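/- Let $p=k/m$ with $k,m$ coprime positive integers, $m$ odd, and $0<p<4$ (for real $t$, $t^{p+1}:=(t^{1/m})^{k+m}$ with the real $m$-th root). Let $\varepsilon\in\{1,-1\}$ and let $c,\alpha\in\mathbb R$ satisfy $\alpha\varepsilon<0$ and $c\alpha<0$. Let $\mathscr Z\subset L^2(\mathbb R^2)$ be the closure of $C_0^\infty(\mathbb R^2)$ for the norm $$\|\varphi\|_{\mathscr Z}^2=\|\varphi\|_{L^2}^2+\|\varphi_y\|_{L^2}^2+\|D_x^{1/2}\varphi\|_{L^2}^2,\qquad \widehat{D_x^{1/2}\varphi}(\xi_1,\xi_2)=|\xi_1|^{1/2}\widehat\varphi(\xi_1,\xi_2),$$ where $\widehat f(\xi_1,\xi_2)=\int_{\mathbb R^2}e^{-\mathrm i(x\xi_1+y\xi_2)}f(x,y)\,dx\,dy$, and let $\mathscr Hu(x,y)=\mathrm{p.v.}\,\frac1\pi\int_{\mathbb R}\frac{u(z,y)}{x-z}\,dz$ be the Hilbert transform in $x$. A solitary wave is a real-valued $\varphi\in\mathscr Z$ which solves $$-c\varphi+\frac1{p+1}\varphi^{p+1}+\alpha\mathscr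 H\varphi_x+\varepsilon\varphi_{yy}=0$$ in the sense of distributions on $\mathbb R^2$. Then every solitary wave $\varphi$ satisfies $$|x|^\ell|y|^\varrho\varphi\in L^\infty(\mathbb R^2)\qquad\text{for all } 0\le\ell\le2\text{ and all }\varrho\ge0.$$ -/

import Mathlib

open MeasureTheory Filter Topology FourierTransform
open scoped ContDiff ENNReal

noncomputable section

namespace BOZK

/-- The plane `ℝ²`; for `v : Plane`, `v 0` is the propagation variable `x` and `v 1` is the
transverse variable `y`. -/
abbrev Plane : Type := EuclideanSpace ℝ (Fin 2)

/-- Test functions: `C_0^∞(ℝ²)`, real-valued. -/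
def IsTest (f : Plane → ℝ) : Prop := ContDiff ℝ ∞ f ∧ HasCompactSupport f

/-- The partial derivative `∂f/∂x`. -/
def dx (f : Plane → ℝ) (v : Plane) : ℝ := lineDeriv ℝ f v (EuclideanSpace.single 0 1)

/-- The partial derivative `∂f/∂y`. -/
def dy (f : Plane → ℝ) (v : Plane) : ℝ := lineDeriv ℝ f v (EuclideanSpace.single 1 1)

/-- The fractional derivative `D_x^{1/2} f`, with symbol `|ξ₁|^{1/2}` with respect to the Fourier
transform with phase `exp (-i (x ξ₁ + y ξ₂))`. Mathlib's phase is
`exp (-2 π i (x ξ₁ + y ξ₂))`, hence the factor `2 π` in the symbol. -/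
def halfDx (f : Plane → ℝ) : Plane → ℂ :=
  𝓕⁻ (fun ξ : Plane => (Real.sqrt (2 * Real.pi * |ξ 0|) : ℂ) * 𝓕 (fun v : Plane => (f v : ℂ)) ξ)

/-- The norm `(‖f‖²_{L²} + ‖f_y‖²_{L²} + ‖D_x^{1/2} f‖²_{L²})^{1/2}`; it is used on test functions
only. -/
def zNorm (f : Plane → ℝ) : ℝ≥0∞ :=
  (eLpNorm f 2 volume ^ 2 + eLpNorm (dy f) 2 volume ^ 2 + eLpNorm (halfDx f) 2 volume ^ 2) ^
    (1 / 2 : ℝ)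

/-- The space `𝒵`, the closure of the test functions for `zNorm`, realized inside `L²(ℝ²)`: the
`L²`-limits of those sequences of test functions that are Cauchy for `zNorm`. -/
def MemZ (f : Plane → ℝ) : Prop :=
  MemLp f 2 volume ∧
    ∃ u : ℕ → Plane → ℝ, (∀ n, IsTest (u n)) ∧
      Tendsto (fun q : ℕ × ℕ => zNorm (u q.1 - u q.2)) atTop (𝓝 0) ∧
      Tendsto (fun n => eLpNorm (u n - f) 2 volume) atTop (𝓝 0)

/-- The Hilbert transform in `x`, the principal value of `(1/π) ∫ f(z, y) / (x - z) dz`. -/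
def hilbertX (f : Plane → ℝ) (v : Plane) : ℝ :=
  limUnder (𝓝[>] (0 : ℝ)) fun δ : ℝ =>
    (1 / Real.pi) * ∫ z in {z : ℝ | δ < |v 0 - z|}, f (!₂[z, v 1]) / (v 0 - z)

/-- The real `m`-th root of the real number `t`, for odd `m`. -/
def oddRoot (m : ℕ) (t : ℝ) : ℝ := Real.sign t * |t| ^ (1 / (m : ℝ))

/-- The real power `t ^ (p + 1)` of the real number `t` for `p = k / m` with `m` odd. -/
def nonlin (k m : ℕ) (t : ℝ) : ℝ := oddRoot m t ^ (k + m)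

/-- `φ` is a solitary wave with parameters `p = k / m`, `c`, `α`, `ε`: it belongs to `𝒵`, and
`-c φ + φ^{p+1} / (p+1) + α H φ_x + ε φ_yy = 0` in the sense of distributions
(both `H ∂_x` and `∂_y²` are symmetric with respect to the `L²` pairing). -/
structure IsSolitaryWave (k m : ℕ) (c α ε : ℝ) (φ : Plane → ℝ) : Prop where
  memZ : MemZ φ
  locallyIntegrable : LocallyIntegrable (fun v => nonlin k m (φ v)) volume
  equation : ∀ ψ : Plane → ℝ, IsTest ψ →
    -c * (∫ v, φ v * ψ v)
      + 1 / ((k : ℝ) / (m : ℝ) + 1) * (∫ v, nonlin k m (φ v) * ψ v)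
      + α * (∫ v, φ v * hilbertX (dx ψ) v)
      + ε * (∫ v, φ v * dy (dy ψ) v) = 0

end BOZK

end

open MeasureTheory Filter Topology FourierTransform
open scoped ContDiff ENNReal

noncomputable section

namespace BOZK

/-! Multiplied by `-ε`, the equation reads `(|c| + |α| H ∂_x - ∂_y²) φ = ε φ^{p+1} / (p + 1)`: the
two sign conditions say exactly that the operator on the left has a positive symbol. Its inverse is
convolution with the superposition over `t > 0`, with weight `e^{-|c| t}`, of products of a Poisson
kernel in `x` (time proportional to `t`) and a heat kernel in `y`. This fundamental solution is a
positive, even, finite measure, so `|φ| ≤ ∫ |φ(w + v)|^{p+1} dρ(v)` almost everywhere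
(`IsSolitaryWave.exists_measurable_rep`). The rest uses only this inequality and the membership of
`φ` in `L^r` for `2 ≤ r < 6`.

The scaling `x ~ t`, `y ~ t^{1/2}` gives the plane the effective dimension `3/2`. Hence the energy
space embeds in `L^r` below the critical exponent `6` (`MemZ.memLp`), and the fundamental solution
sends `L^s` to `L^∞` for `s > 3/2`. Since `|φ|^p` lies in `L^{r/p}` with `r` close to `6`, the
condition `p < 4` makes `|φ|^p` a subcritical potential.

Three steps follow. Boundedness: the part of the potential where `|φ|` is large has small norm, and
a duality argument shows that it cannot support an excess of `|φ|` over a constant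
(`exists_ae_le_of_le_lintegral_resolvent`). First decay: weights `(1+|x|)^a e^{b|y|}` with `a < 1`
and small `b` are submultiplicative and integrable against the fundamental solution; the potential
is small away from a compact set up to a set of small measure, so the weighted supremum is absorbed
(`exists_ae_wt_mul_le`). Bootstrap: the nonlinearity multiplies the rate in `x` by `1 + p`, until
the rate reaches that of the Poisson kernel, which is `|x|^{-2}` (`exists_ae_wt_mul_le_min`). This
kernel tail is what caps `ℓ` at `2`, while exponential decay in `y` beats every power of `|y|`. -/

/-! ### Plancherel's theorem for Fourier integrals. -/

open SchwartzMap in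
/-- **Plancherel's theorem** for the inverse Fourier integral on `L¹ ∩ L²`. -/
theorem fourierInv_memLp_eLpNorm {V : Type*} [NormedAddCommGroup V] [InnerProductSpace ℝ V]
    [FiniteDimensional ℝ V] [MeasurableSpace V] [BorelSpace V] {h : V → ℂ}
    (h1 : Integrable h) (h2 : MemLp h 2) :
    MemLp (𝓕⁻ h) 2 ∧ eLpNorm (𝓕⁻ h) 2 volume = eLpNorm h 2 volume := by
  set H : Lp ℂ 2 (volume : Measure V) := h2.toLp h with hH
  set G : Lp ℂ 2 (volume : Measure V) := 𝓕⁻ H with hG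
  have hcont : Continuous (𝓕⁻ h) :=
    VectorFourier.fourierIntegral_continuous Real.continuous_fourierChar
      (L := -innerₗ V) continuous_inner.neg h1
  -- The Fourier integral and the `L²` extension agree because, paired with any test function `η`,
  -- each gives the integral of `h` against `𝓕⁻ η`.
  have key : 𝓕⁻ h =ᵐ[volume] G := by
    refine ae_eq_of_integral_contDiff_smul_eq hcont.locallyIntegrable
      ((Lp.memLp G).locallyIntegrable (by norm_num)) fun g hg hgc ↦ ?_
    have hc : HasCompactSupport (fun x ↦ (g x : ℂ)) := hgc.comp_left (g := Complex.ofReal) rfl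
    have hs : ContDiff ℝ ∞ (fun x ↦ (g x : ℂ)) := Complex.ofRealCLM.contDiff.comp hg
    set η : 𝓢(V, ℂ) := hc.toSchwartzMap hs with hη
    have e1 : ∫ x, g x • 𝓕⁻ h x = ∫ x, η x • 𝓕⁻ h x := by
      congr
    have e2 : ∫ x, 𝓕⁻ (η : V → ℂ) x • h x = ∫ x, η x • 𝓕⁻ h x := by
      have := VectorFourier.integral_fourierIntegral_smul_eq_flip (μ := volume) (ν := volume)
        Real.continuous_fourierChar
        (L := -innerₗ V) continuous_inner.neg η.integrable h1
      have hf : (-innerₗ V).flip = -innerₗ V := by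
        ext x y; simp [real_inner_comm]
      rw [hf] at this
      exact this
    have e3 : ∫ x, 𝓕⁻ (η : V → ℂ) x • h x = Lp.toTemperedDistribution H (𝓕⁻ η) := by
      rw [Lp.toTemperedDistribution_apply]
      refine integral_congr_ae ?_
      filter_upwards [h2.coeFn_toLp] with x hx
      rw [hx, SchwartzMap.fourierInv_coe]
    have e4 : Lp.toTemperedDistribution H (𝓕⁻ η) = Lp.toTemperedDistribution G η := by
      rw [hG, ← Lp.fourierInv_toTemperedDistribution_eq]
      rfl
    rw [e1, ← e2, e3, e4, Lp.toTemperedDistribution_apply]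
    congr
  refine ⟨(memLp_congr_ae key).2 (Lp.memLp G), ?_⟩
  rw [eLpNorm_congr_ae key, ← eLpNorm_congr_ae h2.coeFn_toLp]
  have : ‖G‖ₑ = ‖H‖ₑ := by
    have h' : ‖𝓕 G‖ = ‖G‖ := Lp.norm_fourier_eq G
    rw [hG, FourierTransform.fourier_fourierInv_eq, ← hG] at h'
    rw [← ofReal_norm, ← ofReal_norm, h']
  rwa [Lp.enorm_def, Lp.enorm_def] at this

/-! ### Poisson and heat kernels, and their product on the plane. -/

/-- Coordinates on the plane. -/
def planeEquiv : ℝ × ℝ ≃ᵐ Plane :=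
  MeasurableEquiv.finTwoArrow.symm.trans (MeasurableEquiv.toLp 2 (Fin 2 → ℝ))

@[simp] theorem planeEquiv_zero (p : ℝ × ℝ) : planeEquiv p 0 = p.1 := rfl

@[simp] theorem planeEquiv_one (p : ℝ × ℝ) : planeEquiv p 1 = p.2 := rfl

theorem measurePreserving_planeEquiv : MeasurePreserving planeEquiv volume volume :=
  ((volume_preserving_finTwoArrow ℝ).symm _).trans (PiLp.volume_preserving_toLp (Fin 2))

theorem lintegral_plane_mul {f g : ℝ → ℝ≥0∞} (hf : Measurable f) (hg : Measurable g) :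
    ∫⁻ v : Plane, f (v 0) * g (v 1) = (∫⁻ x, f x) * ∫⁻ y, g y := by
  rw [← measurePreserving_planeEquiv.lintegral_comp_emb planeEquiv.measurableEmbedding]
  simp only [planeEquiv_zero, planeEquiv_one]
  rw [Measure.volume_eq_prod, lintegral_prod_mul hf.aemeasurable hg.aemeasurable]

theorem integrable_plane_mul {f g : ℝ → ℂ} (hf : Integrable f) (hg : Integrable g) :
    Integrable fun v : Plane ↦ f (v 0) * g (v 1) := by
  rw [← measurePreserving_planeEquiv.integrable_comp_emb planeEquiv.measurableEmbedding]
  exact hf.mul_prod hg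

theorem integral_plane_mul (f g : ℝ → ℂ) :
    ∫ v : Plane, f (v 0) * g (v 1) = (∫ x, f x) * ∫ y, g y := by
  rw [← measurePreserving_planeEquiv.integral_comp planeEquiv.measurableEmbedding]
  simp only [planeEquiv_zero, planeEquiv_one]
  rw [Measure.volume_eq_prod]
  exact integral_prod_mul f g

theorem inner_plane (u v : Plane) : inner ℝ u v = u 0 * v 0 + u 1 * v 1 := by
  simp [PiLp.inner_apply, Fin.sum_univ_two, mul_comm]

theorem fourier_plane_mul (f g : ℝ → ℂ) (ξ : Plane) :
    𝓕 (fun v : Plane ↦ f (v 0) * g (v 1)) ξ = 𝓕 f (ξ 0) * 𝓕 g (ξ 1) := by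
  rw [Real.fourier_eq, Real.fourier_eq, Real.fourier_eq, ← integral_plane_mul]
  congr 1 with v
  simp only [inner_plane, Circle.smul_def, smul_eq_mul, Real.fourierChar_apply, neg_add]
  simp only [RCLike.inner_apply, conj_trivial]
  rw [mul_add, Complex.ofReal_add, add_mul, Complex.exp_add]
  ring_nf

/-- The Poisson kernel of the half plane. -/
def poisson (a x : ℝ) : ℝ := a / (a ^ 2 + x ^ 2) / Real.pi

/-- The heat kernel of the line. -/
def heat (t y : ℝ) : ℝ := Real.exp (-(y ^ 2 / (4 * t))) / Real.sqrt (4 * Real.pi * t)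

theorem poisson_nonneg {a : ℝ} (ha : 0 ≤ a) (x : ℝ) : 0 ≤ poisson a x := by
  unfold poisson; positivity

theorem heat_nonneg (t y : ℝ) : 0 ≤ heat t y := by
  unfold heat; positivity

theorem integrable_exp_neg_abs {b : ℝ} (hb : 0 < b) :
    Integrable fun ξ : ℝ ↦ Real.exp (-b * |ξ|) := by
  have h1 : IntegrableOn (fun ξ : ℝ ↦ Real.exp (-b * |ξ|)) (Set.Ioi 0) :=
    (integrableOn_exp_mul_Ioi (neg_lt_zero.2 hb) 0).congr_fun
      (fun x hx ↦ by simp [abs_of_pos (Set.mem_Ioi.1 hx)]) measurableSet_Ioi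
  have h2 : IntegrableOn (fun ξ : ℝ ↦ Real.exp (-b * |ξ|)) (Set.Iic 0) :=
    (integrableOn_exp_mul_Iic hb 0).congr_fun
      (fun x hx ↦ by simp [abs_of_nonpos (Set.mem_Iic.1 hx)]) measurableSet_Iic
  have := h2.union h1
  rwa [Set.Iic_union_Ioi, integrableOn_univ] at this

theorem integrable_poisson {a : ℝ} (ha : 0 < a) : Integrable (poisson a) := by
  have := ProbabilityTheory.integrable_cauchyPDFReal 0 (γ := a.toNNReal)
  refine this.congr (Eventually.of_forall fun x ↦ ?_)
  simp only [ProbabilityTheory.cauchyPDFReal, poisson, Real.coe_toNNReal a ha.le, sub_zero]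
  rw [add_comm (x ^ 2)]; field_simp

/-- On each half line the integrand is a complex exponential, so the integral is elementary in this
direction; the transform of the kernel itself then comes from Fourier inversion. -/
theorem fourierInv_exp_neg_abs {a : ℝ} (ha : 0 < a) (x : ℝ) :
    𝓕⁻ (fun ξ : ℝ ↦ (Real.exp (-(2 * Real.pi * a) * |ξ|) : ℂ)) x = poisson a x := by
  have hpi := Real.pi_pos
  set p : ℂ := 2 * Real.pi * (-a + x * Complex.I) with hp
  set q : ℂ := 2 * Real.pi * (a + x * Complex.I) with hq
  have hpre : p.re < 0 := by simp [hp]; positivity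
  have hqre : 0 < q.re := by simp [hq]; positivity
  set f : ℝ → ℂ := fun ξ ↦ Real.fourierChar (inner ℝ ξ x) •
    (Real.exp (-(2 * Real.pi * a) * |ξ|) : ℂ) with hf
  have hfp : ∀ ξ ∈ Set.Ioi (0 : ℝ), Complex.exp (p * ξ) = f ξ := by
    intro ξ hξ
    simp only [hf, hp, Circle.smul_def, Real.fourierChar_apply, abs_of_pos (Set.mem_Ioi.1 hξ),
      smul_eq_mul, Complex.ofReal_exp, ← Complex.exp_add, RCLike.inner_apply, conj_trivial]
    congr 1; push_cast; ring
  have hfq : ∀ ξ ∈ Set.Iic (0 : ℝ), Complex.exp (q * ξ) = f ξ := by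
    intro ξ hξ
    simp only [hf, hq, Circle.smul_def, Real.fourierChar_apply, abs_of_nonpos (Set.mem_Iic.1 hξ),
      smul_eq_mul, Complex.ofReal_exp, ← Complex.exp_add, RCLike.inner_apply, conj_trivial]
    congr 1; push_cast; ring
  have i1 : IntegrableOn f (Set.Ioi 0) :=
    (integrableOn_exp_mul_complex_Ioi hpre 0).congr_fun hfp measurableSet_Ioi
  have i2 : IntegrableOn f (Set.Iic 0) :=
    (integrableOn_exp_mul_complex_Iic hqre 0).congr_fun hfq measurableSet_Iic
  rw [Real.fourierInv_eq, ← intervalIntegral.integral_Iic_add_Ioi i2 i1,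
    ← setIntegral_congr_fun measurableSet_Ioi hfp, ← setIntegral_congr_fun measurableSet_Iic hfq,
    integral_exp_mul_complex_Ioi hpre, integral_exp_mul_complex_Iic hqre]
  have hp0 : (-a + x * Complex.I : ℂ) ≠ 0 := by
    intro h; have := congrArg Complex.re h; simp at this; exact ha.ne' this
  have hq0 : (a + x * Complex.I : ℂ) ≠ 0 := by
    intro h; have := congrArg Complex.re h; simp at this; exact ha.ne' this
  have hpiC : (Real.pi : ℂ) ≠ 0 := by exact_mod_cast hpi.ne'
  have hs : ((a : ℂ) ^ 2 + (x : ℂ) ^ 2) ≠ 0 := by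
    have : a ^ 2 + x ^ 2 ≠ 0 := by positivity
    exact_mod_cast this
  simp only [hp, hq, poisson, Complex.ofReal_zero, mul_zero, Complex.exp_zero]
  push_cast
  field_simp
  ring_nf
  simp only [Complex.I_sq]
  ring

theorem fourier_poisson {a : ℝ} (ha : 0 < a) (ξ : ℝ) :
    𝓕 (fun x : ℝ ↦ (poisson a x : ℂ)) ξ = Real.exp (-(2 * Real.pi * a) * |ξ|) := by
  have hpi := Real.pi_pos
  have h0 : 𝓕⁻ (fun ξ : ℝ ↦ (Real.exp (-(2 * Real.pi * a) * |ξ|) : ℂ)) =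
      fun x ↦ (poisson a x : ℂ) := funext fun x ↦ fourierInv_exp_neg_abs ha x
  have hint : Integrable (fun ξ : ℝ ↦ (Real.exp (-(2 * Real.pi * a) * |ξ|) : ℂ)) :=
    (integrable_exp_neg_abs (by positivity)).ofReal
  have hc : Continuous (fun ξ : ℝ ↦ (Real.exp (-(2 * Real.pi * a) * |ξ|) : ℂ)) := by fun_prop
  -- Inversion needs an integrable transform; here it is the reflected Poisson kernel.
  have hF : Integrable (𝓕 (fun ξ : ℝ ↦ (Real.exp (-(2 * Real.pi * a) * |ξ|) : ℂ))) := by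
    have : 𝓕 (fun ξ : ℝ ↦ (Real.exp (-(2 * Real.pi * a) * |ξ|) : ℂ)) =
        fun x ↦ ((poisson a (-x) : ℝ) : ℂ) := by
      funext x
      rw [← fourierInv_exp_neg_abs ha, Real.fourierInv_eq_fourier_neg, neg_neg]
    rw [this]
    exact ((integrable_poisson ha).comp_neg).ofReal
  have := hc.fourier_fourierInv_eq hint hF
  rw [h0] at this
  exact congrFun this ξ

theorem fourier_heat {t : ℝ} (ht : 0 < t) (η : ℝ) :
    𝓕 (fun y : ℝ ↦ (heat t y : ℂ)) η = Real.exp (-(t * (4 * Real.pi ^ 2 * η ^ 2))) := by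
  have hpi := Real.pi_pos
  set b : ℝ := 1 / (4 * Real.pi * t) with hb
  have hb0 : 0 < b := by positivity
  have hG := congrFun (fourier_gaussian_pi' (b := b) (by simpa using hb0) 0) η
  have e1 : (fun y : ℝ ↦ (heat t y : ℂ)) = fun y : ℝ ↦ (1 / Real.sqrt (4 * Real.pi * t) : ℂ) •
      Complex.exp (-Real.pi * b * y ^ 2 + 2 * Real.pi * 0 * y) := by
    funext y
    have : (-Real.pi * b * y ^ 2 + 2 * Real.pi * 0 * y : ℂ) = ((-(y ^ 2 / (4 * t)) : ℝ) : ℂ) := by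
      have hpiC : (Real.pi : ℂ) ≠ 0 := by exact_mod_cast hpi.ne'
      have htC : (t : ℂ) ≠ 0 := by exact_mod_cast ht.ne'
      simp only [hb]; push_cast; field_simp; ring
    rw [this, heat, ← Complex.ofReal_exp]
    push_cast; rw [smul_eq_mul]; ring
  have e2 : 𝓕 (fun y : ℝ ↦ (heat t y : ℂ)) η = (1 / Real.sqrt (4 * Real.pi * t) : ℂ) •
      𝓕 (fun y : ℝ ↦ Complex.exp (-Real.pi * b * y ^ 2 + 2 * Real.pi * 0 * y)) η := by
    rw [e1, Real.fourier_eq, Real.fourier_eq, ← integral_smul]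
    congr 1 with y
    rw [smul_comm]
  rw [e2, hG]
  have hs : ((b : ℂ) ^ (1 / 2 : ℂ)) = ((b ^ (1 / 2 : ℝ) : ℝ) : ℂ) := by
    rw [Complex.ofReal_cpow hb0.le]; simp
  rw [hs, ← Real.sqrt_eq_rpow]
  have hexp : (-Real.pi / b * (η + Complex.I * 0) ^ 2 : ℂ) =
      ((-(t * (4 * Real.pi ^ 2 * η ^ 2)) : ℝ) : ℂ) := by
    have hpiC : (Real.pi : ℂ) ≠ 0 := by exact_mod_cast hpi.ne'
    have htC : (t : ℂ) ≠ 0 := by exact_mod_cast ht.ne'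
    simp only [hb]; push_cast; field_simp; ring
  rw [hexp, ← Complex.ofReal_exp, smul_eq_mul]
  norm_cast
  rw [hb, one_div (4 * Real.pi * t), Real.sqrt_inv]
  have : Real.sqrt (4 * Real.pi * t) ≠ 0 := by positivity
  field_simp

theorem integrable_heat {t : ℝ} (ht : 0 < t) : Integrable (heat t) := by
  have := (integrable_exp_neg_mul_sq (b := 1 / (4 * t)) (by positivity)).div_const
    (Real.sqrt (4 * Real.pi * t))
  refine this.congr (Eventually.of_forall fun y ↦ ?_)
  simp only [heat]; congr 2; ring

/-- The convolution kernel on the plane with symbol `exp (-t symb A)`. -/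
def kern (A t : ℝ) (v : Plane) : ℝ := poisson (A * t) (v 0) * heat t (v 1)

/-- The symbol of `A (-∂_x²)^{1/2} - ∂_y²`. -/
def symb (A : ℝ) (ξ : Plane) : ℝ := 2 * Real.pi * A * |ξ 0| + 4 * Real.pi ^ 2 * ξ 1 ^ 2

theorem symb_nonneg {A : ℝ} (hA : 0 ≤ A) (ξ : Plane) : 0 ≤ symb A ξ := by
  have := Real.pi_pos
  unfold symb; positivity

theorem continuous_symb (A : ℝ) : Continuous (symb A) := by
  unfold symb; fun_prop

theorem kern_nonneg {A t : ℝ} (hA : 0 ≤ A) (ht : 0 ≤ t) (v : Plane) : 0 ≤ kern A t v :=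
  mul_nonneg (poisson_nonneg (by positivity) _) (heat_nonneg _ _)

theorem kern_neg (A t : ℝ) (v : Plane) : kern A t (-v) = kern A t v := by
  simp [kern, poisson, heat]

theorem measurable_kern (A : ℝ) : Measurable fun p : ℝ × Plane ↦ kern A p.1 p.2 := by
  unfold kern poisson heat; fun_prop

theorem integrable_kern {A t : ℝ} (hA : 0 < A) (ht : 0 < t) : Integrable (kern A t) := by
  have := integrable_plane_mul (integrable_poisson (mul_pos hA ht)).ofReal
    (integrable_heat ht).ofReal
  have h2 := this.re
  refine h2.congr (Eventually.of_forall fun v ↦ ?_)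
  simp [kern]

theorem fourier_kern {A t : ℝ} (hA : 0 < A) (ht : 0 < t) (ξ : Plane) :
    𝓕 (fun v ↦ (kern A t v : ℂ)) ξ = Real.exp (-(t * symb A ξ)) := by
  have h := fourier_plane_mul (fun x ↦ (poisson (A * t) x : ℂ)) (fun y ↦ (heat t y : ℂ)) ξ
  rw [fourier_poisson (mul_pos hA ht), fourier_heat ht, ← Complex.ofReal_mul, ← Real.exp_add] at h
  simp only [kern, Complex.ofReal_mul]
  rw [h]
  congr 2
  unfold symb; ring

theorem integral_kern {A t : ℝ} (hA : 0 < A) (ht : 0 < t) : ∫ v, kern A t v = 1 := by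
  have h := fourier_kern hA ht 0
  rw [Real.fourier_eq] at h
  simp only [inner_zero_right, neg_zero, AddChar.map_zero_eq_one, one_smul, symb] at h
  rw [integral_complex_ofReal] at h
  simpa using h

theorem lintegral_kern {A t : ℝ} (hA : 0 < A) (ht : 0 < t) :
    ∫⁻ v, ENNReal.ofReal (kern A t v) = 1 := by
  rw [← ofReal_integral_eq_lintegral_ofReal (integrable_kern hA ht)
    (Eventually.of_forall fun v ↦ kern_nonneg hA.le ht.le v), integral_kern hA ht,
    ENNReal.ofReal_one]

theorem poisson_le {a : ℝ} (ha : 0 < a) (x : ℝ) : poisson a x ≤ 1 / a := by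
  unfold poisson
  have h1 : a / (a ^ 2 + x ^ 2) ≤ 1 / a := by
    rw [div_le_div_iff₀ (by positivity) ha]; nlinarith [sq_nonneg x]
  have h2 : a / (a ^ 2 + x ^ 2) / Real.pi ≤ a / (a ^ 2 + x ^ 2) :=
    div_le_self (by positivity) (by linarith [Real.pi_gt_three])
  exact h2.trans h1

theorem heat_le {t : ℝ} (ht : 0 < t) (y : ℝ) : heat t y ≤ t ^ (-(1 / 2) : ℝ) := by
  unfold heat
  have h0 : t ^ (-(1 / 2) : ℝ) = 1 / Real.sqrt t := by
    rw [Real.rpow_neg ht.le, ← Real.sqrt_eq_rpow, one_div]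
  rw [h0]
  have h1 : Real.exp (-(y ^ 2 / (4 * t))) ≤ 1 := Real.exp_le_one_iff.2 (by
    have : 0 ≤ y ^ 2 / (4 * t) := by positivity
    linarith)
  have h2 : Real.sqrt t ≤ Real.sqrt (4 * Real.pi * t) :=
    Real.sqrt_le_sqrt (by nlinarith [Real.pi_gt_three])
  exact div_le_div₀ zero_le_one h1 (Real.sqrt_pos.2 ht) h2

/-- Mass one is spread over a region of size `t` in `x` and `t^{1/2}` in `y`. The exponent `3/2` is
the effective dimension behind every critical exponent below. -/
theorem kern_le {A t : ℝ} (hA : 0 < A) (ht : 0 < t) (v : Plane) :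
    kern A t v ≤ 1 / A * t ^ (-(3 / 2) : ℝ) := by
  have h := mul_le_mul (poisson_le (mul_pos hA ht) (v 0)) (heat_le ht (v 1)) (heat_nonneg _ _)
    (by positivity)
  refine h.trans (le_of_eq ?_)
  have : t ^ (-(3 / 2) : ℝ) = t⁻¹ * t ^ (-(1 / 2) : ℝ) := by
    rw [← Real.rpow_neg_one, ← Real.rpow_add ht]; norm_num
  rw [this]; field_simp

theorem integrableOn_rpow_mul_exp {s c : ℝ} (hs : -1 < s) (hc : 0 < c) :
    IntegrableOn (fun t : ℝ ↦ t ^ s * Real.exp (-(c * t))) (Set.Ioi 0) := by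
  have := integrableOn_rpow_mul_exp_neg_mul_rpow (p := 1) (s := s) (b := c) hs one_pos hc
  simpa using this

theorem lintegral_rpow_mul_exp_lt_top {s c : ℝ} (hs : -1 < s) (hc : 0 < c) :
    ∫⁻ t in Set.Ioi (0 : ℝ), ENNReal.ofReal (t ^ s * Real.exp (-(c * t))) < ⊤ :=
  (integrableOn_rpow_mul_exp hs hc).lintegral_lt_top

/-! ### Resolvent powers as integrals over time. -/

/-- This is the identity `∫ 𝓕 f · g = ∫ f · 𝓕 g`, with the translation by `u` carried as a
modulation of `h`. -/
theorem integral_kern_mul_fourierInv {A t : ℝ} (hA : 0 < A) (ht : 0 < t) {h : Plane → ℂ}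
    (hh : Integrable h) (u : Plane) :
    ∫ v, (kern A t v : ℂ) * 𝓕⁻ h (u - v) =
      𝓕⁻ (fun ξ ↦ (Real.exp (-(t * symb A ξ)) : ℂ) * h ξ) u := by
  set hu : Plane → ℂ := fun ξ ↦ Real.fourierChar (inner ℝ ξ u) • h ξ with hhu
  have hui : Integrable hu := by
    refine hh.norm.mono' ?_ (Eventually.of_forall fun ξ ↦ by simp [hu])
    exact (Real.continuous_fourierChar.comp (by fun_prop)).aestronglyMeasurable.smul hh.1
  have e1 : ∀ v, 𝓕⁻ h (u - v) = 𝓕 hu v := by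
    intro v
    rw [Real.fourierInv_eq, Real.fourier_eq]
    congr 1 with ξ
    rw [hhu, smul_smul, ← AddChar.map_add_eq_mul, inner_sub_right]
    congr 2; ring
  have e2 := VectorFourier.integral_fourierIntegral_smul_eq_flip (μ := volume) (ν := volume)
    (L := innerₗ Plane) Real.continuous_fourierChar continuous_inner hui
    (integrable_kern hA ht).ofReal (𝕜 := ℝ) (F := ℂ)
  rw [flip_innerₗ] at e2
  have e3 : ∫ v, 𝓕 hu v • (kern A t v : ℂ) =
      ∫ ξ, hu ξ • 𝓕 (fun v ↦ (kern A t v : ℂ)) ξ := e2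
  calc ∫ v, (kern A t v : ℂ) * 𝓕⁻ h (u - v) = ∫ v, 𝓕 hu v • (kern A t v : ℂ) := by
        congr 1 with v; rw [e1, smul_eq_mul, mul_comm]
    _ = ∫ ξ, hu ξ • 𝓕 (fun v ↦ (kern A t v : ℂ)) ξ := e3
    _ = _ := by
        rw [Real.fourierInv_eq]
        congr 1 with ξ
        rw [fourier_kern hA ht, hhu]
        simp only [Circle.smul_def, smul_eq_mul]; ring

/-- The resolvent powers `(c + symb A) ^ (-σ)` as superpositions of the kernels `kern A t`. -/
theorem integral_rpow_mul_kern_mul_fourierInv {A c σ : ℝ} (hA : 0 < A) (hc : 0 < c) (hσ : 0 < σ)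
    {H : Plane → ℂ} (hH : Integrable H) (u : Plane) :
    ∫ t in Set.Ioi (0 : ℝ), ((t ^ (σ - 1) * Real.exp (-(c * t)) : ℝ) : ℂ) *
        ∫ v, (kern A t v : ℂ) * 𝓕⁻ H (u - v) =
      Real.Gamma σ * 𝓕⁻ (fun ξ ↦ (((c + symb A ξ) ^ (-σ) : ℝ) : ℂ) * H ξ) u := by
  have hw : ∀ ξ, 0 < c + symb A ξ := fun ξ ↦ by linarith [symb_nonneg hA.le ξ]
  set G : ℝ → Plane → ℂ := fun t ξ ↦ ((t ^ (σ - 1) * Real.exp (-(c * t)) : ℝ) : ℂ) *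
    (Real.fourierChar (inner ℝ ξ u) • ((Real.exp (-(t * symb A ξ)) : ℂ) * H ξ)) with hG
  have e1 : ∫ t in Set.Ioi (0 : ℝ), ((t ^ (σ - 1) * Real.exp (-(c * t)) : ℝ) : ℂ) *
        ∫ v, (kern A t v : ℂ) * 𝓕⁻ H (u - v) = ∫ t in Set.Ioi (0 : ℝ), ∫ ξ, G t ξ := by
    refine setIntegral_congr_fun measurableSet_Ioi fun t ht ↦ ?_
    simp only [hG]
    rw [integral_kern_mul_fourierInv hA ht hH, Real.fourierInv_eq, integral_const_mul]
  have hgam := integrableOn_rpow_mul_exp (s := σ - 1) (by linarith) hc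
  -- As `symb` is nonnegative, the Gamma density times `‖H‖` is a majorant. After the swap, the time
  -- integral is a Gamma integral with rate `c + symb A ξ`.
  have hGi : Integrable (Function.uncurry G) ((volume.restrict (Set.Ioi (0 : ℝ))).prod volume) := by
    refine Integrable.mono' (hgam.mul_prod hH.norm) ?_ ?_
    · have m1 : Measurable fun p : ℝ × Plane ↦
          ((p.1 ^ (σ - 1) * Real.exp (-(c * p.1)) : ℝ) : ℂ) := by fun_prop
      have m2 : Continuous fun p : ℝ × Plane ↦ Real.fourierChar (inner ℝ p.2 u) :=
        Real.continuous_fourierChar.comp (g := Real.fourierChar) (by fun_prop)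
      have m3 : Measurable fun p : ℝ × Plane ↦ (Real.exp (-(p.1 * symb A p.2)) : ℂ) :=
        (Continuous.measurable (by have := continuous_symb A; fun_prop))
      exact m1.aestronglyMeasurable.mul
        (m2.aestronglyMeasurable.smul (m3.aestronglyMeasurable.mul hH.1.comp_snd))
    · have : ∀ᵐ p : ℝ × Plane ∂((volume.restrict (Set.Ioi (0 : ℝ))).prod volume), 0 < p.1 := by
        have h0 : ∀ᵐ t ∂(volume.restrict (Set.Ioi (0 : ℝ))), 0 < t :=
          ae_restrict_mem measurableSet_Ioi
        exact Measure.quasiMeasurePreserving_fst.ae h0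
      filter_upwards [this] with p hp
      simp only [hG, Function.uncurry, norm_mul, Circle.norm_smul, Complex.norm_real,
        Real.norm_eq_abs]
      rw [abs_of_nonneg (by positivity : 0 ≤ p.1 ^ (σ - 1)), abs_of_pos (Real.exp_pos _)]
      have : |Real.exp (-(p.1 * symb A p.2))| ≤ 1 := by
        rw [abs_of_pos (Real.exp_pos _), Real.exp_le_one_iff]
        have := mul_nonneg hp.le (symb_nonneg hA.le p.2)
        linarith
      calc _ ≤ p.1 ^ (σ - 1) * Real.exp (-(c * p.1)) * (1 * ‖H p.2‖) := by gcongr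
        _ = _ := by rw [one_mul]
  rw [e1, integral_integral_swap hGi, Real.fourierInv_eq, ← integral_const_mul]
  congr 1 with ξ
  have e2 : ∀ t : ℝ, G t ξ = ((t ^ (σ - 1) * Real.exp (-((c + symb A ξ) * t)) : ℝ) : ℂ) *
      (Real.fourierChar (inner ℝ ξ u) • H ξ) := by
    intro t
    simp only [hG, Circle.smul_def, smul_eq_mul]
    have : Real.exp (-((c + symb A ξ) * t)) =
      Real.exp (-(c * t)) * Real.exp (-(t * symb A ξ)) := by
      rw [← Real.exp_add]; congr 1; ring
    rw [this]; push_cast; ring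
  simp only [e2]
  rw [integral_mul_const, integral_complex_ofReal, Real.integral_rpow_mul_exp_neg_mul_Ioi hσ (hw ξ)]
  rw [one_div, Real.inv_rpow (hw ξ).le, ← Real.rpow_neg (hw ξ).le]
  simp only [Circle.smul_def, smul_eq_mul]
  push_cast; ring

/-! ### Test functions and the energy norm on the Fourier side. -/

theorem IsTest.continuous {f : Plane → ℝ} (hf : IsTest f) : Continuous f := hf.1.continuous

theorem IsTest.sub {f g : Plane → ℝ} (hf : IsTest f) (hg : IsTest g) : IsTest (f - g) :=
  ⟨hf.1.sub hg.1, by rw [sub_eq_add_neg]; exact hf.2.add hg.2.neg⟩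

theorem IsTest.lineDeriv_eq {f : Plane → ℝ} (hf : IsTest f) (v e : Plane) :
    lineDeriv ℝ f v e = fderiv ℝ f v e :=
  (hf.1.differentiable (by simp) v).lineDeriv_eq_fderiv

theorem IsTest.lineDeriv {f : Plane → ℝ} (hf : IsTest f) (e : Plane) :
    IsTest fun v ↦ lineDeriv ℝ f v e := by
  simp only [hf.lineDeriv_eq]
  exact ⟨(hf.1.fderiv_right (m := ∞) (by simp)).clm_apply contDiff_const, hf.2.fderiv_apply ℝ e⟩

theorem IsTest.dy {f : Plane → ℝ} (hf : IsTest f) : IsTest (dy f) := hf.lineDeriv _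

theorem IsTest.comp_sub {f : Plane → ℝ} (hf : IsTest f) (v : Plane) : IsTest fun u ↦ f (u - v) :=
  ⟨hf.1.comp (contDiff_id.sub contDiff_const),
    hf.2.comp_homeomorph (Homeomorph.subRight v)⟩

theorem IsTest.memLp {f : Plane → ℝ} (hf : IsTest f) (p : ℝ≥0∞) : MemLp f p volume :=
  hf.continuous.memLp_of_hasCompactSupport hf.2

/-- The complexification of a test function, as a Schwartz function. -/
def IsTest.toSchwartz {f : Plane → ℝ} (hf : IsTest f) : SchwartzMap Plane ℂ :=
  (hf.2.comp_left (g := Complex.ofReal) rfl).toSchwartzMap (Complex.ofRealCLM.contDiff.comp hf.1)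

theorem IsTest.toSchwartz_apply {f : Plane → ℝ} (hf : IsTest f) (v : Plane) :
    hf.toSchwartz v = f v := rfl

/-- The Fourier transform of a real function on the plane. -/
def fhat (f : Plane → ℝ) : Plane → ℂ := 𝓕 fun v ↦ (f v : ℂ)

theorem IsTest.fhat_eq {f : Plane → ℝ} (hf : IsTest f) : fhat f = 𝓕 hf.toSchwartz := rfl

theorem IsTest.continuous_fhat {f : Plane → ℝ} (hf : IsTest f) : Continuous (fhat f) := by
  rw [hf.fhat_eq]; exact (𝓕 hf.toSchwartz).continuous

theorem IsTest.fourierInv_fhat {f : Plane → ℝ} (hf : IsTest f) :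
    𝓕⁻ (fhat f) = fun v ↦ (f v : ℂ) := by
  have : 𝓕⁻ (𝓕 hf.toSchwartz) = hf.toSchwartz := FourierTransform.fourierInv_fourier_eq _
  have h2 := congrArg (fun g : SchwartzMap Plane ℂ ↦ (g : Plane → ℂ)) this
  simp only [SchwartzMap.fourierInv_coe] at h2
  exact h2

theorem IsTest.exists_norm_fhat_le {f : Plane → ℝ} (hf : IsTest f) (k : ℕ) :
    ∃ C, 0 ≤ C ∧ ∀ ξ, ‖fhat f ξ‖ ≤ C * (1 + ‖ξ‖) ^ (-(k : ℝ)) := by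
  refine ⟨2 ^ k * ((Finset.Iic (k, 0)).sup fun m => SchwartzMap.seminorm ℝ m.1 m.2)
    (𝓕 hf.toSchwartz), by positivity, fun ξ ↦ ?_⟩
  have := SchwartzMap.one_add_le_sup_seminorm_apply (𝕜 := ℝ) (m := (k, 0)) (k := k) (n := 0) le_rfl
    le_rfl (𝓕 hf.toSchwartz) ξ
  rw [norm_iteratedFDeriv_zero] at this
  have h1 : 0 < 1 + ‖ξ‖ := by positivity
  rw [Real.rpow_neg h1.le, Real.rpow_natCast, ← div_eq_mul_inv, le_div_iff₀ (by positivity),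
    mul_comm]
  exact this

/-- A multiplier of polynomial growth applied to the Fourier transform of a test function gives
an element of `L¹ ∩ L²`. -/
theorem IsTest.mul_fhat {f : Plane → ℝ} (hf : IsTest f) {m : Plane → ℂ} (hm : Continuous m) {C : ℝ}
    (hC : ∀ ξ, ‖m ξ‖ ≤ C * (1 + ‖ξ‖) ^ 2) :
    Integrable (fun ξ ↦ m ξ * fhat f ξ) ∧ MemLp (fun ξ ↦ m ξ * fhat f ξ) 2 := by
  -- Order `5` against growth of order `2` leaves decay of order `3`, more than the dimension `2`;
  -- the square then decays with order `6`.
  obtain ⟨D, hD, hDf⟩ := hf.exists_norm_fhat_le 5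
  have hC0 : 0 ≤ C := by have := (norm_nonneg _).trans (hC 0); simpa using this
  have hb : ∀ ξ, ‖m ξ * fhat f ξ‖ ≤ C * D * (1 + ‖ξ‖) ^ (-3 : ℝ) := by
    intro ξ
    have h1 : 0 < 1 + ‖ξ‖ := by positivity
    rw [norm_mul]
    calc _ ≤ (C * (1 + ‖ξ‖) ^ 2) * (D * (1 + ‖ξ‖) ^ (-((5 : ℕ) : ℝ))) := by
          gcongr
          · exact hC ξ
          · exact hDf ξ
      _ = C * D * ((1 + ‖ξ‖) ^ (2 : ℝ) * (1 + ‖ξ‖) ^ (-((5 : ℕ) : ℝ))) := by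
          rw [Real.rpow_two]; ring
      _ = _ := by rw [← Real.rpow_add h1]; norm_num
  have hmeas : AEStronglyMeasurable (fun ξ ↦ m ξ * fhat f ξ) volume :=
    (hm.mul hf.continuous_fhat).aestronglyMeasurable
  have hpos : ∀ ξ : Plane, 0 < 1 + ‖ξ‖ := fun ξ ↦ by positivity
  have i1 : Integrable (fun ξ : Plane ↦ C * D * (1 + ‖ξ‖) ^ (-3 : ℝ)) :=
    (integrable_one_add_norm (by simp; norm_num)).const_mul _
  have i2 : MemLp (fun ξ : Plane ↦ C * D * (1 + ‖ξ‖) ^ (-3 : ℝ)) 2 := by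
    rw [memLp_two_iff_integrable_sq i1.1]
    have := (integrable_one_add_norm (E := Plane) (μ := volume) (r := 6)
      (by simp; norm_num)).const_mul ((C * D) ^ 2)
    refine this.congr (Eventually.of_forall fun ξ ↦ ?_)
    simp only
    rw [mul_pow (C * D), ← Real.rpow_natCast (_ ^ (-3 : ℝ)) 2, ← Real.rpow_mul (hpos ξ).le]
    norm_num
  refine ⟨i1.mono' hmeas (Eventually.of_forall hb), i2.of_le hmeas (Eventually.of_forall fun ξ ↦ ?_)⟩
  rw [Real.norm_of_nonneg (by have := hpos ξ; positivity)]
  exact hb ξ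

theorem norm_coord_le (ξ : Plane) (i : Fin 2) : |ξ i| ≤ ‖ξ‖ := by
  simpa using PiLp.norm_apply_le ξ i

theorem IsTest.fhat_dy {f : Plane → ℝ} (hf : IsTest f) (ξ : Plane) :
    fhat (BOZK.dy f) ξ = 2 * Real.pi * Complex.I * ξ 1 * fhat f ξ := by
  have h := SchwartzMap.fourier_lineDerivOp_eq hf.toSchwartz (EuclideanSpace.single (1 : Fin 2) 1)
  have e : hf.dy.toSchwartz = LineDeriv.lineDerivOp (EuclideanSpace.single (1 : Fin 2) (1 : ℝ))
      hf.toSchwartz := by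
    ext v
    rw [SchwartzMap.lineDerivOp_apply_eq_fderiv, hf.dy.toSchwartz_apply, BOZK.dy, hf.lineDeriv_eq]
    have hd : HasFDerivAt hf.toSchwartz (Complex.ofRealCLM.comp (fderiv ℝ f v)) v :=
      Complex.ofRealCLM.hasFDerivAt.comp v (hf.1.differentiable (by simp) v).hasFDerivAt
    rw [hd.fderiv]; rfl
  rw [hf.dy.fhat_eq, hf.fhat_eq, e, h]
  rw [_root_.smul_apply, SchwartzMap.smulLeftCLM_apply_apply (by fun_prop)]
  simp [EuclideanSpace.inner_single_right]
  ring

theorem lintegral_enorm_sq_eq {g : Plane → ℂ} :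
    eLpNorm g 2 volume ^ 2 = ∫⁻ v, ‖g v‖ₑ ^ 2 := by
  have := eLpNorm_nnreal_pow_eq_lintegral (μ := (volume : Measure Plane)) (f := g) (p := 2)
    two_ne_zero
  simpa using this

theorem eLpNorm_ofReal {f : Plane → ℝ} (p : ℝ≥0∞) :
    eLpNorm (fun v ↦ (f v : ℂ)) p volume = eLpNorm f p volume :=
  eLpNorm_congr_norm_ae (Eventually.of_forall fun v ↦ by simp)

theorem IsTest.lintegral_fhat {f : Plane → ℝ} (hf : IsTest f) :
    ∫⁻ ξ, ‖fhat f ξ‖ₑ ^ 2 = eLpNorm f 2 volume ^ 2 := by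
  have h := hf.mul_fhat (m := 1) continuous_const (C := 1) (fun ξ ↦ by
    simp only [Pi.one_apply, norm_one]; nlinarith [norm_nonneg ξ])
  simp only [Pi.one_apply, one_mul] at h
  have := (fourierInv_memLp_eLpNorm h.1 h.2).2
  rw [hf.fourierInv_fhat, eLpNorm_ofReal] at this
  rw [this, lintegral_enorm_sq_eq]

/-- The energy norm on the Fourier side. -/
theorem IsTest.lintegral_symb_mul_fhat {f : Plane → ℝ} (hf : IsTest f) :
    ∫⁻ ξ, ENNReal.ofReal (1 + symb 1 ξ) * ‖fhat f ξ‖ₑ ^ 2 =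
      eLpNorm f 2 volume ^ 2 + eLpNorm (BOZK.dy f) 2 volume ^ 2 +
        eLpNorm (halfDx f) 2 volume ^ 2 := by
  have hpi := Real.pi_pos
  have h := hf.mul_fhat (m := fun ξ ↦ (Real.sqrt (2 * Real.pi * |ξ 0|) : ℂ)) (C := 2 * Real.pi)
    (by fun_prop) (fun ξ ↦ by
      rw [Complex.norm_real, Real.norm_of_nonneg (Real.sqrt_nonneg _)]
      have h0 := norm_coord_le ξ 0
      have h1 : 2 * Real.pi * |ξ 0| ≤ (2 * Real.pi * (1 + ‖ξ‖) ^ 2) ^ 2 := by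
        have hn := norm_nonneg ξ
        have : 2 * Real.pi * |ξ 0| ≤ 2 * Real.pi * (1 + ‖ξ‖) ^ 2 := by
          gcongr; nlinarith
        refine this.trans ?_
        have : 1 ≤ 2 * Real.pi * (1 + ‖ξ‖) ^ 2 := by
          have := Real.pi_gt_three
          have : 1 ≤ (1 + ‖ξ‖) ^ 2 := by nlinarith
          nlinarith
        nlinarith
      calc _ ≤ Real.sqrt ((2 * Real.pi * (1 + ‖ξ‖) ^ 2) ^ 2) := Real.sqrt_le_sqrt h1
        _ = _ := Real.sqrt_sq (by positivity))
  have h2 := (fourierInv_memLp_eLpNorm h.1 h.2).2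
  have h3 : eLpNorm (halfDx f) 2 volume ^ 2 =
      ∫⁻ ξ, ENNReal.ofReal (2 * Real.pi * |ξ 0|) * ‖fhat f ξ‖ₑ ^ 2 := by
    change eLpNorm (𝓕⁻ _) 2 volume ^ 2 = _
    rw [show (fun ξ : Plane => (Real.sqrt (2 * Real.pi * |ξ 0|) : ℂ) *
      𝓕 (fun v : Plane => (f v : ℂ)) ξ) = fun ξ ↦ (Real.sqrt (2 * Real.pi * |ξ 0|) : ℂ) * fhat f ξ
      from rfl, h2, lintegral_enorm_sq_eq]
    congr 1 with ξ
    rw [enorm_mul, mul_pow]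
    congr 1
    rw [← ofReal_norm, ← ENNReal.ofReal_pow (norm_nonneg _), Complex.norm_real, Real.norm_eq_abs,
      sq_abs, Real.sq_sqrt (by positivity)]
  have h4 : eLpNorm (BOZK.dy f) 2 volume ^ 2 =
      ∫⁻ ξ, ENNReal.ofReal (4 * Real.pi ^ 2 * ξ 1 ^ 2) * ‖fhat f ξ‖ₑ ^ 2 := by
    rw [← hf.dy.lintegral_fhat]
    congr 1 with ξ
    rw [hf.fhat_dy, enorm_mul, mul_pow]
    congr 1
    rw [← ofReal_norm, ← ENNReal.ofReal_pow (norm_nonneg _)]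
    congr 1
    simp [mul_pow]
    norm_num
  rw [h3, h4, ← hf.lintegral_fhat]
  have mf : Measurable fun ξ ↦ ‖fhat f ξ‖ₑ ^ 2 := by
    have := hf.continuous_fhat.measurable; fun_prop
  rw [← lintegral_add_left mf, ← lintegral_add_left]
  · congr 1 with ξ
    have : ENNReal.ofReal (1 + symb 1 ξ) = 1 + ENNReal.ofReal (4 * Real.pi ^ 2 * ξ 1 ^ 2) +
        ENNReal.ofReal (2 * Real.pi * |ξ 0|) := by
      rw [symb, mul_one, add_comm (2 * Real.pi * |ξ 0|), ← add_assoc,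
        ENNReal.ofReal_add (by positivity) (by positivity), ENNReal.ofReal_add (by positivity)
        (by positivity), ENNReal.ofReal_one]
    rw [this]; ring
  · have : Measurable fun ξ : Plane ↦ ENNReal.ofReal (4 * Real.pi ^ 2 * ξ 1 ^ 2) := by fun_prop
    exact mf.add (this.mul mf)

/-! ### Smoothing by the kernels and the Sobolev embedding. -/

/-- Jensen's inequality for the measure with density `k`. -/
theorem lintegral_mul_rpow_le {X : Type*} [MeasurableSpace X] {μ : Measure X} {k f : X → ℝ≥0∞}
    (hk : AEMeasurable k μ) (hf : AEMeasurable f μ) {s : ℝ} (hs : 1 < s) :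
    (∫⁻ x, k x * f x ∂μ) ^ s ≤ (∫⁻ x, k x ∂μ) ^ (s - 1) * ∫⁻ x, k x * f x ^ s ∂μ := by
  have hs0 : 0 < s := by linarith
  have hconj := Real.HolderConjugate.conjExponent hs
  set q := s.conjExponent with hq
  have hq0 : 0 < q := hconj.symm.pos
  have hsum : 1 / q + 1 / s = 1 := by
    have := hconj.inv_add_inv_eq_one
    rw [one_div, one_div, add_comm]; exact this
  have h := ENNReal.lintegral_mul_le_Lp_mul_Lq μ hconj.symm (f := fun x ↦ k x ^ (1 / q))
    (g := fun x ↦ k x ^ (1 / s) * f x) (hk.pow_const _) ((hk.pow_const _).mul hf)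
  have e1 : ∀ x, ((fun x ↦ k x ^ (1 / q)) * fun x ↦ k x ^ (1 / s) * f x) x = k x * f x := by
    intro x
    simp only [Pi.mul_apply]
    rw [← mul_assoc, ← ENNReal.rpow_add_of_nonneg _ _ (by positivity) (by positivity), hsum,
      ENNReal.rpow_one]
  have e2 : ∀ x, (k x ^ (1 / q)) ^ q = k x := fun x ↦ by
    rw [← ENNReal.rpow_mul, one_div_mul_cancel hq0.ne', ENNReal.rpow_one]
  have e3 : ∀ x, (k x ^ (1 / s) * f x) ^ s = k x * f x ^ s := fun x ↦ by
    rw [ENNReal.mul_rpow_of_nonneg _ _ hs0.le, ← ENNReal.rpow_mul, one_div_mul_cancel hs0.ne',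
      ENNReal.rpow_one]
  simp only [e1, e2, e3] at h
  have e4 : 1 / q * s = s - 1 := by
    have h1 : 1 / q = 1 - 1 / s := by linarith
    rw [h1]; field_simp
  calc _ ≤ ((∫⁻ x, k x ∂μ) ^ (1 / q) * (∫⁻ x, k x * f x ^ s ∂μ) ^ (1 / s)) ^ s := by gcongr
    _ = _ := by
      rw [ENNReal.mul_rpow_of_nonneg _ _ hs0.le, ← ENNReal.rpow_mul, ← ENNReal.rpow_mul, e4,
        one_div_mul_cancel hs0.ne', ENNReal.rpow_one]

/-- The convolution of the kernel `kern A t` with a nonnegative function. -/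
def kconv (A t : ℝ) (f : Plane → ℝ≥0∞) (u : Plane) : ℝ≥0∞ :=
  ∫⁻ v, ENNReal.ofReal (kern A t v) * f (u - v)

theorem measurable_ofReal_kern (A t : ℝ) : Measurable fun v ↦ ENNReal.ofReal (kern A t v) :=
  ((measurable_kern A).comp (measurable_const.prodMk measurable_id)).ennreal_ofReal

theorem measurable_kconv (A : ℝ) {f : Plane → ℝ≥0∞} (hf : Measurable f) :
    Measurable fun p : ℝ × Plane ↦ kconv A p.1 f p.2 := by
  unfold kconv
  refine Measurable.lintegral_prod_right' (f := fun q : (ℝ × Plane) × Plane ↦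
    ENNReal.ofReal (kern A q.1.1 q.2) * f (q.1.2 - q.2)) ?_
  have h1 : Measurable fun q : (ℝ × Plane) × Plane ↦ kern A q.1.1 q.2 :=
    (measurable_kern A).comp (by fun_prop : Measurable fun q : (ℝ × Plane) × Plane ↦ (q.1.1, q.2))
  exact h1.ennreal_ofReal.mul (hf.comp (by fun_prop))

theorem lintegral_kconv {A t : ℝ} (hA : 0 < A) (ht : 0 < t) {f : Plane → ℝ≥0∞}
    (hf : Measurable f) : ∫⁻ u, kconv A t f u = ∫⁻ u, f u := by
  unfold kconv
  rw [lintegral_lintegral_swap]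
  · have : ∀ v, ∫⁻ u, ENNReal.ofReal (kern A t v) * f (u - v) =
        ENNReal.ofReal (kern A t v) * ∫⁻ u, f u := fun v ↦ by
      rw [lintegral_const_mul _ (by fun_prop), lintegral_sub_right_eq_self]
    simp only [this]
    rw [lintegral_mul_const _ (measurable_ofReal_kern A t), lintegral_kern hA ht, one_mul]
  · have := measurable_ofReal_kern A t
    exact ((this.comp measurable_snd).mul (hf.comp (by fun_prop))).aemeasurable

theorem kconv_le {A t : ℝ} (hA : 0 < A) (ht : 0 < t) (f : Plane → ℝ≥0∞) (u : Plane) :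
    kconv A t f u ≤ ENNReal.ofReal (1 / A * t ^ (-(3 / 2) : ℝ)) * ∫⁻ v, f v := by
  unfold kconv
  rw [← lintegral_sub_left_eq_self f u, ← lintegral_const_mul' _ _ ENNReal.ofReal_ne_top]
  gcongr with v
  exact kern_le hA ht v

theorem kconv_rpow_le {A t : ℝ} (hA : 0 < A) (ht : 0 < t) {f : Plane → ℝ≥0∞}
    (hf : Measurable f) {s : ℝ} (hs : 1 < s) (u : Plane) :
    kconv A t f u ^ s ≤ kconv A t (fun v ↦ f v ^ s) u := by
  have := lintegral_mul_rpow_le (μ := volume) (measurable_ofReal_kern A t).aemeasurable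
    (f := fun v ↦ f (u - v)) (by fun_prop) hs
  rwa [lintegral_kern hA ht, ENNReal.one_rpow, one_mul] at this

/-- Interpolation: of the `r` powers, two are integrated using conservation of mass, and the other
`r - 2` are estimated by the `L² → L^∞` bound, which costs `t^{-3/4}` each. -/
theorem lintegral_kconv_rpow_le {t r : ℝ} (ht : 0 < t) (hr : 2 ≤ r) {f : Plane → ℝ≥0∞}
    (hf : Measurable f) (h2 : ∫⁻ v, f v ^ (2 : ℝ) ≤ 1) :
    ∫⁻ u, kconv 1 t f u ^ r ≤ ENNReal.ofReal (t ^ (-(3 / 4) * (r - 2))) := by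
  have b1 : ∀ u, kconv 1 t f u ^ (2 : ℝ) ≤ kconv 1 t (fun v ↦ f v ^ (2 : ℝ)) u :=
    kconv_rpow_le one_pos ht hf one_lt_two
  have b2 : ∀ u, kconv 1 t f u ^ (r - 2) ≤ ENNReal.ofReal (t ^ (-(3 / 4) * (r - 2))) := by
    intro u
    have h := ((b1 u).trans (kconv_le one_pos ht _ u)).trans (mul_le_mul_right h2 _)
    rw [mul_one, div_one, one_mul] at h
    have h' := ENNReal.rpow_le_rpow h (by linarith : 0 ≤ (r - 2) / 2)
    rw [← ENNReal.rpow_mul, ENNReal.ofReal_rpow_of_nonneg (by positivity) (by linarith),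
      ← Real.rpow_mul ht.le] at h'
    convert h' using 2
    · ring
    · congr 1; ring
  calc ∫⁻ u, kconv 1 t f u ^ r
      ≤ ∫⁻ u, ENNReal.ofReal (t ^ (-(3 / 4) * (r - 2))) *
          kconv 1 t (fun v ↦ f v ^ (2 : ℝ)) u := by
        gcongr with u
        calc kconv 1 t f u ^ r = kconv 1 t f u ^ (r - 2) * kconv 1 t f u ^ (2 : ℝ) := by
              rw [← ENNReal.rpow_add_of_nonneg _ _ (by linarith) (by norm_num)]; congr 1; ring
          _ ≤ _ := mul_le_mul' (b2 u) (b1 u)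
    _ = ENNReal.ofReal (t ^ (-(3 / 4) * (r - 2))) * ∫⁻ v, f v ^ (2 : ℝ) := by
        rw [lintegral_const_mul' _ _ ENNReal.ofReal_ne_top,
          lintegral_kconv one_pos ht (by fun_prop)]
    _ ≤ _ := by
        calc _ ≤ ENNReal.ofReal (t ^ (-(3 / 4) * (r - 2))) * 1 := by gcongr
          _ = _ := mul_one _

/-- Boundedness of the Bessel-type potential of order `1/2` from `L²` to `L^r`, `2 ≤ r < 6`. -/
theorem exists_lintegral_bessel_rpow_le {r : ℝ} (h2 : 2 ≤ r) (h6 : r < 6) :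
    ∃ C : ℝ≥0∞, C < ⊤ ∧ ∀ f : Plane → ℝ≥0∞, Measurable f → ∫⁻ v, f v ^ (2 : ℝ) ≤ 1 →
      ∫⁻ u, (∫⁻ t in Set.Ioi (0 : ℝ), ENNReal.ofReal (t ^ (-(1 / 2) : ℝ) * Real.exp (-t)) *
        kconv 1 t f u) ^ r ≤ C := by
  -- The weight `t^{-1/2} e^{-t}` is split as `t^{-θ} e^{-t/2}` times `t^{θ-1/2} e^{-t/2}`, and
  -- Jensen is applied in `t` with the first factor as density. That density needs `θ < 1`; the
  -- power `e` of `t` left at the end exceeds `-1` exactly when `θ > θ₀`. Both are possible exactly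
  -- because `r < 6`.
  set θ₀ : ℝ := (5 / 4 * r - 5 / 2) / (r - 1) with hθ₀
  have hθ₀1 : θ₀ < 1 := by rw [hθ₀, div_lt_one (by linarith)]; linarith
  set θ : ℝ := (1 + θ₀) / 2 with hθ
  have hθ1 : θ < 1 := by rw [hθ]; linarith
  have hθ2 : 5 / 4 * r - 5 / 2 < θ * (r - 1) := by
    have : θ₀ < θ := by rw [hθ]; linarith
    rwa [hθ₀, div_lt_iff₀ (by linarith)] at this
  set k : ℝ → ℝ≥0∞ := fun t ↦ ENNReal.ofReal (t ^ (-θ) * Real.exp (-(1 / 2 * t))) with hk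
  set e : ℝ := -θ + (θ - 1 / 2) * r - 3 / 4 * (r - 2) with he
  have he1 : -1 < e := by rw [he]; nlinarith
  have hkm : Measurable k := by fun_prop
  have I1 : ∫⁻ t in Set.Ioi (0 : ℝ), k t < ⊤ :=
    lintegral_rpow_mul_exp_lt_top (by linarith) (by norm_num)
  have I2 : ∫⁻ t in Set.Ioi (0 : ℝ), ENNReal.ofReal (t ^ e * Real.exp (-(1 / 2 * t))) < ⊤ :=
    lintegral_rpow_mul_exp_lt_top he1 (by norm_num)
  refine ⟨(∫⁻ t in Set.Ioi (0 : ℝ), k t) ^ (r - 1) *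
    ∫⁻ t in Set.Ioi (0 : ℝ), ENNReal.ofReal (t ^ e * Real.exp (-(1 / 2 * t))),
    ENNReal.mul_lt_top (ENNReal.rpow_lt_top_of_nonneg (by linarith) I1.ne) I2, fun f hf hf2 ↦ ?_⟩
  set g : ℝ → Plane → ℝ≥0∞ := fun t u ↦
    ENNReal.ofReal (t ^ (θ - 1 / 2) * Real.exp (-(1 / 2 * t))) * kconv 1 t f u with hg
  have hgm : Measurable (Function.uncurry g) :=
    (by fun_prop : Measurable fun p : ℝ × Plane ↦
      ENNReal.ofReal (p.1 ^ (θ - 1 / 2) * Real.exp (-(1 / 2 * p.1)))).mul (measurable_kconv 1 hf)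
  have step : ∀ u, (∫⁻ t in Set.Ioi (0 : ℝ), ENNReal.ofReal (t ^ (-(1 / 2) : ℝ) * Real.exp (-t)) *
      kconv 1 t f u) ^ r ≤ (∫⁻ t in Set.Ioi (0 : ℝ), k t) ^ (r - 1) *
        ∫⁻ t in Set.Ioi (0 : ℝ), k t * g t u ^ r := by
    intro u
    have hgu : Measurable fun t ↦ g t u :=
      hgm.comp (by fun_prop : Measurable fun t : ℝ ↦ (t, u))
    refine le_trans (le_of_eq ?_) (lintegral_mul_rpow_le hkm.aemeasurable hgu.aemeasurable
      (by linarith))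
    congr 1
    refine setLIntegral_congr_fun measurableSet_Ioi fun t (ht : 0 < t) ↦ ?_
    simp only [hk, hg]
    rw [← mul_assoc, ← ENNReal.ofReal_mul (by positivity)]
    congr 2
    rw [mul_mul_mul_comm, ← Real.rpow_add ht, ← Real.exp_add]
    congr 2 <;> ring
  calc _ ≤ ∫⁻ u, (∫⁻ t in Set.Ioi (0 : ℝ), k t) ^ (r - 1) *
        ∫⁻ t in Set.Ioi (0 : ℝ), k t * g t u ^ r := lintegral_mono step
    _ = (∫⁻ t in Set.Ioi (0 : ℝ), k t) ^ (r - 1) *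
        ∫⁻ t in Set.Ioi (0 : ℝ), k t * ∫⁻ u, g t u ^ r := by
      rw [lintegral_const_mul' _ _ (ENNReal.rpow_lt_top_of_nonneg (by linarith) I1.ne).ne,
        lintegral_lintegral_swap]
      · congr 1
        refine lintegral_congr fun t ↦ ?_
        rw [lintegral_const_mul' _ _ ENNReal.ofReal_ne_top]
      · exact ((hkm.comp measurable_snd).mul
          ((hgm.comp measurable_swap).pow_const r)).aemeasurable
    _ ≤ _ := by
      gcongr 1
      refine setLIntegral_mono' measurableSet_Ioi fun t (ht : 0 < t) ↦ ?_
      have e1 : ∫⁻ u, g t u ^ r =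
          ENNReal.ofReal ((t ^ (θ - 1 / 2) * Real.exp (-(1 / 2 * t))) ^ r) *
            ∫⁻ u, kconv 1 t f u ^ r := by
        rw [← lintegral_const_mul' _ _ ENNReal.ofReal_ne_top]
        congr 1 with u
        rw [hg, ENNReal.mul_rpow_of_nonneg _ _ (by linarith),
          ENNReal.ofReal_rpow_of_nonneg (by positivity) (by linarith)]
      rw [e1]
      calc _ ≤ k t * (ENNReal.ofReal ((t ^ (θ - 1 / 2) * Real.exp (-(1 / 2 * t))) ^ r) *
            ENNReal.ofReal (t ^ (-(3 / 4) * (r - 2)))) := by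
            gcongr; exact lintegral_kconv_rpow_le ht h2 hf hf2
        _ ≤ _ := by
            simp only [hk]
            rw [← ENNReal.ofReal_mul (by positivity), ← ENNReal.ofReal_mul (by positivity)]
            refine ENNReal.ofReal_le_ofReal ?_
            rw [Real.mul_rpow (by positivity) (by positivity), ← Real.rpow_mul ht.le,
              ← Real.exp_mul]
            have h1 : Real.exp (-(1 / 2 * t) * r) ≤ 1 := Real.exp_le_one_iff.2 (by nlinarith)
            calc _ = t ^ (-θ) * t ^ ((θ - 1 / 2) * r) * t ^ (-(3 / 4) * (r - 2)) *
                  Real.exp (-(1 / 2 * t)) * Real.exp (-(1 / 2 * t) * r) := by ring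
              _ ≤ t ^ (-θ) * t ^ ((θ - 1 / 2) * r) * t ^ (-(3 / 4) * (r - 2)) *
                  Real.exp (-(1 / 2 * t)) * 1 := by gcongr
              _ = _ := by
                rw [← Real.rpow_add ht, ← Real.rpow_add ht, mul_one]
                congr 2; rw [he]; ring

theorem add_symb_le {A c : ℝ} (hA : 0 ≤ A) (hc : 0 ≤ c) (ξ : Plane) :
    c + symb A ξ ≤ (c + 2 * Real.pi * A + 4 * Real.pi ^ 2) * (1 + ‖ξ‖) ^ 2 := by
  have hpi := Real.pi_pos
  have hn := norm_nonneg ξ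
  have h0 := norm_coord_le ξ 0
  have h1 : ξ 1 ^ 2 ≤ ‖ξ‖ ^ 2 := sq_le_sq' (by linarith [(abs_le.1 (norm_coord_le ξ 1)).1])
    ((le_abs_self _).trans (norm_coord_le ξ 1))
  unfold symb
  have e1 : 2 * Real.pi * A * |ξ 0| ≤ 2 * Real.pi * A * (1 + ‖ξ‖) ^ 2 := by
    gcongr; nlinarith
  have e2 : 4 * Real.pi ^ 2 * ξ 1 ^ 2 ≤ 4 * Real.pi ^ 2 * (1 + ‖ξ‖) ^ 2 :=
    mul_le_mul_of_nonneg_left (by nlinarith) (by positivity)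
  have e3 : c * 1 ≤ c * (1 + ‖ξ‖) ^ 2 := by gcongr; nlinarith
  linarith

theorem continuous_fourierInv {h : Plane → ℂ} (hh : Integrable h) : Continuous (𝓕⁻ h) :=
  VectorFourier.fourierIntegral_continuous Real.continuous_fourierChar
    (L := -innerₗ Plane) continuous_inner.neg hh

/-- A Sobolev embedding for the energy norm. -/
theorem exists_lintegral_rpow_le_of_zNorm_le_one {r : ℝ} (h2 : 2 ≤ r) (h6 : r < 6) :
    ∃ C : ℝ≥0∞, C < ⊤ ∧ ∀ f, IsTest f → zNorm f ≤ 1 → ∫⁻ u, ‖f u‖ₑ ^ r ≤ C := by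
  obtain ⟨C, hC, hCf⟩ := exists_lintegral_bessel_rpow_le h2 h6
  have hΓ : 0 < Real.Gamma (1 / 2) := Real.Gamma_pos_of_pos (by norm_num)
  set γ : ℝ≥0∞ := ENNReal.ofReal (Real.Gamma (1 / 2)) with hγ
  have hγ0 : γ ≠ 0 := by simpa [hγ] using hΓ
  have hγt : γ ≠ ⊤ := ENNReal.ofReal_ne_top
  refine ⟨(γ ^ r)⁻¹ * C, ENNReal.mul_lt_top (ENNReal.inv_lt_top.2
    (ENNReal.rpow_pos (pos_iff_ne_zero.2 hγ0) hγt)) hC, fun f hf hz ↦ ?_⟩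
  have hw : ∀ ξ, 0 < 1 + symb 1 ξ := fun ξ ↦ by linarith [symb_nonneg zero_le_one ξ]
  -- The function `𝓕⁻ H` has `L²` norm equal to the energy norm of `f`, and `f` is recovered from it
  -- by the resolvent power of order `1/2`, a superposition of positive kernels.
  set H : Plane → ℂ := fun ξ ↦ (((1 + symb 1 ξ) ^ (1 / 2 : ℝ) : ℝ) : ℂ) * fhat f ξ with hH
  have hm : Continuous fun ξ : Plane ↦ (((1 + symb 1 ξ) ^ (1 / 2 : ℝ) : ℝ) : ℂ) :=
    Complex.continuous_ofReal.comp ((continuous_const.add (continuous_symb 1)).rpow_const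
      fun ξ ↦ Or.inl (hw ξ).ne')
  obtain ⟨H1, H2⟩ := hf.mul_fhat hm (C := 1 + 2 * Real.pi * 1 + 4 * Real.pi ^ 2) fun ξ ↦ by
    rw [Complex.norm_real, Real.norm_of_nonneg (by have := hw ξ; positivity)]
    refine le_trans ?_ (add_symb_le zero_le_one zero_le_one ξ)
    have h1 : 1 ≤ 1 + symb 1 ξ := by linarith [symb_nonneg zero_le_one ξ]
    calc _ ≤ (1 + symb 1 ξ) ^ (1 : ℝ) := Real.rpow_le_rpow_of_exponent_le h1 (by norm_num)
      _ = _ := Real.rpow_one _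
  have hS : ∫⁻ v, ‖𝓕⁻ H v‖ₑ ^ (2 : ℝ) ≤ 1 := by
    have e := (fourierInv_memLp_eLpNorm H1 H2).2
    simp only [ENNReal.rpow_two]
    rw [← lintegral_enorm_sq_eq, e, lintegral_enorm_sq_eq]
    have e2 : ∫⁻ ξ, ‖H ξ‖ₑ ^ 2 = ∫⁻ ξ, ENNReal.ofReal (1 + symb 1 ξ) * ‖fhat f ξ‖ₑ ^ 2 := by
      congr 1 with ξ
      rw [hH, enorm_mul, mul_pow]
      congr 1
      rw [← ofReal_norm, ← ENNReal.ofReal_pow (norm_nonneg _), Complex.norm_real,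
        Real.norm_of_nonneg (by have := hw ξ; positivity), ← Real.rpow_natCast,
        ← Real.rpow_mul (hw ξ).le]
      norm_num
    change ∫⁻ ξ, ‖H ξ‖ₑ ^ 2 ≤ 1
    rw [e2, hf.lintegral_symb_mul_fhat]
    by_contra hcon
    exact absurd hz (not_le.2 (ENNReal.one_lt_rpow (not_le.1 hcon) (by norm_num)))
  have hFm : Measurable fun v ↦ ‖𝓕⁻ H v‖ₑ := (continuous_fourierInv H1).measurable.enorm
  have hpt : ∀ u, γ * ‖f u‖ₑ ≤ ∫⁻ t in Set.Ioi (0 : ℝ),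
      ENNReal.ofReal (t ^ (-(1 / 2) : ℝ) * Real.exp (-t)) * kconv 1 t (fun v ↦ ‖𝓕⁻ H v‖ₑ) u := by
    intro u
    have h := integral_rpow_mul_kern_mul_fourierInv one_pos one_pos (σ := 1 / 2) (by norm_num) H1 u
    have e1 : (fun ξ ↦ (((1 + symb 1 ξ) ^ (-(1 / 2) : ℝ) : ℝ) : ℂ) * H ξ) = fhat f := by
      funext ξ
      rw [hH]
      simp only
      rw [← mul_assoc, ← Complex.ofReal_mul, ← Real.rpow_add (hw ξ)]
      simp
    rw [e1, hf.fourierInv_fhat] at h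
    have h' := congrArg (fun z : ℂ ↦ ‖z‖ₑ) h
    simp only [enorm_mul] at h'
    have e2 : ∀ x : ℝ, ‖(x : ℂ)‖ₑ = ‖x‖ₑ := fun x ↦ by
      rw [← ofReal_norm, ← ofReal_norm, Complex.norm_real]
    rw [e2, e2, Real.enorm_of_nonneg hΓ.le] at h'
    rw [hγ, ← h']
    refine (enorm_integral_le_lintegral_enorm _).trans ?_
    refine setLIntegral_mono' measurableSet_Ioi fun t (ht : 0 < t) ↦ ?_
    rw [enorm_mul, e2, Real.enorm_of_nonneg (by positivity)]
    have e3 : t ^ ((1 / 2 : ℝ) - 1) * Real.exp (-(1 * t)) = t ^ (-(1 / 2) : ℝ) * Real.exp (-t) := by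
      norm_num
    rw [e3]
    gcongr
    refine (enorm_integral_le_lintegral_enorm _).trans (le_of_eq ?_)
    unfold kconv
    congr 1 with v
    rw [enorm_mul, e2, Real.enorm_of_nonneg (kern_nonneg zero_le_one ht.le v)]
  calc ∫⁻ u, ‖f u‖ₑ ^ r = (γ ^ r)⁻¹ * ∫⁻ u, (γ * ‖f u‖ₑ) ^ r := by
        have hr0 : γ ^ r ≠ 0 := (ENNReal.rpow_pos (pos_iff_ne_zero.2 hγ0) hγt).ne'
        have hrt : γ ^ r ≠ ⊤ := (ENNReal.rpow_lt_top_of_nonneg (by linarith) hγt).ne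
        simp only [ENNReal.mul_rpow_of_nonneg _ _ (by linarith : 0 ≤ r)]
        rw [lintegral_const_mul' _ _ hrt, ← mul_assoc, ENNReal.inv_mul_cancel hr0 hrt, one_mul]
    _ ≤ (γ ^ r)⁻¹ * C := by
        gcongr
        refine le_trans (lintegral_mono fun u ↦ ?_) (hCf _ hFm hS)
        exact ENNReal.rpow_le_rpow (hpt u) (by linarith)

/-- The unit-ball bound suffices: from some index on, the approximants stay within energy distance
one of a fixed `u N₂`. Fatou along an almost everywhere convergent subsequence passes the bound to
`f - u N₂`, and `u N₂` lies in every `L^r`. -/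
theorem MemZ.memLp {f : Plane → ℝ} (hf : MemZ f) {r : ℝ} (h2 : 2 ≤ r) (h6 : r < 6) :
    MemLp f (ENNReal.ofReal r) volume := by
  obtain ⟨hf2, u, hu, hcau, hlim⟩ := hf
  obtain ⟨C, hC, hCf⟩ := exists_lintegral_rpow_le_of_zNorm_le_one h2 h6
  have hev : ∀ᶠ q : ℕ × ℕ in atTop, zNorm (u q.1 - u q.2) ≤ 1 :=
    (hcau.eventually (Iio_mem_nhds one_pos)).mono fun q hq ↦ le_of_lt hq
  obtain ⟨⟨N₁, N₂⟩, hN⟩ := eventually_atTop.1 hev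
  have hN' : ∀ n ≥ N₁, ∫⁻ v, ‖(u n - u N₂) v‖ₑ ^ r ≤ C := fun n hn ↦
    hCf _ ((hu n).sub (hu N₂)) (hN (n, N₂) ⟨hn, le_rfl⟩)
  have hmeas := tendstoInMeasure_of_tendsto_eLpNorm (two_ne_zero)
    (fun n ↦ (hu n).continuous.aestronglyMeasurable) hf2.1 hlim
  obtain ⟨ns, hns, hae⟩ := hmeas.exists_seq_tendsto_ae
  have hr0 : 0 ≤ r := by linarith
  have hF : ∫⁻ v, ‖(f - u N₂) v‖ₑ ^ r ≤ C := by
    calc ∫⁻ v, ‖(f - u N₂) v‖ₑ ^ r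
        = ∫⁻ v, liminf (fun i ↦ ‖(u (ns i) - u N₂) v‖ₑ ^ r) atTop := by
          refine lintegral_congr_ae ?_
          filter_upwards [hae] with v hv
          have h1 : Tendsto (fun i ↦ ‖(u (ns i) - u N₂) v‖ₑ ^ r) atTop
              (𝓝 (‖(f - u N₂) v‖ₑ ^ r)) := by
            have := ((hv.sub_const (u N₂ v)).enorm)
            exact (ENNReal.continuous_rpow_const.tendsto _).comp this
          exact h1.liminf_eq.symm
      _ ≤ liminf (fun i ↦ ∫⁻ v, ‖(u (ns i) - u N₂) v‖ₑ ^ r) atTop := by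
          refine lintegral_liminf_le fun i ↦ ?_
          exact (((hu _).sub (hu N₂)).continuous.measurable.enorm).pow_const r
      _ ≤ C := by
          refine liminf_le_of_frequently_le' (Eventually.frequently ?_)
          filter_upwards [eventually_ge_atTop N₁] with i hi
          exact hN' _ (hi.trans hns.le_apply)
  have hp0 : ENNReal.ofReal r ≠ 0 := by simp; linarith
  have hM : MemLp (f - u N₂) (ENNReal.ofReal r) volume := by
    refine ⟨hf2.1.sub (hu N₂).continuous.aestronglyMeasurable, ?_⟩
    rw [eLpNorm_lt_top_iff_lintegral_rpow_enorm_lt_top hp0 ENNReal.ofReal_ne_top,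
      ENNReal.toReal_ofReal hr0]
    exact hF.trans_lt hC
  have := hM.add ((hu N₂).memLp (ENNReal.ofReal r))
  simpa using this

theorem MemZ.lintegral_rpow_lt_top {f : Plane → ℝ} (hf : MemZ f) {r : ℝ} (h2 : 2 ≤ r)
    (h6 : r < 6) : ∫⁻ v, ‖f v‖ₑ ^ r < ⊤ := by
  have hp0 : ENNReal.ofReal r ≠ 0 := by simp; linarith
  have := (hf.memLp h2 h6).2
  rwa [eLpNorm_lt_top_iff_lintegral_rpow_enorm_lt_top hp0 ENNReal.ofReal_ne_top,
    ENNReal.toReal_ofReal (by linarith)] at this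

/-! ### The Hilbert transform of a derivative as an integral of second differences. -/

/-- The second difference of a function on the line. -/
def sdiff (f : ℝ → ℝ) (x s : ℝ) : ℝ := 2 * f x - f (x + s) - f (x - s)

section Line

variable {f : ℝ → ℝ}

theorem hasDerivAt_sdiff (hf : ContDiff ℝ ∞ f) (x s : ℝ) :
    HasDerivAt (sdiff f x) (deriv f (x - s) - deriv f (x + s)) s := by
  have hd : Differentiable ℝ f := hf.differentiable (by simp)
  have h1 : HasDerivAt (fun s ↦ f (x + s)) (deriv f (x + s)) s :=
    (hd (x + s)).hasDerivAt.comp_const_add x s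
  have h2 : HasDerivAt (fun s ↦ f (x - s)) (-deriv f (x - s)) s :=
    (hd (x - s)).hasDerivAt.comp_const_sub x s
  exact (((hasDerivAt_const s (2 * f x)).sub h1).sub h2).congr_deriv (by ring)

theorem exists_deriv_sub_le (hf : ContDiff ℝ ∞ f) (hc : HasCompactSupport f) :
    ∃ K, 0 ≤ K ∧ ∀ x s, 0 ≤ s → |deriv f (x - s) - deriv f (x + s)| ≤ K * s := by
  have h1 : ContDiff ℝ ∞ (deriv f) := (contDiff_infty_iff_deriv.1 hf).2
  obtain ⟨K, hK⟩ := h1.lipschitzWith_of_hasCompactSupport hc.deriv (by simp)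
  refine ⟨2 * K, by positivity, fun x s hs ↦ ?_⟩
  have := hK.dist_le_mul (x - s) (x + s)
  rw [Real.dist_eq, Real.dist_eq] at this
  refine this.trans (le_of_eq ?_)
  rw [show x - s - (x + s) = -(2 * s) by ring, abs_neg, abs_of_nonneg (by positivity)]
  ring

/-- The quadratic bound controls the singularity at `s = 0` and the constant bound the tail, so that
`sdiff f x s / s ^ 2` is dominated by a multiple of `1 / (1 + s²)`. -/
theorem exists_sdiff_le (hf : ContDiff ℝ ∞ f) (hc : HasCompactSupport f) :
    ∃ K, 0 ≤ K ∧ ∀ x s, 0 ≤ s → |sdiff f x s| ≤ K * s ^ 2 ∧ |sdiff f x s| ≤ K ∧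
      |deriv f (x - s) - deriv f (x + s)| ≤ K * s := by
  obtain ⟨K, hK0, hK⟩ := exists_deriv_sub_le hf hc
  obtain ⟨M, hM⟩ := hf.continuous.bounded_above_of_compact_support hc
  have hM0 : 0 ≤ M := (norm_nonneg _).trans (hM 0)
  refine ⟨K + 4 * M, by positivity, fun x s hs ↦ ⟨?_, ?_, ?_⟩⟩
  · have h := Convex.norm_image_sub_le_of_norm_hasDerivWithin_le (s := Set.Icc 0 s)
      (f := sdiff f x) (x := 0) (y := s) (C := K * s)
      (fun r _ ↦ (hasDerivAt_sdiff hf x r).hasDerivWithinAt)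
      (fun r hr ↦ (hK x r hr.1).trans (by gcongr; exact hr.2)) (convex_Icc 0 s)
      ⟨le_rfl, hs⟩ ⟨hs, le_rfl⟩
    have h0 : sdiff f x 0 = 0 := by simp [sdiff]; ring
    rw [h0, sub_zero, sub_zero, Real.norm_eq_abs, Real.norm_eq_abs, abs_of_nonneg hs] at h
    nlinarith [sq_nonneg s]
  · have e1 := abs_le.1 (hM x)
    have e2 := abs_le.1 (hM (x + s))
    have e3 := abs_le.1 (hM (x - s))
    rw [abs_le]; unfold sdiff
    constructor <;> linarith [e1.1, e1.2, e2.1, e2.2, e3.1, e3.2]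
  · refine (hK x s hs).trans ?_
    nlinarith

theorem integrableOn_sdiff_div (hf : ContDiff ℝ ∞ f) (hc : HasCompactSupport f) (x : ℝ) :
    IntegrableOn (fun s ↦ sdiff f x s / s ^ 2) (Set.Ioi 0) := by
  obtain ⟨K, hK0, hK⟩ := exists_sdiff_le hf hc
  have hd : Continuous (sdiff f x) := by
    have := hf.continuous; unfold sdiff; fun_prop
  refine Integrable.mono' (g := fun s ↦ 2 * K * (1 + s ^ 2)⁻¹)
    (integrable_inv_one_add_sq.const_mul _).integrableOn
    (hd.measurable.div (by fun_prop)).aestronglyMeasurable ?_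
  filter_upwards [ae_restrict_mem measurableSet_Ioi] with s (hs : 0 < s)
  obtain ⟨h1, h2, -⟩ := hK x s hs.le
  rw [Real.norm_eq_abs, abs_div, abs_of_pos (by positivity : 0 < s ^ 2), ← div_eq_mul_inv,
    div_le_div_iff₀ (by positivity) (by positivity)]
  nlinarith

theorem integrableOn_deriv_sub_div (hf : ContDiff ℝ ∞ f) (hc : HasCompactSupport f) (x : ℝ) :
    IntegrableOn (fun s ↦ (deriv f (x - s) - deriv f (x + s)) / s) (Set.Ioi 0) := by
  obtain ⟨K, hK0, hK⟩ := exists_sdiff_le hf hc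
  have hd : Continuous (deriv f) := hf.continuous_deriv (by simp)
  have hm : Measurable fun s ↦ (deriv f (x - s) - deriv f (x + s)) / s := by
    have := hd.measurable; fun_prop
  have hi : Integrable (deriv f) := hd.integrable_of_hasCompactSupport hc.deriv
  have h1 : IntegrableOn (fun s ↦ (deriv f (x - s) - deriv f (x + s)) / s) (Set.Ioc 0 1) := by
    refine Integrable.mono' (g := fun _ ↦ K) (integrableOn_const (by simp))
      hm.aestronglyMeasurable ?_
    filter_upwards [ae_restrict_mem measurableSet_Ioc] with s hs
    rw [Real.norm_eq_abs, abs_div, abs_of_pos hs.1, div_le_iff₀ hs.1]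
    exact (hK x s hs.1.le).2.2
  have h2 : IntegrableOn (fun s ↦ (deriv f (x - s) - deriv f (x + s)) / s) (Set.Ioi 1) := by
    refine Integrable.mono' (g := fun s ↦ |deriv f (x - s) - deriv f (x + s)|)
      (((hi.comp_sub_left x).sub (hi.comp_add_left x)).abs).integrableOn
      hm.aestronglyMeasurable ?_
    filter_upwards [ae_restrict_mem measurableSet_Ioi] with s (hs : 1 < s)
    rw [Real.norm_eq_abs, abs_div, abs_of_pos (by linarith : 0 < s)]
    exact div_le_self (abs_nonneg _) hs.le
  have := h1.union h2
  rwa [Set.Ioc_union_Ioi_eq_Ioi zero_le_one] at this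

/-- Integration by parts; the boundary term `sdiff f x s / s` vanishes at both ends. -/
theorem integral_deriv_sub_div (hf : ContDiff ℝ ∞ f) (hc : HasCompactSupport f) (x : ℝ) :
    ∫ s in Set.Ioi (0 : ℝ), (deriv f (x - s) - deriv f (x + s)) / s =
      ∫ s in Set.Ioi (0 : ℝ), sdiff f x s / s ^ 2 := by
  obtain ⟨K, hK0, hK⟩ := exists_sdiff_le hf hc
  have i1 := integrableOn_deriv_sub_div hf hc x
  have i2 := integrableOn_sdiff_div hf hc x
  have h := integral_Ioi_of_hasDerivAt_of_tendsto (a := 0) (m := 0)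
    (f := fun s ↦ sdiff f x s / s)
    (f' := fun s ↦ (deriv f (x - s) - deriv f (x + s)) / s - sdiff f x s / s ^ 2) ?_ ?_
    (i1.sub i2) ?_
  · rw [integral_sub i1 i2] at h
    simp only [div_zero, sub_zero] at h
    linarith
  · have hb : ∀ s ∈ Set.Ici (0 : ℝ), ‖sdiff f x s / s‖ ≤ K * s := by
      intro s (hs : 0 ≤ s)
      rcases hs.eq_or_lt with rfl | hs
      · simp
      · rw [Real.norm_eq_abs, abs_div, abs_of_pos hs, div_le_iff₀ hs]
        have := (hK x s hs.le).1
        nlinarith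
    have ht : Tendsto (fun s : ℝ ↦ K * s) (𝓝[Set.Ici 0] 0) (𝓝 0) := by
      have : Tendsto (fun s : ℝ ↦ K * s) (𝓝 0) (𝓝 (K * 0)) := (continuous_const_mul K).tendsto 0
      rw [mul_zero] at this
      exact this.mono_left nhdsWithin_le_nhds
    unfold ContinuousWithinAt
    simp only [div_zero]
    exact squeeze_zero_norm' (eventually_mem_nhdsWithin.mono hb) ht
  · intro s (hs : 0 < s)
    refine ((hasDerivAt_sdiff hf x s).div (hasDerivAt_id' s) hs.ne').congr_deriv ?_
    field_simp
  · refine squeeze_zero_norm' (a := fun s ↦ K * s⁻¹) ?_ ?_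
    · filter_upwards [eventually_gt_atTop 0] with s hs
      rw [Real.norm_eq_abs, abs_div, abs_of_pos hs, ← div_eq_mul_inv]
      gcongr
      exact (hK x s hs.le).2.1
    · simpa using tendsto_inv_atTop_zero.const_mul K

/-- Pairing the points `x + s` and `x - s` makes the cancellation of the principal value explicit:
the paired integrand is absolutely integrable down to `s = 0`. -/
theorem setIntegral_deriv_div_sub (hf : ContDiff ℝ ∞ f) (hc : HasCompactSupport f) (x : ℝ) {δ : ℝ}
    (hδ : 0 < δ) : ∫ z in {z : ℝ | δ < |x - z|}, deriv f z / (x - z) =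
      ∫ s in Set.Ioi δ, (deriv f (x - s) - deriv f (x + s)) / s := by
  have hd : Continuous (deriv f) := hf.continuous_deriv (by simp)
  have hi : Integrable (deriv f) := hd.integrable_of_hasCompactSupport hc.deriv
  have hm : MeasurableSet {z : ℝ | δ < |x - z|} := measurableSet_lt (by fun_prop) (by fun_prop)
  have hm' : MeasurableSet {s : ℝ | δ < |s|} := measurableSet_lt (by fun_prop) (by fun_prop)
  have e1 : ∫ z in {z : ℝ | δ < |x - z|}, deriv f z / (x - z) =
      ∫ s in {s : ℝ | δ < |s|}, deriv f (x - s) / s := by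
    rw [← integral_indicator hm, ← integral_indicator hm', ← integral_sub_left_eq_self _ volume x]
    congr 1 with s
    simp [Set.indicator]
  have e2 : {s : ℝ | δ < |s|} = Set.Iio (-δ) ∪ Set.Ioi δ := by
    ext s; simp only [Set.mem_ofPred_eq, lt_abs, Set.mem_union, Set.mem_Iio, Set.mem_Ioi]
    rw [lt_neg, or_comm]
  have key : ∀ {g : ℝ → ℝ}, Integrable g → Measurable g →
      IntegrableOn (fun s ↦ g s / s) {s : ℝ | δ < |s|} := by
    intro g hg hgm
    refine Integrable.mono' (hg.norm.div_const δ).integrableOn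
      (hgm.div measurable_id).aestronglyMeasurable ?_
    filter_upwards [ae_restrict_mem hm'] with s (hs : δ < |s|)
    rw [Real.norm_eq_abs, abs_div, Real.norm_eq_abs]
    gcongr
  have j1 := key (hi.comp_sub_left x) (by have := hd.measurable; fun_prop)
  have j2 := key (hi.comp_add_left x) (by have := hd.measurable; fun_prop)
  rw [e2] at j1 j2
  rw [e1, e2, setIntegral_union (by
      rw [Set.disjoint_left]; intro s hs hs'
      simp only [Set.mem_Iio, Set.mem_Ioi] at hs hs'; linarith) measurableSet_Ioi
      (j1.mono_set Set.subset_union_left) (j1.mono_set Set.subset_union_right)]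
  have e3 : ∫ s in Set.Iio (-δ), deriv f (x - s) / s = - ∫ s in Set.Ioi δ, deriv f (x + s) / s := by
    rw [← integral_Iic_eq_integral_Iio]
    have := integral_comp_neg_Ioi δ (fun s ↦ deriv f (x - s) / s)
    rw [← this, ← integral_neg]
    congr 1 with s
    rw [sub_neg_eq_add, div_neg]
  rw [e3]
  simp only [sub_div]
  rw [integral_sub (j1.mono_set Set.subset_union_right) (j2.mono_set Set.subset_union_right)]
  ring

theorem tendsto_setIntegral_deriv_div_sub (hf : ContDiff ℝ ∞ f) (hc : HasCompactSupport f)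
    (x : ℝ) : Tendsto (fun δ : ℝ ↦ ∫ z in {z : ℝ | δ < |x - z|}, deriv f z / (x - z)) (𝓝[>] 0)
      (𝓝 (∫ s in Set.Ioi (0 : ℝ), sdiff f x s / s ^ 2)) := by
  have i1 := integrableOn_deriv_sub_div hf hc x
  rw [← integral_deriv_sub_div hf hc x]
  set h : ℝ → ℝ := fun s ↦ (deriv f (x - s) - deriv f (x + s)) / s with hh
  have : Tendsto (fun δ : ℝ ↦ ∫ s in Set.Ioi (0 : ℝ), (Set.Ioi δ).indicator h s) (𝓝[>] 0)
      (𝓝 (∫ s in Set.Ioi (0 : ℝ), h s)) := by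
    refine tendsto_integral_filter_of_dominated_convergence (fun s ↦ ‖h s‖)
      (Eventually.of_forall fun δ ↦ i1.1.indicator measurableSet_Ioi)
      (Eventually.of_forall fun δ ↦ Eventually.of_forall fun s ↦ norm_indicator_le_norm_self _ _)
      i1.norm ?_
    filter_upwards [ae_restrict_mem measurableSet_Ioi] with s (hs : 0 < s)
    refine tendsto_const_nhds.congr' ?_
    filter_upwards [mem_nhdsWithin_of_mem_nhds (Iio_mem_nhds hs)] with δ hδ
    rw [Set.indicator_of_mem (by exact hδ)]
  refine this.congr' ?_
  filter_upwards [self_mem_nhdsWithin] with δ (hδ : 0 < δ)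
  rw [setIntegral_deriv_div_sub hf hc x hδ, setIntegral_indicator measurableSet_Ioi,
    Set.inter_eq_self_of_subset_right (Set.Ioi_subset_Ioi hδ.le)]

end Line

/-- The unit vector in the direction of propagation. -/
abbrev e0 : Plane := EuclideanSpace.single 0 1

theorem mk_eq (v : Plane) (s : ℝ) : !₂[v 0 + s, v 1] = v + s • e0 := by
  ext i; fin_cases i <;> simp [e0]

/-- The truncated integrals converge, so the `limUnder` in the definition is a genuine limit and not
a default value. -/
theorem IsTest.hilbertX_dx {f : Plane → ℝ} (hf : IsTest f) (v : Plane) :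
    hilbertX (BOZK.dx f) v = 1 / Real.pi *
      ∫ s in Set.Ioi (0 : ℝ), (2 * f v - f (v + s • e0) - f (v - s • e0)) / s ^ 2 := by
  set g : ℝ → ℝ := fun z ↦ f !₂[z, v 1] with hg
  have hmk : ∀ z, !₂[z, v 1] = v + (z - v 0) • e0 := fun z ↦ by
    rw [← mk_eq]; congr 2; ring
  have hgs : ContDiff ℝ ∞ g := by
    have : g = fun z ↦ f (v + (z - v 0) • e0) := funext fun z ↦ by rw [hg, ← hmk]
    rw [this]
    exact hf.1.comp (contDiff_const.add ((contDiff_id.sub contDiff_const).smul contDiff_const))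
  have hgc : HasCompactSupport g := by
    obtain ⟨R, hR⟩ := hf.2.isCompact.isBounded.subset_closedBall 0
    refine HasCompactSupport.intro (isCompact_closedBall (0 : ℝ) R) fun z hz ↦ ?_
    by_contra hne
    have := hR (subset_tsupport f hne)
    rw [mem_closedBall_zero_iff] at this hz
    exact hz ((norm_coord_le !₂[z, v 1] 0).trans this)
  have hgd : ∀ z, deriv g z = BOZK.dx f !₂[z, v 1] := by
    intro z
    rw [BOZK.dx, hf.lineDeriv_eq]
    have h1 : HasDerivAt (fun z : ℝ ↦ v + (z - v 0) • e0) e0 z := by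
      have := (((hasDerivAt_id z).sub_const (v 0)).smul_const e0).const_add v
      simpa using this
    have h2 := (hf.1.differentiable (by simp) (v + (z - v 0) • e0)).hasFDerivAt.comp_hasDerivAt z h1
    have h3 : g = f ∘ fun z ↦ v + (z - v 0) • e0 := funext fun z ↦ by
      simp only [hg, Function.comp, hmk]
    rw [h3, h2.deriv, hmk]
  have ht := (tendsto_setIntegral_deriv_div_sub hgs hgc (v 0)).const_mul (1 / Real.pi)
  unfold hilbertX
  simp only [← hgd]
  rw [ht.limUnder_eq]
  congr 1
  congr 1 with s
  unfold sdiff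
  have h0 : g (v 0) = f v := by simp only [hg]; rw [hmk]; simp
  have h1 : g (v 0 + s) = f (v + s • e0) := by simp only [hg]; rw [mk_eq]
  have h2 : g (v 0 - s) = f (v - s • e0) := by
    simp only [hg]; rw [sub_eq_add_neg (v 0), mk_eq, neg_smul, ← sub_eq_add_neg]
  rw [h0, h1, h2]

theorem IsTest.hilbertX_dx_comp_sub {f : Plane → ℝ} (hf : IsTest f) (v u : Plane) :
    hilbertX (BOZK.dx fun w ↦ f (w - v)) u = hilbertX (BOZK.dx f) (u - v) := by
  rw [hf.hilbertX_dx, (hf.comp_sub v).hilbertX_dx]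
  congr 1
  congr 1 with s
  simp only [add_sub_right_comm, sub_right_comm]

/-! ### The Fourier multiplier of the Hilbert transform of a derivative. -/

theorem integrableOn_one_sub_cos_div (a : ℝ) :
    IntegrableOn (fun s ↦ (2 - 2 * Real.cos (2 * Real.pi * s * a)) / s ^ 2) (Set.Ioi 0) := by
  refine Integrable.mono' (g := fun s ↦ (4 + 4 * Real.pi ^ 2 * a ^ 2) * (1 + s ^ 2)⁻¹)
    (integrable_inv_one_add_sq.const_mul _).integrableOn
    (by fun_prop : Measurable _).aestronglyMeasurable ?_
  filter_upwards [ae_restrict_mem measurableSet_Ioi] with s (hs : 0 < s)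
  exact norm_one_sub_cos_div_le a hs
where
  norm_one_sub_cos_div_le (a : ℝ) {s : ℝ} (hs : 0 < s) :
      ‖(2 - 2 * Real.cos (2 * Real.pi * s * a)) / s ^ 2‖ ≤
        (4 + 4 * Real.pi ^ 2 * a ^ 2) * (1 + s ^ 2)⁻¹ := by
    have h1 := Real.cos_le_one (2 * Real.pi * s * a)
    have h2 := Real.neg_one_le_cos (2 * Real.pi * s * a)
    have h3 := Real.one_sub_sq_div_two_le_cos (x := 2 * Real.pi * s * a)
    rw [Real.norm_eq_abs, abs_of_nonneg (div_nonneg (by linarith) (by positivity)),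
      ← div_eq_mul_inv, div_le_div_iff₀ (by positivity) (by positivity)]
    have h4 : (2 * Real.pi * s * a) ^ 2 = 4 * Real.pi ^ 2 * a ^ 2 * s ^ 2 := by ring
    nlinarith [sq_nonneg s]

/-- The constant in `∫₀^∞ (2 - 2 cos (2πas)) / s² ds = cosConst |a|`. -/
def cosConst : ℝ := ∫ s in Set.Ioi (0 : ℝ), (2 - 2 * Real.cos (2 * Real.pi * s * 1)) / s ^ 2

/-- Positivity is all that is needed: the value of the constant only rescales the Poisson time. -/
theorem cosConst_pos : 0 < cosConst := by
  have hpi := Real.pi_pos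
  unfold cosConst
  rw [setIntegral_pos_iff_support_of_nonneg_ae _ (integrableOn_one_sub_cos_div 1)]
  · refine lt_of_lt_of_le ?_ (measure_mono (?_ : Set.Ioo (0 : ℝ) (1 / 2) ⊆ _))
    · simp
    · intro s hs
      refine ⟨?_, hs.1⟩
      have : Real.cos (2 * Real.pi * s * 1) < Real.cos 0 :=
        Real.cos_lt_cos_of_nonneg_of_le_pi le_rfl (by nlinarith [hs.2]) (by
          have := hs.1; positivity)
      rw [Real.cos_zero] at this
      exact (div_pos (by linarith) (by have := hs.1; positivity)).ne'
  · refine Eventually.of_forall fun s ↦ div_nonneg ?_ (sq_nonneg s)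
    linarith [Real.cos_le_one (2 * Real.pi * s * 1)]

theorem integral_one_sub_cos_div (a : ℝ) :
    ∫ s in Set.Ioi (0 : ℝ), (2 - 2 * Real.cos (2 * Real.pi * s * a)) / s ^ 2 =
      cosConst * |a| := by
  rcases eq_or_ne a 0 with rfl | ha
  · simp
  have hb : 0 < |a| := abs_pos.2 ha
  have h := integral_comp_mul_left_Ioi
    (fun s ↦ (2 - 2 * Real.cos (2 * Real.pi * s * 1)) / s ^ 2) 0 hb
  rw [mul_zero] at h
  have e : ∀ s, (2 - 2 * Real.cos (2 * Real.pi * s * a)) / s ^ 2 =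
      |a| ^ 2 * ((2 - 2 * Real.cos (2 * Real.pi * (|a| * s) * 1)) / (|a| * s) ^ 2) := by
    intro s
    have : Real.cos (2 * Real.pi * (|a| * s) * 1) = Real.cos (2 * Real.pi * s * a) := by
      rw [← Real.cos_abs (2 * Real.pi * s * a), ← Real.cos_abs (2 * Real.pi * (|a| * s) * 1)]
      simp only [abs_mul, abs_abs, abs_one]
      ring_nf
    rw [this]
    rcases eq_or_ne s 0 with rfl | hs
    · simp
    · field_simp
  simp only [e]
  rw [integral_const_mul, h, smul_eq_mul, cosConst]
  field_simp

theorem IsTest.fourierInv_fhat_apply {f : Plane → ℝ} (hf : IsTest f) (v : Plane) :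
    (f v : ℂ) = ∫ ξ, (Real.fourierChar (inner ℝ ξ v) : ℂ) * fhat f ξ := by
  have := congrFun hf.fourierInv_fhat v
  rw [← this, Real.fourierInv_eq]
  rfl

theorem IsTest.integrable_fhat {f : Plane → ℝ} (hf : IsTest f) : Integrable (fhat f) := by
  have h := hf.mul_fhat (m := 1) continuous_const (C := 1) (fun ξ ↦ by
    simp only [Pi.one_apply, norm_one]; nlinarith [norm_nonneg ξ])
  simpa using h.1

theorem integrable_fourierChar_mul {h : Plane → ℂ} (hh : Integrable h) (v : Plane) :
    Integrable fun ξ ↦ (Real.fourierChar (inner ℝ ξ v) : ℂ) * h ξ := by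
  refine hh.norm.mono' ?_ (Eventually.of_forall fun ξ ↦ by
    rw [norm_mul, Circle.norm_coe, one_mul])
  exact (by fun_prop : Continuous fun ξ : Plane ↦
    (Real.fourierChar (inner ℝ ξ v) : ℂ)).aestronglyMeasurable.mul hh.1

/-- Shifting by `±s` along `x` multiplies the transform by conjugate phases, whose sum is `2 cos (2π
s ξ 0)`. -/
theorem IsTest.second_difference_eq {f : Plane → ℝ} (hf : IsTest f) (v : Plane) (s : ℝ) :
    ((2 * f v - f (v + s • e0) - f (v - s • e0) : ℝ) : ℂ) =
      ∫ ξ, ((2 - 2 * Real.cos (2 * Real.pi * s * ξ 0) : ℝ) : ℂ) *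
        ((Real.fourierChar (inner ℝ ξ v) : ℂ) * fhat f ξ) := by
  push_cast
  rw [hf.fourierInv_fhat_apply v, hf.fourierInv_fhat_apply, hf.fourierInv_fhat_apply,
    ← integral_const_mul, ← integral_sub, ← integral_sub]
  · congr 1 with ξ
    have h1 : inner ℝ ξ (v + s • e0) = inner ℝ ξ v + s * ξ 0 := by
      rw [inner_add_right, inner_smul_right, e0, EuclideanSpace.inner_single_right]; simp
    have h2 : inner ℝ ξ (v - s • e0) = inner ℝ ξ v - s * ξ 0 := by
      rw [inner_sub_right, inner_smul_right, e0, EuclideanSpace.inner_single_right]; simp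
    have h3 : (2 * Complex.cos (2 * Real.pi * s * ξ 0) : ℂ) =
        Real.fourierChar (s * ξ 0) + Real.fourierChar (-(s * ξ 0)) := by
      rw [Complex.two_cos, Real.fourierChar_apply, Real.fourierChar_apply]
      push_cast
      congr 2 <;> ring
    rw [h1, h2, sub_eq_add_neg (inner ℝ ξ v), AddChar.map_add_eq_mul, AddChar.map_add_eq_mul, h3]
    push_cast
    ring
  · exact ((integrable_fourierChar_mul hf.integrable_fhat _).const_mul _).sub
      (integrable_fourierChar_mul hf.integrable_fhat _)
  · exact integrable_fourierChar_mul hf.integrable_fhat _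
  · exact (integrable_fourierChar_mul hf.integrable_fhat _).const_mul _
  · exact integrable_fourierChar_mul hf.integrable_fhat _

theorem IsTest.mul_fhat_real {f : Plane → ℝ} (hf : IsTest f) {m : Plane → ℝ} (hm : Continuous m)
    {C : ℝ} (hC : ∀ ξ, |m ξ| ≤ C * (1 + ‖ξ‖) ^ 2) :
    Integrable (fun ξ ↦ (m ξ : ℂ) * fhat f ξ) ∧ MemLp (fun ξ ↦ (m ξ : ℂ) * fhat f ξ) 2 :=
  hf.mul_fhat (m := fun ξ ↦ (m ξ : ℂ)) (by fun_prop)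
    (fun ξ ↦ by rw [Complex.norm_real]; exact hC ξ)

theorem abs_mul_abs_coord_le (a : ℝ) (ξ : Plane) : |a * abs (ξ 0)| ≤ |a| * (1 + ‖ξ‖) ^ 2 := by
  rw [abs_mul, abs_abs]
  have h0 := norm_coord_le ξ 0
  gcongr
  nlinarith [norm_nonneg ξ]

/-- The operator `𝓗 ∂_x` is, up to the value of a positive constant, the Fourier multiplier with
symbol `|ξ₁|`. -/
theorem IsTest.hilbertX_dx_eq_fourierInv {f : Plane → ℝ} (hf : IsTest f) (v : Plane) :
    (hilbertX (BOZK.dx f) v : ℂ) =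
      𝓕⁻ (fun ξ ↦ ((cosConst / Real.pi * |ξ 0| : ℝ) : ℂ) * fhat f ξ) v := by
  have hpi := Real.pi_pos
  rw [hf.hilbertX_dx, Complex.ofReal_mul, ← integral_complex_ofReal]
  set G : ℝ → Plane → ℂ := fun s ξ ↦
    (((2 - 2 * Real.cos (2 * Real.pi * s * ξ 0)) / s ^ 2 : ℝ) : ℂ) *
      ((Real.fourierChar (inner ℝ ξ v) : ℂ) * fhat f ξ) with hG
  have e1 : ∀ s, (((2 * f v - f (v + s • e0) - f (v - s • e0)) / s ^ 2 : ℝ) : ℂ) = ∫ ξ, G s ξ := by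
    intro s
    rw [Complex.ofReal_div, hf.second_difference_eq, div_eq_mul_inv, ← integral_mul_const]
    congr 1 with ξ
    simp only [hG]
    push_cast; ring
  have hb := (hf.mul_fhat_real (m := fun ξ : Plane ↦ 4 + 4 * Real.pi ^ 2 * ξ 0 ^ 2)
    (C := 4 + 4 * Real.pi ^ 2) (by fun_prop) (fun ξ ↦ by
      rw [abs_of_nonneg (by positivity)]
      have h0 : ξ 0 ^ 2 ≤ ‖ξ‖ ^ 2 := by
        rw [← sq_abs]; exact pow_le_pow_left₀ (abs_nonneg _) (norm_coord_le ξ 0) 2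
      have hn := norm_nonneg ξ
      have e1 : 4 * Real.pi ^ 2 * ξ 0 ^ 2 ≤ 4 * Real.pi ^ 2 * (1 + ‖ξ‖) ^ 2 :=
        mul_le_mul_of_nonneg_left (by nlinarith) (by positivity)
      nlinarith)).1
  have hGi : Integrable (Function.uncurry G) ((volume.restrict (Set.Ioi (0 : ℝ))).prod volume) := by
    refine Integrable.mono' ((integrable_inv_one_add_sq.integrableOn (s := Set.Ioi 0)).mul_prod
      hb.norm) ?_ ?_
    · have m1 : Measurable fun p : ℝ × Plane ↦
          (((2 - 2 * Real.cos (2 * Real.pi * p.1 * p.2 0)) / p.1 ^ 2 : ℝ) : ℂ) := by fun_prop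
      have m2 : Continuous fun p : ℝ × Plane ↦
          (Real.fourierChar (inner ℝ p.2 v) : ℂ) * fhat f p.2 := by
        have := hf.continuous_fhat; fun_prop
      exact m1.aestronglyMeasurable.mul m2.aestronglyMeasurable
    · have : ∀ᵐ p : ℝ × Plane ∂((volume.restrict (Set.Ioi (0 : ℝ))).prod volume), 0 < p.1 := by
        have h0 : ∀ᵐ t ∂(volume.restrict (Set.Ioi (0 : ℝ))), 0 < t :=
          ae_restrict_mem measurableSet_Ioi
        exact Measure.quasiMeasurePreserving_fst.ae h0
      filter_upwards [this] with p hp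
      simp only [hG, Function.uncurry, norm_mul, Complex.norm_real, Circle.norm_coe, one_mul]
      have h := integrableOn_one_sub_cos_div.norm_one_sub_cos_div_le (p.2 0) hp
      have h' : ‖4 + 4 * Real.pi ^ 2 * p.2 0 ^ 2‖ = 4 + 4 * Real.pi ^ 2 * p.2 0 ^ 2 :=
        Real.norm_of_nonneg (by positivity)
      rw [h', ← mul_assoc, mul_comm (1 + p.1 ^ 2)⁻¹]
      gcongr
  simp only [e1]
  rw [integral_integral_swap hGi, Real.fourierInv_eq, ← integral_const_mul]
  congr 1 with ξ
  simp only [hG]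
  rw [integral_mul_const, integral_complex_ofReal, integral_one_sub_cos_div, Circle.smul_def,
    smul_eq_mul]
  push_cast
  ring

/-! ### The elliptic operator and its fundamental solution. -/

/-- The elliptic operator `c + a 𝓗 ∂_x - ∂_y²`. -/
def ellip (c a : ℝ) (f : Plane → ℝ) (v : Plane) : ℝ :=
  c * f v + a * hilbertX (dx f) v - dy (dy f) v

theorem dy_comp_sub (f : Plane → ℝ) (v u : Plane) :
    dy (fun w ↦ f (w - v)) u = dy f (u - v) := by
  unfold dy lineDeriv
  simp only [add_sub_right_comm]

theorem IsTest.ellip_comp_sub {f : Plane → ℝ} (hf : IsTest f) (c a : ℝ) (v u : Plane) :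
    ellip c a (fun w ↦ f (w - v)) u = ellip c a f (u - v) := by
  unfold ellip
  rw [hf.hilbertX_dx_comp_sub, funext (dy_comp_sub f v), dy_comp_sub (BOZK.dy f)]

theorem IsTest.hilbertX_dx_memLp {f : Plane → ℝ} (hf : IsTest f) :
    Continuous (hilbertX (BOZK.dx f)) ∧ MemLp (hilbertX (BOZK.dx f)) 2 volume := by
  have h := hf.mul_fhat_real (m := fun ξ : Plane ↦ cosConst / Real.pi * |ξ 0|)
    (C := |cosConst / Real.pi|) (by fun_prop) (abs_mul_abs_coord_le _)
  have e : (fun v ↦ (hilbertX (BOZK.dx f) v : ℂ)) = _ := funext hf.hilbertX_dx_eq_fourierInv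
  have h1 := continuous_fourierInv h.1
  have h2 := (fourierInv_memLp_eLpNorm h.1 h.2).1
  have e' : (𝓕⁻ (fun ξ ↦ ((cosConst / Real.pi * |ξ 0| : ℝ) : ℂ) * fhat f ξ)) =
    fun v ↦ (hilbertX (BOZK.dx f) v : ℂ) := by rw [e]
  rw [e'] at h1 h2
  exact ⟨Complex.continuous_re.comp h1, by simpa using h2.re⟩

theorem IsTest.ellip_eq_fourierInv {f : Plane → ℝ} (hf : IsTest f) (c a : ℝ) (v : Plane) :
    -- The constant in `symb` solves `2π A = a * cosConst / π`.
    (ellip c a f v : ℂ) =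
      𝓕⁻ (fun ξ ↦ ((c + symb (a * cosConst / (2 * Real.pi ^ 2)) ξ : ℝ) : ℂ) * fhat f ξ) v := by
  have hpi := Real.pi_pos
  have i1 := (hf.mul_fhat_real (m := fun ξ : Plane ↦ cosConst / Real.pi * |ξ 0|)
    (C := |cosConst / Real.pi|) (by fun_prop) (abs_mul_abs_coord_le _)).1
  have i2 := hf.integrable_fhat
  have i3 := hf.dy.dy.integrable_fhat
  unfold ellip
  push_cast
  rw [hf.hilbertX_dx_eq_fourierInv, hf.fourierInv_fhat_apply v,
    hf.dy.dy.fourierInv_fhat_apply v, Real.fourierInv_eq, Real.fourierInv_eq]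
  simp only [Circle.smul_def, smul_eq_mul]
  rw [← integral_const_mul, ← integral_const_mul, ← integral_add, ← integral_sub]
  · congr 1 with ξ
    rw [hf.dy.fhat_dy, hf.fhat_dy, symb]
    push_cast
    have hpiC : (Real.pi : ℂ) ≠ 0 := by exact_mod_cast hpi.ne'
    field_simp
    ring_nf
    simp only [Complex.I_sq]
    ring
  · exact ((integrable_fourierChar_mul i2 v).const_mul _).add
      ((integrable_fourierChar_mul i1 v).const_mul _)
  · exact integrable_fourierChar_mul i3 v
  · exact (integrable_fourierChar_mul i2 v).const_mul _
  · exact (integrable_fourierChar_mul i1 v).const_mul _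

/-- The density of the fundamental solution of `c + symb A`. -/
def resolventDensity (A c : ℝ) (v : Plane) : ℝ≥0∞ :=
  ∫⁻ t in Set.Ioi (0 : ℝ), ENNReal.ofReal (Real.exp (-(c * t)) * kern A t v)

/-- The fundamental solution of `c + symb A`, as a measure on the plane. -/
def resolvent (A c : ℝ) : Measure Plane := volume.withDensity (resolventDensity A c)

theorem measurable_exp_mul_kern (A c : ℝ) :
    Measurable fun p : ℝ × Plane ↦ Real.exp (-(c * p.1)) * kern A p.1 p.2 :=
  (by fun_prop : Measurable fun p : ℝ × Plane ↦ Real.exp (-(c * p.1))).mul (measurable_kern A)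

theorem measurable_resolventDensity (A c : ℝ) : Measurable (resolventDensity A c) :=
  Measurable.lintegral_prod_left' (f := fun p : ℝ × Plane ↦
    ENNReal.ofReal (Real.exp (-(c * p.1)) * kern A p.1 p.2)) (measurable_exp_mul_kern A c).ennreal_ofReal

theorem resolventDensity_neg (A c : ℝ) (v : Plane) :
    resolventDensity A c (-v) = resolventDensity A c v := by
  unfold resolventDensity
  simp only [kern_neg]

theorem resolvent_absolutelyContinuous (A c : ℝ) : resolvent A c ≪ volume :=
  withDensity_absolutelyContinuous _ _

theorem lintegral_resolvent (A c : ℝ) {f : Plane → ℝ≥0∞} (hf : Measurable f) :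
    ∫⁻ v, f v ∂resolvent A c =
      ∫⁻ t in Set.Ioi (0 : ℝ), ∫⁻ v, ENNReal.ofReal (Real.exp (-(c * t)) * kern A t v) * f v := by
  unfold resolvent
  rw [lintegral_withDensity_eq_lintegral_mul _ (measurable_resolventDensity A c) hf,
    lintegral_lintegral_swap]
  · congr 1 with v
    rw [Pi.mul_apply, resolventDensity, lintegral_mul_const]
    exact ((measurable_exp_mul_kern A c).comp
      (by fun_prop : Measurable fun t : ℝ ↦ (t, v))).ennreal_ofReal
  · exact ((measurable_exp_mul_kern A c).ennreal_ofReal.mul (hf.comp measurable_snd)).aemeasurable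

theorem lintegral_comp_neg_resolvent (A c : ℝ) {f : Plane → ℝ≥0∞} (hf : Measurable f) :
    ∫⁻ v, f (-v) ∂resolvent A c = ∫⁻ v, f v ∂resolvent A c := by
  unfold resolvent
  have hm := measurable_resolventDensity A c
  rw [lintegral_withDensity_eq_lintegral_mul _ hm hf,
    lintegral_withDensity_eq_lintegral_mul _ hm (by fun_prop), ← lintegral_neg_eq_self]
  congr 1 with v
  simp [resolventDensity_neg]

theorem lintegral_exp_lt_top {c : ℝ} (hc : 0 < c) :
    ∫⁻ t in Set.Ioi (0 : ℝ), ENNReal.ofReal (Real.exp (-(c * t))) < ⊤ := by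
  have := lintegral_rpow_mul_exp_lt_top (s := 0) (by norm_num) hc
  simpa using this

theorem isFiniteMeasure_resolvent {A c : ℝ} (hA : 0 < A) (hc : 0 < c) :
    IsFiniteMeasure (resolvent A c) := by
  refine ⟨?_⟩
  have := lintegral_resolvent A c (f := fun _ ↦ 1) measurable_const
  rw [lintegral_one] at this
  rw [this]
  refine lt_of_le_of_lt (le_of_eq ?_) (lintegral_exp_lt_top hc)
  refine setLIntegral_congr_fun measurableSet_Ioi fun t (ht : 0 < t) ↦ ?_
  simp only [mul_one, ENNReal.ofReal_mul (Real.exp_pos _).le]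
  rw [lintegral_const_mul _ (measurable_ofReal_kern A t), lintegral_kern hA ht, mul_one]

theorem lintegral_comp_sub_resolvent (A c : ℝ) {f : Plane → ℝ≥0∞} (hf : Measurable f)
    (w : Plane) : ∫⁻ v, f (w - v) ∂resolvent A c =
      ∫⁻ t in Set.Ioi (0 : ℝ), ENNReal.ofReal (Real.exp (-(c * t))) * kconv A t f w := by
  rw [lintegral_resolvent A c (by fun_prop)]
  congr 1 with t
  unfold kconv
  rw [← lintegral_const_mul' _ _ ENNReal.ofReal_ne_top]
  congr 1 with v
  rw [ENNReal.ofReal_mul (Real.exp_pos _).le, mul_assoc]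

theorem lintegral_comp_add_resolvent (A c : ℝ) {f : Plane → ℝ≥0∞} (hf : Measurable f)
    (w : Plane) : ∫⁻ v, f (w + v) ∂resolvent A c = ∫⁻ v, f (w - v) ∂resolvent A c := by
  rw [← lintegral_comp_neg_resolvent A c (by fun_prop)]
  simp only [sub_eq_add_neg]

/-- The resolvent maps `L^s` to `L^∞` for `s > 3/2`. -/
theorem exists_lintegral_resolvent_le {A c s : ℝ} (hA : 0 < A) (hc : 0 < c) (hs : 3 / 2 < s) :
    ∃ C : ℝ≥0∞, C < ⊤ ∧ ∀ V : Plane → ℝ≥0∞, Measurable V → ∀ w,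
      ∫⁻ v, V (w - v) ∂resolvent A c ≤ C * (∫⁻ v, V v ^ s) ^ (1 / s) := by
  have hs0 : 0 < s := by linarith
  -- Jensen and the sup bound of the kernel give the factor `t^{-3/(2s)}`, integrable at `0` exactly
  -- when `s > 3/2`.
  have hI := lintegral_rpow_mul_exp_lt_top (s := -(3 / 2) * (1 / s)) (c := c) (by
    have : 3 / 2 * (1 / s) < 1 := by rw [mul_one_div, div_lt_one hs0]; exact hs
    linarith) hc
  refine ⟨ENNReal.ofReal ((1 / A) ^ (1 / s)) * _, ENNReal.mul_lt_top ENNReal.ofReal_lt_top hI,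
    fun V hV w ↦ ?_⟩
  have key : ∀ t : ℝ, 0 < t → kconv A t V w ≤
      ENNReal.ofReal ((1 / A) ^ (1 / s) * t ^ (-(3 / 2) * (1 / s))) * (∫⁻ v, V v ^ s) ^ (1 / s) := by
    intro t ht
    have h1 := (kconv_rpow_le hA ht hV (by linarith : 1 < s) w).trans (kconv_le hA ht _ w)
    have h2 := ENNReal.rpow_le_rpow h1 (by positivity : 0 ≤ 1 / s)
    rw [← ENNReal.rpow_mul, mul_one_div_cancel hs0.ne', ENNReal.rpow_one,
      ENNReal.mul_rpow_of_nonneg _ _ (by positivity),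
      ENNReal.ofReal_rpow_of_nonneg (by positivity) (by positivity),
      Real.mul_rpow (by positivity) (by positivity), ← Real.rpow_mul ht.le] at h2
    exact h2
  rw [lintegral_comp_sub_resolvent A c hV]
  calc _ ≤ ∫⁻ t in Set.Ioi (0 : ℝ), (ENNReal.ofReal ((1 / A) ^ (1 / s)) *
        ENNReal.ofReal (t ^ (-(3 / 2) * (1 / s)) * Real.exp (-(c * t)))) *
          (∫⁻ v, V v ^ s) ^ (1 / s) := by
        refine setLIntegral_mono' measurableSet_Ioi fun t (ht : 0 < t) ↦ ?_
        calc _ ≤ ENNReal.ofReal (Real.exp (-(c * t))) *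
              (ENNReal.ofReal ((1 / A) ^ (1 / s) * t ^ (-(3 / 2) * (1 / s))) *
                (∫⁻ v, V v ^ s) ^ (1 / s)) := by gcongr; exact key t ht
          _ = _ := by
            rw [← mul_assoc, ← ENNReal.ofReal_mul (by positivity),
              ← ENNReal.ofReal_mul (by positivity)]
            congr 2; ring
    _ = _ := by
        rw [lintegral_mul_const _ (by fun_prop), lintegral_const_mul _ (by fun_prop)]

theorem integrable_exp_mul_kern {A c : ℝ} (hA : 0 < A) (hc : 0 < c) :
    Integrable (fun p : ℝ × Plane ↦ Real.exp (-(c * p.1)) * kern A p.1 p.2)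
      ((volume.restrict (Set.Ioi (0 : ℝ))).prod volume) := by
  refine ⟨(measurable_exp_mul_kern A c).aestronglyMeasurable, ?_⟩
  have h := (isFiniteMeasure_resolvent hA hc).measure_univ_lt_top
  rw [← lintegral_one, lintegral_resolvent A c measurable_const] at h
  rw [HasFiniteIntegral, lintegral_prod _ (measurable_exp_mul_kern A c).enorm.aemeasurable]
  refine lt_of_le_of_lt (le_of_eq ?_) h
  refine setLIntegral_congr_fun measurableSet_Ioi fun t (ht : 0 < t) ↦ ?_
  congr 1 with v
  rw [mul_one, Real.enorm_of_nonneg (mul_nonneg (Real.exp_pos _).le (kern_nonneg hA.le ht.le v))]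

theorem resolventDensity_toReal {A : ℝ} (hA : 0 < A) (c : ℝ) (v : Plane) :
    (resolventDensity A c v).toReal =
      ∫ t in Set.Ioi (0 : ℝ), Real.exp (-(c * t)) * kern A t v := by
  rw [integral_eq_lintegral_of_nonneg_ae, resolventDensity]
  · filter_upwards [ae_restrict_mem measurableSet_Ioi] with t (ht : 0 < t)
    exact mul_nonneg (Real.exp_pos _).le (kern_nonneg hA.le ht.le v)
  · exact ((measurable_exp_mul_kern A c).comp
      (by fun_prop : Measurable fun t : ℝ ↦ (t, v))).aestronglyMeasurable

theorem integral_resolvent {A c : ℝ} (hA : 0 < A) (hc : 0 < c) {g : Plane → ℂ}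
    (hg : Continuous g) {M : ℝ} (hM : ∀ v, ‖g v‖ ≤ M) :
    ∫ v, g v ∂resolvent A c =
      ∫ t in Set.Ioi (0 : ℝ), (Real.exp (-(c * t)) : ℂ) * ∫ v, (kern A t v : ℂ) * g v := by
  -- The density is infinite at the origin, but its total mass is finite, hence it is finite almost
  -- everywhere.
  have hfin : ∫⁻ v, resolventDensity A c v ≠ ⊤ := by
    have := (isFiniteMeasure_resolvent hA hc).measure_univ_lt_top
    rw [resolvent, withDensity_apply _ MeasurableSet.univ, Measure.restrict_univ] at this
    exact this.ne
  have hae := ae_lt_top (measurable_resolventDensity A c) hfin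
  have hint : Integrable (Function.uncurry fun (t : ℝ) (v : Plane) ↦
      ((Real.exp (-(c * t)) * kern A t v : ℝ) : ℂ) * g v)
      ((volume.restrict (Set.Ioi (0 : ℝ))).prod volume) := by
    refine Integrable.mul_bdd (c := M) (integrable_exp_mul_kern hA hc).ofReal
      (hg.comp continuous_snd).aestronglyMeasurable (Eventually.of_forall fun p ↦ hM p.2)
  unfold resolvent
  rw [integral_withDensity_eq_integral_toReal_smul (measurable_resolventDensity A c) hae]
  calc _ = ∫ v, ∫ t in Set.Ioi (0 : ℝ), ((Real.exp (-(c * t)) * kern A t v : ℝ) : ℂ) * g v := by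
        congr 1 with v
        rw [resolventDensity_toReal hA, integral_mul_const, integral_complex_ofReal,
          Complex.real_smul]
    _ = _ := by
        rw [← integral_integral_swap hint]
        congr 1 with t
        rw [← integral_const_mul]
        congr 1 with v
        push_cast; ring

theorem IsTest.continuous_ellip {f : Plane → ℝ} (hf : IsTest f) (c a : ℝ) :
    Continuous (ellip c a f) :=
  ((hf.continuous.const_mul c).add (hf.hilbertX_dx_memLp.1.const_mul a)).sub hf.dy.dy.continuous

theorem IsTest.exists_abs_ellip_le {f : Plane → ℝ} (hf : IsTest f) {c a : ℝ} (hc : 0 < c)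
    (ha : 0 < a) : Integrable (fun ξ ↦
        ((c + symb (a * cosConst / (2 * Real.pi ^ 2)) ξ : ℝ) : ℂ) * fhat f ξ) ∧
      ∃ M, ∀ v, |ellip c a f v| ≤ M := by
  have hA : 0 < a * cosConst / (2 * Real.pi ^ 2) := by
    have := cosConst_pos; have := Real.pi_pos; positivity
  set A := a * cosConst / (2 * Real.pi ^ 2)
  have h := (hf.mul_fhat_real (m := fun ξ ↦ c + symb A ξ)
    (continuous_const.add (continuous_symb A)) (fun ξ ↦ by
      rw [abs_of_nonneg (by linarith [symb_nonneg hA.le ξ])]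
      exact add_symb_le hA.le hc.le ξ)).1
  refine ⟨h, ∫ ξ, ‖((c + symb A ξ : ℝ) : ℂ) * fhat f ξ‖, fun v ↦ ?_⟩
  rw [← Real.norm_eq_abs, ← Complex.norm_real, hf.ellip_eq_fourierInv]
  exact VectorFourier.norm_fourierIntegral_le_integral_norm _ _ _ _ _

/-- The resolvent inverts the elliptic operator on test functions. -/
theorem IsTest.integral_ellip_resolvent {f : Plane → ℝ} (hf : IsTest f) {c a : ℝ} (hc : 0 < c)
    (ha : 0 < a) (u : Plane) :
    ∫ v, ellip c a f (u - v) ∂resolvent (a * cosConst / (2 * Real.pi ^ 2)) c = f u := by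
  have hA : 0 < a * cosConst / (2 * Real.pi ^ 2) := by
    have := cosConst_pos; have := Real.pi_pos; positivity
  obtain ⟨hi, M, hM⟩ := hf.exists_abs_ellip_le hc ha
  set A := a * cosConst / (2 * Real.pi ^ 2) with hAdef
  have hw : ∀ ξ, 0 < c + symb A ξ := fun ξ ↦ by linarith [symb_nonneg hA.le ξ]
  have hcont : Continuous fun v ↦ (ellip c a f (u - v) : ℂ) := by
    have := hf.continuous_ellip c a; fun_prop
  have e := integral_resolvent hA hc hcont (M := M)
    (fun v ↦ by rw [Complex.norm_real]; exact hM _)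
  rw [← Complex.ofReal_inj, ← integral_complex_ofReal, e]
  -- With `σ = 1` the power of `t` disappears and the superposition is exactly the resolvent.
  have h := integral_rpow_mul_kern_mul_fourierInv hA hc one_pos hi u
  have e1 : (fun ξ ↦ (((c + symb A ξ) ^ (-1 : ℝ) : ℝ) : ℂ) *
      (((c + symb A ξ : ℝ) : ℂ) * fhat f ξ)) = fhat f := by
    funext ξ
    rw [← mul_assoc, ← Complex.ofReal_mul, Real.rpow_neg_one, inv_mul_cancel₀ (hw ξ).ne']
    simp
  rw [e1, hf.fourierInv_fhat, Real.Gamma_one] at h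
  simp only [Complex.ofReal_one, one_mul] at h
  rw [← h]
  refine setIntegral_congr_fun measurableSet_Ioi fun t (ht : 0 < t) ↦ ?_
  simp only [sub_self, Real.rpow_zero, one_mul, hf.ellip_eq_fourierInv]
  rfl

/-! ### Weighted estimates for the fundamental solution. -/

theorem lintegral_poisson {a : ℝ} (ha : 0 < a) : ∫⁻ x, ENNReal.ofReal (poisson a x) = 1 := by
  have h := fourier_poisson ha 0
  rw [Real.fourier_eq] at h
  simp only [inner_zero_right, neg_zero, AddChar.map_zero_eq_one, one_smul, abs_zero, mul_zero,
    Real.exp_zero] at h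
  rw [integral_complex_ofReal] at h
  rw [← ofReal_integral_eq_lintegral_ofReal (integrable_poisson ha)
    (Eventually.of_forall fun v ↦ poisson_nonneg ha.le v), Complex.ofReal_inj.1 h,
    ENNReal.ofReal_one]

theorem lintegral_heat {t : ℝ} (ht : 0 < t) : ∫⁻ y, ENNReal.ofReal (heat t y) = 1 := by
  have h := fourier_heat ht 0
  rw [Real.fourier_eq] at h
  simp only [inner_zero_right, neg_zero, AddChar.map_zero_eq_one, one_smul, ne_eq,
    OfNat.ofNat_ne_zero, not_false_eq_true, zero_pow, mul_zero, Real.exp_zero] at h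
  rw [integral_complex_ofReal] at h
  rw [← ofReal_integral_eq_lintegral_ofReal (integrable_heat ht)
    (Eventually.of_forall fun v ↦ heat_nonneg t v), Complex.ofReal_inj.1 h,
    ENNReal.ofReal_one]

/-- Half of the Gaussian exponent absorbs `b|y|` by completing the square; the other half is the
heat kernel at time `2t`. -/
theorem exp_mul_heat_le {t : ℝ} (ht : 0 < t) (b y : ℝ) :
    Real.exp (b * |y|) * heat t y ≤
      Real.exp (2 * b ^ 2 * t) * (Real.sqrt 2 * heat (2 * t) y) := by
  have hpi := Real.pi_pos
  unfold heat
  have h1 : Real.sqrt (4 * Real.pi * (2 * t)) = Real.sqrt 2 * Real.sqrt (4 * Real.pi * t) := by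
    rw [← Real.sqrt_mul (by norm_num)]; congr 1; ring
  have h2 : 0 < Real.sqrt 2 := by positivity
  have h3 : 0 < Real.sqrt (4 * Real.pi * t) := by positivity
  rw [h1, ← mul_div_assoc (Real.sqrt 2), mul_div_mul_left _ _ h2.ne', ← mul_div_assoc,
    ← mul_div_assoc, ← Real.exp_add, ← Real.exp_add]
  gcongr Real.exp ?_ / _
  have e : 2 * b ^ 2 * t + -(y ^ 2 / (4 * (2 * t))) - (b * |y| + -(y ^ 2 / (4 * t))) =
      (|y| - 4 * b * t) ^ 2 / (8 * t) := by
    rw [sub_sq, sq_abs]; field_simp; ring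
  have : 0 ≤ (|y| - 4 * b * t) ^ 2 / (8 * t) := by positivity
  linarith

/-- The weight `(1 + |x|)^a exp (b |y|)`. -/
def wt (a b : ℝ) (v : Plane) : ℝ := (1 + |v 0|) ^ a * Real.exp (b * |v 1|)

theorem wt_pos (a b : ℝ) (v : Plane) : 0 < wt a b v := by
  unfold wt; positivity

theorem measurable_wt (a b : ℝ) : Measurable (wt a b) := by
  unfold wt; fun_prop

theorem one_le_wt {a b : ℝ} (ha : 0 ≤ a) (hb : 0 ≤ b) (v : Plane) : 1 ≤ wt a b v :=
  one_le_mul_of_one_le_of_one_le (Real.one_le_rpow (by linarith [abs_nonneg (v 0)]) ha)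
    (Real.one_le_exp (by positivity))

/-- Submultiplicativity lets the weight pass through the integral inequality: one factor goes to the
unknown, the other to the fundamental solution. -/
theorem wt_le_wt_mul {a b : ℝ} (ha : 0 ≤ a) (hb : 0 ≤ b) (w v : Plane) :
    wt a b w ≤ wt a b (w + v) * wt a b v := by
  unfold wt
  have h0 : |w 0| ≤ |w 0 + v 0| + |v 0| := by
    simpa using abs_sub (w 0 + v 0) (v 0)
  have h1 : |w 1| ≤ |w 1 + v 1| + |v 1| := by
    simpa using abs_sub (w 1 + v 1) (v 1)
  simp only [PiLp.add_apply]
  rw [mul_mul_mul_comm, ← Real.mul_rpow (by positivity) (by positivity), ← Real.exp_add, ← mul_add]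
  gcongr
  nlinarith [abs_nonneg (w 0 + v 0), abs_nonneg (v 0),
    mul_nonneg (abs_nonneg (w 0 + v 0)) (abs_nonneg (v 0))]

/-- For `|x| ≤ 1` the weight is at most `2`; for `|x| ≥ 1` the kernel is at most `s / x² ≤ 4s / (1 +
|x|)²`. The last term is integrable in `x` because `a < 1`. -/
theorem rpow_mul_poisson_le {a s : ℝ} (ha1 : a < 1) (hs : 0 < s) (x : ℝ) :
    (1 + |x|) ^ a * poisson s x ≤ 2 * poisson s x + s * (4 * (1 + |x|) ^ (-(2 - a))) := by
  have hx := abs_nonneg x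
  have hp := poisson_nonneg hs.le x
  rcases le_total |x| 1 with h | h
  · have : (1 + |x|) ^ a ≤ 2 := by
      calc (1 + |x|) ^ a ≤ (1 + |x|) ^ (1 : ℝ) :=
            Real.rpow_le_rpow_of_exponent_le (by linarith) ha1.le
        _ ≤ 2 := by rw [Real.rpow_one]; linarith
    have h2 : 0 ≤ s * (4 * (1 + |x|) ^ (-(2 - a))) := by positivity
    nlinarith
  · have h1 : poisson s x ≤ s * (4 * ((1 + |x|) ^ (2 : ℝ))⁻¹) := by
      unfold poisson
      have h3 : s / (s ^ 2 + x ^ 2) / Real.pi ≤ s / (s ^ 2 + x ^ 2) :=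
        div_le_self (by positivity) (by linarith [Real.pi_gt_three])
      refine h3.trans ?_
      rw [Real.rpow_two, div_eq_mul_inv]
      gcongr
      rw [← div_eq_mul_inv, inv_eq_one_div, div_le_div_iff₀ (by positivity) (by positivity),
        ← sq_abs x]
      nlinarith [sq_nonneg s]
    have h4 : (1 + |x|) ^ (-(2 - a)) = (1 + |x|) ^ a * ((1 + |x|) ^ (2 : ℝ))⁻¹ := by
      rw [← Real.rpow_neg (by positivity), ← Real.rpow_add (by positivity)]; congr 1; ring
    calc _ ≤ (1 + |x|) ^ a * (s * (4 * ((1 + |x|) ^ (2 : ℝ))⁻¹)) := by gcongr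
      _ = s * (4 * (1 + |x|) ^ (-(2 - a))) := by rw [h4]; ring
      _ ≤ _ := by linarith

/-- The exponential weight costs `e^{2b²t}`, and `4b² ≤ c` keeps this below `e^{ct/2}`, so half of
the damping `e^{-ct}` remains. The Poisson factor grows only linearly in `t`. -/
theorem lintegral_wt_resolvent_lt_top {A c a b : ℝ} (hA : 0 < A) (hc : 0 < c)
    (ha1 : a < 1) (hb : 4 * b ^ 2 ≤ c) :
    ∫⁻ v, ENNReal.ofReal (wt a b v) ∂resolvent A c < ⊤ := by
  rw [lintegral_resolvent A c (measurable_wt a b).ennreal_ofReal]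
  set D : ℝ≥0∞ := ∫⁻ x : ℝ, ENNReal.ofReal (4 * (1 + |x|) ^ (-(2 - a))) with hD
  have hDt : D < ⊤ := by
    have := (integrable_one_add_norm (E := ℝ) (μ := volume) (r := 2 - a) (by simp; linarith))
    exact (this.const_mul 4).lintegral_lt_top
  have hP : ∀ t : ℝ, 0 < t → ∫⁻ x : ℝ, ENNReal.ofReal ((1 + |x|) ^ a * poisson (A * t) x) ≤
      2 + ENNReal.ofReal (A * t) * D := by
    intro t ht
    have hAt := mul_pos hA ht
    have hpm : Measurable (poisson (A * t)) := by unfold poisson; fun_prop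
    calc _ ≤ ∫⁻ x : ℝ, (2 * ENNReal.ofReal (poisson (A * t) x) +
          ENNReal.ofReal (A * t) * ENNReal.ofReal (4 * (1 + |x|) ^ (-(2 - a)))) := by
          refine lintegral_mono fun x ↦ ?_
          refine (ENNReal.ofReal_le_ofReal (rpow_mul_poisson_le ha1 hAt x)).trans ?_
          rw [ENNReal.ofReal_add (by have := poisson_nonneg hAt.le x; positivity) (by positivity),
            ENNReal.ofReal_mul zero_le_two, ENNReal.ofReal_mul hAt.le]
          simp
      _ = _ := by
          rw [lintegral_add_left (by fun_prop), lintegral_const_mul _ (by fun_prop),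
            lintegral_const_mul _ (by fun_prop), lintegral_poisson hAt, mul_one]
  have hH : ∀ t : ℝ, 0 < t → ∫⁻ y : ℝ, ENNReal.ofReal (Real.exp (b * |y|) * heat t y) ≤
      ENNReal.ofReal (Real.exp (2 * b ^ 2 * t) * Real.sqrt 2) := by
    intro t ht
    calc _ ≤ ∫⁻ y : ℝ, ENNReal.ofReal (Real.exp (2 * b ^ 2 * t) * Real.sqrt 2) *
          ENNReal.ofReal (heat (2 * t) y) := by
          refine lintegral_mono fun y ↦ ?_
          rw [← ENNReal.ofReal_mul (by positivity), mul_assoc]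
          exact ENNReal.ofReal_le_ofReal (exp_mul_heat_le ht b y)
      _ = _ := by
          rw [lintegral_const_mul' _ _ ENNReal.ofReal_ne_top, lintegral_heat (by linarith), mul_one]
  have key : ∀ t : ℝ, 0 < t → ∫⁻ v, ENNReal.ofReal (Real.exp (-(c * t)) * kern A t v) *
      ENNReal.ofReal (wt a b v) ≤ ENNReal.ofReal (Real.sqrt 2 * Real.exp (-(c / 2 * t))) *
        (2 + ENNReal.ofReal (A * t) * D) := by
    intro t ht
    have hAt := mul_pos hA ht
    have e1 : ∀ v : Plane, ENNReal.ofReal (Real.exp (-(c * t)) * kern A t v) *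
        ENNReal.ofReal (wt a b v) = ENNReal.ofReal (Real.exp (-(c * t))) *
          (ENNReal.ofReal ((1 + |v 0|) ^ a * poisson (A * t) (v 0)) *
          ENNReal.ofReal (Real.exp (b * |v 1|) * heat t (v 1))) := by
      intro v
      have hk := kern_nonneg hA.le ht.le v
      have hp := poisson_nonneg hAt.le (v 0)
      rw [← ENNReal.ofReal_mul (by positivity), ← ENNReal.ofReal_mul (by positivity),
        ← ENNReal.ofReal_mul (by positivity)]
      congr 1
      unfold kern wt; ring
    simp only [e1]
    have hpm : Measurable (poisson (A * t)) := by unfold poisson; fun_prop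
    have hhm : Measurable (heat t) := by unfold heat; fun_prop
    rw [lintegral_const_mul' _ _ ENNReal.ofReal_ne_top, lintegral_plane_mul
      (f := fun x ↦ ENNReal.ofReal ((1 + |x|) ^ a * poisson (A * t) x))
      (g := fun y ↦ ENNReal.ofReal (Real.exp (b * |y|) * heat t y)) (by fun_prop) (by fun_prop)]
    calc _ ≤ ENNReal.ofReal (Real.exp (-(c * t))) * ((2 + ENNReal.ofReal (A * t) * D) *
          ENNReal.ofReal (Real.exp (2 * b ^ 2 * t) * Real.sqrt 2)) := by
          gcongr
          · exact hP t ht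
          · exact hH t ht
      _ = ENNReal.ofReal (Real.exp (-(c * t)) * (Real.exp (2 * b ^ 2 * t) * Real.sqrt 2)) *
          (2 + ENNReal.ofReal (A * t) * D) := by
          rw [ENNReal.ofReal_mul (Real.exp_pos _).le (q := Real.exp (2 * b ^ 2 * t) * Real.sqrt 2)]
          ring
      _ ≤ _ := by
          gcongr ENNReal.ofReal ?_ * _
          rw [← mul_assoc, ← Real.exp_add, mul_comm]
          gcongr
          nlinarith
  refine lt_of_le_of_lt (setLIntegral_mono' measurableSet_Ioi key) ?_
  have e2 : ∀ t ∈ Set.Ioi (0 : ℝ), ENNReal.ofReal (Real.sqrt 2 * Real.exp (-(c / 2 * t))) *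
      (2 + ENNReal.ofReal (A * t) * D) =
      2 * ENNReal.ofReal (Real.sqrt 2) * ENNReal.ofReal (Real.exp (-(c / 2 * t))) +
      ENNReal.ofReal (Real.sqrt 2 * A) * D *
        ENNReal.ofReal (t ^ (1 : ℝ) * Real.exp (-(c / 2 * t))) := by
    intro t (ht : 0 < t)
    rw [Real.rpow_one, ENNReal.ofReal_mul ht.le, ENNReal.ofReal_mul hA.le,
      ENNReal.ofReal_mul (Real.sqrt_nonneg _), ENNReal.ofReal_mul (Real.sqrt_nonneg _)]
    ring
  rw [setLIntegral_congr_fun measurableSet_Ioi e2, lintegral_add_left (by fun_prop),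
    lintegral_const_mul _ (by fun_prop), lintegral_const_mul _ (by fun_prop)]
  refine ENNReal.add_lt_top.2 ⟨ENNReal.mul_lt_top (ENNReal.mul_lt_top (by simp) (by simp))
    (lintegral_exp_lt_top (by linarith)), ENNReal.mul_lt_top
    (ENNReal.mul_lt_top ENNReal.ofReal_lt_top hDt) (lintegral_rpow_mul_exp_lt_top (by norm_num) (by linarith))⟩

/-- Both `|x|` and `s` are at most their maximum, whose square is at most `s² + x²`. The endpoint `β
= 2` is the exact rate of the Poisson tail. -/
theorem abs_rpow_mul_poisson_le {β s : ℝ} (hβ0 : 0 ≤ β) (hβ2 : β ≤ 2) (hs : 0 < s) (x : ℝ) :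
    |x| ^ β * poisson s x ≤ s ^ (β - 1) := by
  unfold poisson
  have hm : 0 < max |x| s := lt_max_of_lt_right hs
  have h1 : |x| ^ β * s ^ (2 - β) ≤ s ^ 2 + x ^ 2 := by
    calc _ ≤ max |x| s ^ β * max |x| s ^ (2 - β) := by
          have h2 : 0 ≤ 2 - β := by linarith
          exact mul_le_mul (Real.rpow_le_rpow (abs_nonneg x) (le_max_left _ _) hβ0)
            (Real.rpow_le_rpow hs.le (le_max_right _ _) h2) (by positivity) (by positivity)
      _ = max |x| s ^ 2 := by rw [← Real.rpow_add hm, ← Real.rpow_two]; congr 1; ring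
      _ ≤ _ := by
          rcases max_choice |x| s with h | h <;> rw [h]
          · rw [sq_abs]; nlinarith [sq_nonneg s]
          · nlinarith [sq_nonneg x]
  have h2 : s ^ (β - 1) * s ^ (2 - β) = s := by
    rw [← Real.rpow_add hs]; ring_nf; exact Real.rpow_one s
  have h3 : s / (s ^ 2 + x ^ 2) / Real.pi ≤ s / (s ^ 2 + x ^ 2) :=
    div_le_self (by positivity) (by linarith [Real.pi_gt_three])
  calc _ ≤ |x| ^ β * (s / (s ^ 2 + x ^ 2)) := by gcongr
    _ = s ^ (β - 1) * ((|x| ^ β * s ^ (2 - β)) / (s ^ 2 + x ^ 2)) := by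
        nth_rw 1 [← h2]; field_simp
    _ ≤ s ^ (β - 1) * 1 := by
        gcongr
        rw [div_le_one (by positivity)]; exact h1
    _ = _ := mul_one _

/-- The weight `|x|^β exp (b |y|)` makes the fundamental solution bounded. -/
theorem exists_lintegral_abs_rpow_mul_exp_resolvent_le {A c β b : ℝ} (hA : 0 < A) (hc : 0 < c)
    (hβ0 : 1 / 2 < β) (hβ2 : β ≤ 2) (hb : 4 * b ^ 2 ≤ c) :
    ∃ C : ℝ≥0∞, C < ⊤ ∧ ∀ f : Plane → ℝ≥0∞, Measurable f → ∀ w,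
      ∫⁻ v, ENNReal.ofReal (|v 0| ^ β * Real.exp (b * |v 1|)) * f (w + v) ∂resolvent A c ≤
        C * ∫⁻ v, f v := by
  -- The exponent is `β - 1` from the Poisson factor plus `-1/2` from the heat factor; `β > 1/2`
  -- makes it integrable at `t = 0`.
  have hI := lintegral_rpow_mul_exp_lt_top (s := β - 3 / 2) (c := c / 2) (by linarith)
    (by linarith)
  refine ⟨ENNReal.ofReal (A ^ (β - 1)) * _, ENNReal.mul_lt_top ENNReal.ofReal_lt_top hI,
    fun f hf w ↦ ?_⟩
  rw [lintegral_resolvent A c (by fun_prop)]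
  have key : ∀ t : ℝ, 0 < t → ∀ v : Plane, ENNReal.ofReal (Real.exp (-(c * t)) * kern A t v) *
      (ENNReal.ofReal (|v 0| ^ β * Real.exp (b * |v 1|)) * f (w + v)) ≤
      ENNReal.ofReal (A ^ (β - 1)) *
        ENNReal.ofReal (t ^ (β - 3 / 2) * Real.exp (-(c / 2 * t))) * f (w + v) := by
    intro t ht v
    have hAt := mul_pos hA ht
    have hk := kern_nonneg hA.le ht.le v
    rw [← mul_assoc, ← ENNReal.ofReal_mul (by positivity), ← ENNReal.ofReal_mul (by positivity)]
    gcongr ENNReal.ofReal ?_ * _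
    have h1 := abs_rpow_mul_poisson_le (by linarith) hβ2 hAt (v 0)
    have h2 : Real.exp (b * |v 1|) * heat t (v 1) ≤
        Real.exp (2 * b ^ 2 * t) * t ^ (-(1 / 2) : ℝ) := by
      refine (exp_mul_heat_le ht b (v 1)).trans ?_
      gcongr
      calc _ ≤ Real.sqrt 2 * (2 * t) ^ (-(1 / 2) : ℝ) := by
            gcongr; exact heat_le (by linarith) _
        _ = _ := by
            rw [Real.mul_rpow zero_le_two ht.le, Real.sqrt_eq_rpow, ← mul_assoc,
              ← Real.rpow_add two_pos]
            norm_num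
    have hh := heat_nonneg t (v 1)
    have e1 : Real.exp (-(c * t)) * Real.exp (2 * b ^ 2 * t) ≤ Real.exp (-(c / 2 * t)) := by
      rw [← Real.exp_add]; gcongr; nlinarith
    calc _ = Real.exp (-(c * t)) * ((|v 0| ^ β * poisson (A * t) (v 0)) *
          (Real.exp (b * |v 1|) * heat t (v 1))) := by unfold kern; ring
      _ ≤ Real.exp (-(c * t)) * ((A * t) ^ (β - 1) *
          (Real.exp (2 * b ^ 2 * t) * t ^ (-(1 / 2) : ℝ))) := by gcongr
      _ = A ^ (β - 1) * (t ^ (β - 1) * t ^ (-(1 / 2) : ℝ)) *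
          (Real.exp (-(c * t)) * Real.exp (2 * b ^ 2 * t)) := by
          rw [Real.mul_rpow hA.le ht.le]; ring
      _ ≤ A ^ (β - 1) * (t ^ (β - 1) * t ^ (-(1 / 2) : ℝ)) * Real.exp (-(c / 2 * t)) := by gcongr
      _ = _ := by rw [← Real.rpow_add ht]; ring_nf
  calc _ ≤ ∫⁻ t in Set.Ioi (0 : ℝ), ∫⁻ v, ENNReal.ofReal (A ^ (β - 1)) *
        ENNReal.ofReal (t ^ (β - 3 / 2) * Real.exp (-(c / 2 * t))) * f (w + v) :=
        setLIntegral_mono' measurableSet_Ioi fun t ht ↦ lintegral_mono (key t ht)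
    _ = _ := by
        have : ∀ t : ℝ, ∫⁻ v, ENNReal.ofReal (A ^ (β - 1)) *
            ENNReal.ofReal (t ^ (β - 3 / 2) * Real.exp (-(c / 2 * t))) * f (w + v) =
            ENNReal.ofReal (A ^ (β - 1)) *
            ENNReal.ofReal (t ^ (β - 3 / 2) * Real.exp (-(c / 2 * t))) * ∫⁻ v, f v := by
          intro t
          rw [lintegral_const_mul _ (by fun_prop), lintegral_add_left_eq_self]
        simp only [this]
        rw [lintegral_mul_const _ (by fun_prop), lintegral_const_mul _ (by fun_prop)]

/-! ### Weak solutions as convolutions with the fundamental solution. -/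

theorem ennreal_mul_le_sq_add_sq (x y : ℝ≥0∞) : x * y ≤ x ^ 2 + y ^ 2 := by
  rcases le_total x y with h | h
  · calc x * y ≤ y * y := by gcongr
      _ = y ^ 2 := (sq y).symm
      _ ≤ _ := le_add_self
  · calc x * y ≤ x * x := by gcongr
      _ = x ^ 2 := (sq x).symm
      _ ≤ _ := le_self_add

theorem lintegral_enorm_sq_lt_top {f : Plane → ℝ} (hf : MemLp f 2 volume) :
    ∫⁻ v, ‖f v‖ₑ ^ 2 < ⊤ := by
  have := (eLpNorm_lt_top_iff_lintegral_rpow_enorm_lt_top two_ne_zero ENNReal.ofNat_ne_top).1 hf.2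
  simpa using this

theorem integrable_mul_comp_sub_prod {ρ : Measure Plane} [IsFiniteMeasure ρ] {φ F : Plane → ℝ}
    (hφm : Measurable φ) (hφ : MemLp φ 2 volume) (hFm : Measurable F) (hF : MemLp F 2 volume) :
    Integrable (Function.uncurry fun v u : Plane ↦ φ u * F (u - v)) (ρ.prod volume) := by
  have hm : Measurable (Function.uncurry fun v u : Plane ↦ φ u * F (u - v)) :=
    (hφm.comp measurable_snd).mul
      (hFm.comp (by fun_prop : Measurable fun p : Plane × Plane ↦ p.2 - p.1))
  refine ⟨hm.aestronglyMeasurable, ?_⟩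
  rw [HasFiniteIntegral, lintegral_prod _ hm.enorm.aemeasurable]
  calc _ ≤ ∫⁻ _ : Plane, ((∫⁻ u, ‖φ u‖ₑ ^ 2) + ∫⁻ u, ‖F u‖ₑ ^ 2) ∂ρ := by
        refine lintegral_mono fun v ↦ ?_
        rw [← lintegral_sub_right_eq_self (fun u ↦ ‖F u‖ₑ ^ 2) v, ← lintegral_add_left (by fun_prop)]
        refine lintegral_mono fun u ↦ ?_
        simp only [Function.uncurry]
        rw [enorm_mul]
        exact ennreal_mul_le_sq_add_sq _ _
    _ < ⊤ := by
        rw [lintegral_const]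
        exact ENNReal.mul_lt_top (ENNReal.add_lt_top.2
          ⟨lintegral_enorm_sq_lt_top hφ, lintegral_enorm_sq_lt_top hF⟩) (measure_lt_top ρ _)

/-- The summand `1` is paired with the integrability of `h`, and `G` with its boundedness.
Domination by `|G| + 1` admits a nonlinearity that need not itself be integrable. -/
theorem integrable_comp_add_mul_prod {ρ : Measure Plane} [IsFiniteMeasure ρ] {g G h : Plane → ℝ}
    (hgm : Measurable g) (hG : Integrable G) (hgG : ∀ v, |g v| ≤ |G v| + 1)
    (hhm : Measurable h) (hh : Integrable h) {M : ℝ} (hM : ∀ v, |h v| ≤ M) :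
    Integrable (Function.uncurry fun v w : Plane ↦ h w * g (w + v)) (ρ.prod volume) := by
  have hm : Measurable (Function.uncurry fun v w : Plane ↦ h w * g (w + v)) :=
    (hhm.comp measurable_snd).mul
      (hgm.comp (by fun_prop : Measurable fun p : Plane × Plane ↦ p.2 + p.1))
  refine ⟨hm.aestronglyMeasurable, ?_⟩
  rw [HasFiniteIntegral, lintegral_prod _ hm.enorm.aemeasurable]
  have hM0 : 0 ≤ M := (abs_nonneg _).trans (hM 0)
  calc _ ≤ ∫⁻ _ : Plane, ((∫⁻ u, ‖h u‖ₑ) + ENNReal.ofReal M * ∫⁻ u, ‖G u‖ₑ) ∂ρ := by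
        refine lintegral_mono fun v ↦ ?_
        rw [← lintegral_add_right_eq_self (fun u ↦ ‖G u‖ₑ) v,
          ← lintegral_const_mul' _ _ ENNReal.ofReal_ne_top, ← lintegral_add_left (by fun_prop)]
        refine lintegral_mono fun w ↦ ?_
        simp only [Function.uncurry]
        rw [← ofReal_norm, ← ofReal_norm, ← ofReal_norm, ← ENNReal.ofReal_mul hM0,
          ← ENNReal.ofReal_add (by positivity) (by positivity)]
        refine ENNReal.ofReal_le_ofReal ?_
        simp only [Real.norm_eq_abs, abs_mul]
        have h1 := hgG (w + v)
        have h2 := hM w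
        calc _ ≤ |h w| * (|G (w + v)| + 1) := by gcongr
          _ = |h w| + |h w| * |G (w + v)| := by ring
          _ ≤ _ := by gcongr
    _ < ⊤ := by
        rw [lintegral_const]
        exact ENNReal.mul_lt_top (ENNReal.add_lt_top.2
          ⟨hh.2, ENNReal.mul_lt_top ENNReal.ofReal_lt_top hG.2⟩) (measure_lt_top ρ _)

theorem IsTest.ellip_memLp {f : Plane → ℝ} (hf : IsTest f) (c a : ℝ) :
    MemLp (ellip c a f) 2 volume :=
  (((hf.memLp 2).const_mul c).add (hf.hilbertX_dx_memLp.2.const_mul a)).sub (hf.dy.dy.memLp 2)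

/-- Solutions of the linear equation are given by convolution with the fundamental solution. -/
theorem ae_eq_integral_resolvent {c a : ℝ} (hc : 0 < c) (ha : 0 < a) {φ g G : Plane → ℝ}
    (hφm : Measurable φ) (hφ : MemLp φ 2 volume) (hgm : Measurable g) (hG : Integrable G)
    (hgG : ∀ v, |g v| ≤ |G v| + 1)
    (heq : ∀ ψ, IsTest ψ → ∫ v, φ v * ellip c a ψ v = ∫ v, g v * ψ v) :
    ∀ᵐ w, φ w = ∫ v, g (w + v) ∂resolvent (a * cosConst / (2 * Real.pi ^ 2)) c := by
  have hA : 0 < a * cosConst / (2 * Real.pi ^ 2) := by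
    have := cosConst_pos; have := Real.pi_pos; positivity
  set ρ := resolvent (a * cosConst / (2 * Real.pi ^ 2)) c with hρ
  have : IsFiniteMeasure ρ := isFiniteMeasure_resolvent hA hc
  refine ae_eq_of_integral_contDiff_smul_eq (hφ.locallyIntegrable (by norm_num)) ?_ ?_
  · rw [locallyIntegrable_iff]
    intro K hK
    have hi := (integrable_comp_add_mul_prod (ρ := ρ) (h := K.indicator 1) (M := 1) hgm hG hgG
      (measurable_one.indicator hK.measurableSet)
      ((integrable_indicator_iff hK.measurableSet).2 (integrableOn_const (by simpa using hK.measure_ne_top)))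
      (fun v ↦ by by_cases hv : v ∈ K <;> simp [hv])).integral_prod_right
    rw [← integrable_indicator_iff hK.measurableSet]
    refine hi.congr (Eventually.of_forall fun w ↦ ?_)
    simp only [Function.uncurry]
    rw [integral_const_mul]
    by_cases hw : w ∈ K <;> simp [hw]
  · intro ψ hψ1 hψ2
    have hψ : IsTest ψ := ⟨hψ1, hψ2⟩
    -- The equation is tested on the translates of `ψ` by `v` and averaged against `ρ`. By Fubini,
    -- the resolvent turns `ellip c a ψ` back into `ψ` on one side, and the convolution of `g`
    -- appears on the other.
    have e1 := integral_integral_swap (integrable_mul_comp_sub_prod (ρ := ρ) hφm hφ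
      (hψ.continuous_ellip c a).measurable (hψ.ellip_memLp c a))
    obtain ⟨M, hM⟩ := hψ.continuous.bounded_above_of_compact_support hψ2
    have e2 := integral_integral_swap (integrable_comp_add_mul_prod (ρ := ρ) hgm hG hgG
      hψ.continuous.measurable (memLp_one_iff_integrable.1 (hψ.memLp 1)) hM)
    have e3 : ∀ v, ∫ u, φ u * ellip c a ψ (u - v) = ∫ w, ψ w * g (w + v) := by
      intro v
      have := heq _ (hψ.comp_sub v)
      simp only [hψ.ellip_comp_sub] at this
      rw [this, ← integral_add_right_eq_self _ v]
      congr 1 with w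
      rw [add_sub_cancel_right, mul_comm]
    simp only [e3] at e1
    rw [e2] at e1
    simp only [integral_const_mul, smul_eq_mul] at e1 ⊢
    rw [e1]
    congr 1 with u
    rw [hρ, hψ.integral_ellip_resolvent hc ha, mul_comm]

/-! ### The nonlinearity and the integral inequality. -/

/-- Besides measurability, this modulus is all that the argument uses of the nonlinearity. -/
theorem abs_nonlin {m : ℕ} (hm : 0 < m) (k : ℕ) (t : ℝ) :
    |nonlin k m t| = |t| ^ ((k : ℝ) / m + 1) := by
  have hm' : (0 : ℝ) < m := by exact_mod_cast hm
  unfold nonlin oddRoot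
  rw [abs_pow, abs_mul, abs_of_nonneg (by positivity : 0 ≤ |t| ^ (1 / (m : ℝ)))]
  have h1 : |Real.sign t| * |t| ^ (1 / (m : ℝ)) = |t| ^ (1 / (m : ℝ)) := by
    rcases eq_or_ne t 0 with rfl | ht
    · simp [Real.zero_rpow (inv_ne_zero hm'.ne')]
    · rcases Real.sign_apply_eq_of_ne_zero t ht with h | h <;> simp [h]
  rw [h1, ← Real.rpow_natCast, ← Real.rpow_mul (abs_nonneg t)]
  congr 1
  push_cast; field_simp

theorem measurable_nonlin (k m : ℕ) : Measurable (nonlin k m) := by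
  have hs : Measurable Real.sign := by
    have : Real.sign = fun r : ℝ ↦ if r < 0 then (-1 : ℝ) else if 0 < r then 1 else 0 := rfl
    rw [this]
    exact Measurable.ite measurableSet_Iio measurable_const
      (Measurable.ite measurableSet_Ioi measurable_const measurable_const)
  unfold nonlin oddRoot
  fun_prop

/-- The integral inequality satisfied by a measurable representative of a solitary wave. -/
theorem IsSolitaryWave.exists_measurable_rep {k m : ℕ} {c α ε : ℝ} {φ : Plane → ℝ}
    (h : IsSolitaryWave k m c α ε φ) (hm : 0 < m)
    (hp : (k : ℝ) / (m : ℝ) < 4) (hε : ε = 1 ∨ ε = -1) (hαε : α * ε < 0) (hcα : c * α < 0) :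
    ∃ u : Plane → ℝ, Measurable u ∧ φ =ᵐ[volume] u ∧
      (∀ r : ℝ, 2 ≤ r → r < 6 → ∫⁻ v, ‖u v‖ₑ ^ r < ⊤) ∧
      ∃ A c₀ : ℝ, 0 < A ∧ 0 < c₀ ∧
        ∀ᵐ w, ‖u w‖ₑ ≤ ∫⁻ v, ‖u (w + v)‖ₑ ^ ((k : ℝ) / m + 1) ∂resolvent A c₀ := by
  set u := h.memZ.1.1.mk φ with hu
  have hum : Measurable u := h.memZ.1.1.stronglyMeasurable_mk.measurable
  have hφu : φ =ᵐ[volume] u := h.memZ.1.1.ae_eq_mk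
  have hLr : ∀ r : ℝ, 2 ≤ r → r < 6 → ∫⁻ v, ‖u v‖ₑ ^ r < ⊤ := fun r h2 h6 ↦ by
    refine lt_of_le_of_lt (le_of_eq (lintegral_congr_ae ?_)) (h.memZ.lintegral_rpow_lt_top h2 h6)
    filter_upwards [hφu] with v hv
    rw [hv]
  refine ⟨u, hum, hφu, hLr, |α| * cosConst / (2 * Real.pi ^ 2), |c|, ?_, ?_, ?_⟩
  · have := cosConst_pos
    have := Real.pi_pos
    have : α ≠ 0 := by rintro rfl; simp at hαε
    positivity
  · have : c ≠ 0 := by rintro rfl; simp at hcα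
    positivity
  have hα0 : 0 < |α| := abs_pos.2 (by rintro rfl; simp at hαε)
  have hc0 : 0 < |c| := abs_pos.2 (by rintro rfl; simp at hcα)
  set p : ℝ := (k : ℝ) / m with hpdef
  have hp0 : 0 ≤ p := by positivity
  -- The coefficient after the equation is multiplied by `-ε`, which turns the linear part into
  -- `ellip |c| |α|`.
  set β : ℝ := ε * (1 / (p + 1)) with hβ
  have hε1 : |ε| = 1 := by rcases hε with rfl | rfl <;> simp
  have hβ1 : |β| ≤ 1 := by
    rw [hβ, abs_mul, hε1, one_mul, abs_of_pos (by positivity), div_le_one (by linarith)]; linarith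
  have hu2 : MemLp u 2 volume := (memLp_congr_ae hφu).1 h.memZ.1
  -- Since `p + 1 < 5 < 6`, the power `|u|^{p+1}` is at most `|u|^5 + 1`, and `|u|^5` is integrable
  -- by the Sobolev embedding.
  have hG : Integrable fun v ↦ |u v| ^ (5 : ℝ) := by
    refine ⟨(by fun_prop : Measurable fun v ↦ |u v| ^ (5 : ℝ)).aestronglyMeasurable, ?_⟩
    rw [HasFiniteIntegral]
    refine lt_of_le_of_lt (le_of_eq ?_) (hLr 5 (by norm_num) (by norm_num))
    congr 1 with v
    rw [← ofReal_norm, ← ofReal_norm, ENNReal.ofReal_rpow_of_nonneg (norm_nonneg _) (by norm_num),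
      Real.norm_of_nonneg (by positivity), Real.norm_eq_abs]
  have hN : ∀ t : ℝ, |β * nonlin k m t| ≤ |t| ^ (p + 1) := fun t ↦ by
    rw [abs_mul, abs_nonlin hm]
    exact mul_le_of_le_one_left (by positivity) hβ1
  have hrep := ae_eq_integral_resolvent hc0 hα0 hum hu2
    (g := fun v ↦ β * nonlin k m (u v)) (((measurable_nonlin k m).comp hum).const_mul β) hG
    (fun v ↦ by
      rw [abs_of_nonneg (by positivity : 0 ≤ |u v| ^ (5 : ℝ))]
      refine (hN _).trans ?_
      rcases le_total |u v| 1 with h1 | h1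
      · have := Real.rpow_le_one (abs_nonneg _) h1 (by linarith : 0 ≤ p + 1)
        have : 0 ≤ |u v| ^ (5 : ℝ) := by positivity
        linarith
      · have := Real.rpow_le_rpow_of_exponent_le h1 (by linarith : p + 1 ≤ 5)
        linarith) ?_
  · filter_upwards [hrep] with w hw
    rw [hw]
    refine (enorm_integral_le_lintegral_enorm _).trans (lintegral_mono fun v ↦ ?_)
    rw [← ofReal_norm, ← ofReal_norm, ENNReal.ofReal_rpow_of_nonneg (norm_nonneg _) (by linarith)]
    exact ENNReal.ofReal_le_ofReal (hN _)
  · intro ψ hψ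
    have e := h.equation ψ hψ
    have c1 : ∫ v, φ v * ψ v = ∫ v, u v * ψ v :=
      integral_congr_ae (hφu.mono fun v hv ↦ by simp only [hv])
    have c2 : ∫ v, nonlin k m (φ v) * ψ v = ∫ v, nonlin k m (u v) * ψ v :=
      integral_congr_ae (hφu.mono fun v hv ↦ by simp only [hv])
    have c3 : ∫ v, φ v * hilbertX (dx ψ) v = ∫ v, u v * hilbertX (dx ψ) v :=
      integral_congr_ae (hφu.mono fun v hv ↦ by simp only [hv])
    have c4 : ∫ v, φ v * dy (dy ψ) v = ∫ v, u v * dy (dy ψ) v :=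
      integral_congr_ae (hφu.mono fun v hv ↦ by simp only [hv])
    rw [c1, c2, c3, c4] at e
    have j1 : Integrable fun v ↦ u v * ψ v := hu2.integrable_mul (hψ.memLp 2)
    have j2 : Integrable fun v ↦ u v * hilbertX (dx ψ) v :=
      hu2.integrable_mul hψ.hilbertX_dx_memLp.2
    have j3 : Integrable fun v ↦ u v * dy (dy ψ) v := hu2.integrable_mul (hψ.dy.dy.memLp 2)
    have e1 : ∫ v, u v * ellip |c| |α| ψ v = |c| * (∫ v, u v * ψ v) +
        |α| * (∫ v, u v * hilbertX (dx ψ) v) - ∫ v, u v * dy (dy ψ) v := by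
      rw [← integral_const_mul, ← integral_const_mul, ← integral_add (j1.const_mul _)
        (j2.const_mul _), ← integral_sub (f := fun v ↦ |c| * (u v * ψ v) +
          |α| * (u v * hilbertX (dx ψ) v)) ((j1.const_mul _).add (j2.const_mul _)) j3]
      congr 1 with v
      unfold ellip; ring
    have e2 : ∫ v, β * nonlin k m (u v) * ψ v = β * ∫ v, nonlin k m (u v) * ψ v := by
      rw [← integral_const_mul]; congr 1 with v; ring
    rw [e1, e2, hβ]
    rcases hε with rfl | rfl
    · have h1 : α < 0 := by linarith
      have h2 : 0 < c := by nlinarith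
      rw [abs_of_neg h1, abs_of_pos h2]
      linarith
    · have h1 : 0 < α := by linarith
      have h2 : c < 0 := by nlinarith
      rw [abs_of_pos h1, abs_of_neg h2]
      linarith

/-! ### Boundedness of subsolutions. -/

theorem ae_comp_add_resolvent (A c : ℝ) {P : Plane → Prop} (h : ∀ᵐ x, P x) (w : Plane) :
    ∀ᵐ v ∂resolvent A c, P (w + v) :=
  (resolvent_absolutelyContinuous A c).ae_le
    ((measurePreserving_add_left volume w).quasiMeasurePreserving.ae h)

theorem ennreal_eq_zero_of_le_half {x : ℝ≥0∞} (hx : x ≠ ⊤) (h : x ≤ 2⁻¹ * x) : x = 0 := by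
  by_contra h0
  have := ENNReal.half_lt_self h0 hx
  rw [ENNReal.div_eq_inv_mul] at this
  exact absurd h (not_le.2 this)

theorem ennreal_le_of_le_half_add {x y : ℝ≥0∞} (hx : x ≠ ⊤) (h : x ≤ 2⁻¹ * x + y) :
    x ≤ 2 * y := by
  have h2 : 2⁻¹ * x ≠ ⊤ := ENNReal.mul_ne_top (by simp) hx
  have h1 : 2⁻¹ * x + 2⁻¹ * x ≤ 2⁻¹ * x + y := by
    rwa [← add_mul, ENNReal.inv_two_add_inv_two, one_mul]
  have h3 := ENNReal.le_of_add_le_add_left h2 h1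
  calc x = 2 * (2⁻¹ * x) := by
        rw [← mul_assoc, ENNReal.mul_inv_cancel two_ne_zero ENNReal.ofNat_ne_top, one_mul]
    _ ≤ _ := by gcongr

/-- The part of `U ^ p` on the set where `U` exceeds `n` is small in `L^s`. -/
theorem tendsto_lintegral_indicator_rpow {U : Plane → ℝ≥0∞} (hU : Measurable U)
    (hfin : ∀ v, U v ≠ ⊤) {r : ℝ} (hr : ∫⁻ v, U v ^ r < ⊤) :
    Tendsto (fun n : ℕ ↦ ∫⁻ v, {v | (n : ℝ≥0∞) < U v}.indicator (fun v ↦ U v ^ r) v) atTop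
      (𝓝 0) := by
  have h := tendsto_lintegral_of_dominated_convergence
    (F := fun (n : ℕ) v ↦ {v | (n : ℝ≥0∞) < U v}.indicator (fun v ↦ U v ^ r) v)
    (f := fun _ ↦ 0) (μ := (volume : Measure Plane)) (fun v ↦ U v ^ r)
    (fun n ↦ (hU.pow_const r).indicator (measurableSet_lt measurable_const hU))
    (fun n ↦ Eventually.of_forall fun v ↦ Set.indicator_le_self _ _ _) hr.ne
    (Eventually.of_forall fun v ↦ ?_)
  · simpa using h
  · obtain ⟨N, hN⟩ := ENNReal.exists_nat_gt (hfin v)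
    refine tendsto_const_nhds.congr' ?_
    filter_upwards [eventually_ge_atTop N] with n hn
    rw [Set.indicator_of_notMem]
    simp only [Set.mem_ofPred_eq, not_lt]
    exact hN.le.trans (by exact_mod_cast hn)

section Decay

variable {A c p : ℝ} {U : Plane → ℝ≥0∞}

/-- Subsolutions of the integral equation are bounded. -/
theorem exists_ae_le_of_le_lintegral_resolvent (hA : 0 < A) (hc : 0 < c) (hp0 : 0 < p)
    (hp4 : p < 4) (hU : Measurable U) (hfin : ∀ v, U v ≠ ⊤)
    (hLr : ∀ r : ℝ, 2 ≤ r → r < 6 → ∫⁻ v, U v ^ r < ⊤)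
    (hle : ∀ᵐ w, U w ≤ ∫⁻ v, U (w + v) ^ (p + 1) ∂resolvent A c) :
    ∃ B : ℝ≥0∞, B < ⊤ ∧ ∀ᵐ w, U w ≤ B := by
  have hfρ := isFiniteMeasure_resolvent hA hc
  set ρ := resolvent A c with hρ
  -- The bound `r > 3p/2` puts `U^p` in `L^s` with `s > 3/2`; the bound `r > 5 > p + 1` is for the
  -- finiteness of `∫ V n * z` below.
  obtain ⟨r, hr1, hr6⟩ := exists_between (show max 5 (3 / 2 * p) < 6 from
    max_lt (by norm_num) (by linarith))
  have hr5 : 5 < r := (le_max_left _ _).trans_lt hr1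
  have hrp : 3 / 2 * p < r := (le_max_right _ _).trans_lt hr1
  set s := r / p with hs
  have hs32 : 3 / 2 < s := by rw [hs, lt_div_iff₀ hp0]; exact hrp
  have hs0 : 0 < s := by linarith
  have hps : p * s = r := by rw [hs]; field_simp
  obtain ⟨C, hC, hCV⟩ := exists_lintegral_resolvent_le hA hc hs32
  set V : ℕ → Plane → ℝ≥0∞ := fun n ↦ {v | (n : ℝ≥0∞) < U v}.indicator fun v ↦ U v ^ p with hV
  have hVm : ∀ n, Measurable (V n) := fun n ↦
    (hU.pow_const p).indicator (measurableSet_lt measurable_const hU)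
  have hVs : ∀ n v, V n v ^ s = {v | (n : ℝ≥0∞) < U v}.indicator (fun v ↦ U v ^ r) v := by
    intro n v
    simp only [hV, Set.indicator_apply]
    split_ifs
    · rw [← ENNReal.rpow_mul, hps]
    · exact ENNReal.zero_rpow_of_pos hs0
  have hlim : Tendsto (fun n ↦ C * (∫⁻ v, V n v ^ s) ^ (1 / s)) atTop (𝓝 0) := by
    simp only [hVs]
    have h1 := (tendsto_lintegral_indicator_rpow hU hfin (hLr r (by linarith) hr6))
    have h2 := (ENNReal.continuous_rpow_const (y := 1 / s)).tendsto 0 |>.comp h1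
    rw [ENNReal.zero_rpow_of_pos (by positivity)] at h2
    have h3 := ENNReal.Tendsto.const_mul h2 (Or.inr hC.ne)
    rwa [mul_zero] at h3
  obtain ⟨n, hn1, hn2⟩ := ((hlim.eventually (Iic_mem_nhds (by simp : (0 : ℝ≥0∞) < 2⁻¹))).and
    (eventually_ge_atTop 1)).exists
  have hsub : ∀ w, ∫⁻ v, V n (w - v) ∂ρ ≤ 2⁻¹ := fun w ↦ (hCV _ (hVm n) w).trans hn1
  have hadd : ∀ w, ∫⁻ v, V n (w + v) ∂ρ ≤ 2⁻¹ := fun w ↦ by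
    rw [hρ, lintegral_comp_add_resolvent A c (hVm n)]; exact hsub w
  set F : ℝ≥0∞ := (n : ℝ≥0∞) ^ (p + 1) * ρ Set.univ with hF
  have hFt : F < ⊤ := ENNReal.mul_lt_top
    (ENNReal.rpow_lt_top_of_nonneg (by linarith) (by simp)) (measure_lt_top ρ _)
  have hpt : ∀ v, U v ^ (p + 1) ≤ V n v * U v + (n : ℝ≥0∞) ^ (p + 1) := by
    intro v
    rcases lt_or_ge (n : ℝ≥0∞) (U v) with h | h
    · refine le_trans (le_of_eq ?_) le_self_add
      simp only [hV]
      rw [Set.indicator_of_mem (by exact h), ENNReal.rpow_add_of_nonneg _ _ hp0.le zero_le_one,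
        ENNReal.rpow_one]
    · exact le_add_left (ENNReal.rpow_le_rpow h (by linarith))
  -- Truncated subtraction: `z` is the positive part of `U - 2F`. The potential contributes at most
  -- `½ · 2F` through the constant and the region `U ≤ n` at most `F`, so `2F` cancels and a
  -- homogeneous inequality for `z` remains.
  set z : Plane → ℝ≥0∞ := fun v ↦ U v - 2 * F with hz
  have hzm : Measurable z := hU.sub_const _
  have hzle : ∀ᵐ w, z w ≤ ∫⁻ v, V n (w + v) * z (w + v) ∂ρ := by
    filter_upwards [hle] with w hw
    change U w - 2 * F ≤ _
    rw [tsub_le_iff_right]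
    have m1 : Measurable fun v ↦ V n (w + v) := (hVm n).comp (by fun_prop)
    have m2 : Measurable fun v ↦ z (w + v) := hzm.comp (by fun_prop)
    have m3 : Measurable fun v ↦ V n (w + v) * z (w + v) := m1.mul m2
    calc U w ≤ ∫⁻ v, U (w + v) ^ (p + 1) ∂ρ := hw
      _ ≤ ∫⁻ v, (V n (w + v) * z (w + v) + V n (w + v) * (2 * F)) + (n : ℝ≥0∞) ^ (p + 1) ∂ρ := by
          refine lintegral_mono fun v ↦ (hpt (w + v)).trans ?_
          rw [← mul_add]
          gcongr
          exact le_tsub_add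
      _ = (∫⁻ v, V n (w + v) * z (w + v) ∂ρ) + (∫⁻ v, V n (w + v) ∂ρ) * (2 * F) + F := by
          rw [lintegral_add_right _ measurable_const, lintegral_add_left m3,
            lintegral_mul_const _ m1, lintegral_const]
      _ ≤ (∫⁻ v, V n (w + v) * z (w + v) ∂ρ) + 2⁻¹ * (2 * F) + F := by
          gcongr; exact hadd w
      _ = _ := by
          rw [← mul_assoc, ENNReal.inv_mul_cancel two_ne_zero ENNReal.ofNat_ne_top, one_mul,
            add_assoc, ← two_mul]
  have hVz : Measurable fun v ↦ V n v * z v := (hVm n).mul hzm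
  have hVzw : ∀ w, Measurable fun v ↦ V n (w + v) * z (w + v) := fun w ↦
    hVz.comp (measurable_const_add w)
  have hVw : ∀ w, Measurable fun v ↦ V n (w - v) := fun w ↦ (hVm n).comp (by fun_prop)
  -- Duality: after pairing with `V n`, translation moves the average over `ρ` from `V n * z` to the
  -- other factor `V n`, where it is at most `½`. Finiteness of the integral then forces it to
  -- vanish.
  have hle2 : ∫⁻ w, V n w * z w ≤ 2⁻¹ * ∫⁻ w, V n w * z w := by
    calc _ ≤ ∫⁻ w, V n w * ∫⁻ v, V n (w + v) * z (w + v) ∂ρ :=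
          lintegral_mono_ae (hzle.mono fun w hw ↦ by gcongr)
      _ = ∫⁻ w, (∫⁻ v, V n w * (V n (w + v) * z (w + v)) ∂ρ) := by
          congr 1 with w
          rw [lintegral_const_mul _ (hVzw w)]
      _ = ∫⁻ v, (∫⁻ w, V n w * (V n (w + v) * z (w + v))) ∂ρ := by
          rw [lintegral_lintegral_swap]
          exact (((hVm n).comp measurable_fst).mul
            (hVz.comp (by fun_prop : Measurable fun q : Plane × Plane ↦ q.1 + q.2))).aemeasurable
      _ = ∫⁻ v, (∫⁻ w, V n (w - v) * (V n w * z w)) ∂ρ := by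
          congr 1 with v
          rw [← lintegral_add_right_eq_self (fun w ↦ V n (w - v) * (V n w * z w)) v]
          simp only [add_sub_cancel_right]
      _ = ∫⁻ w, (∫⁻ v, V n (w - v) ∂ρ) * (V n w * z w) := by
          rw [lintegral_lintegral_swap]
          · congr 1 with w
            rw [lintegral_mul_const _ (hVw w)]
          · exact (((hVm n).comp (by fun_prop : Measurable fun q : Plane × Plane ↦ q.2 - q.1)).mul
              (hVz.comp measurable_snd)).aemeasurable
      _ ≤ ∫⁻ w, 2⁻¹ * (V n w * z w) := by
          gcongr with w; exact hsub w
      _ = _ := lintegral_const_mul _ hVz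
  have hfinz : ∫⁻ w, V n w * z w ≠ ⊤ := by
    refine (lt_of_le_of_lt (lintegral_mono fun v ↦ ?_) (hLr r (by linarith) hr6)).ne
    simp only [hV, Set.indicator_apply]
    split_ifs with h
    · have h1 : 1 ≤ U v := le_trans (by exact_mod_cast hn2) (le_of_lt h)
      calc _ ≤ U v ^ p * U v := by gcongr; exact tsub_le_self
        _ = U v ^ (p + 1) := by
            rw [ENNReal.rpow_add_of_nonneg _ _ hp0.le zero_le_one, ENNReal.rpow_one]
        _ ≤ _ := ENNReal.rpow_le_rpow_of_exponent_le h1 (by linarith)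
    · simp
  have hzero := ennreal_eq_zero_of_le_half hfinz hle2
  rw [lintegral_eq_zero_iff hVz] at hzero
  refine ⟨2 * F, ENNReal.mul_lt_top (by simp) hFt, ?_⟩
  filter_upwards [hzle] with w hw
  have h0 : ∫⁻ v, V n (w + v) * z (w + v) ∂ρ = 0 := by
    rw [lintegral_eq_zero_iff (hVzw w)]
    exact ae_comp_add_resolvent A c hzero w
  rw [h0] at hw
  exact tsub_eq_zero_iff_le.1 (nonpos_iff_eq_zero.1 hw)

/-! ### First decay estimate, by absorption. -/

/-- The weighted fundamental solution is a finite measure, absolutely continuous for Lebesgue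
measure, so sets of small area have small mass. Area is translation invariant, which gives
uniformity in `w`. -/
theorem exists_lintegral_wt_indicator_le (hA : 0 < A) (hc : 0 < c) {a b : ℝ} (ha1 : a < 1)
    (hb : 4 * b ^ 2 ≤ c) {E : Set Plane} (hE : MeasurableSet E) (hEfin : volume E < ⊤)
    {η : ℝ≥0∞} (hη : η ≠ 0) :
    ∃ R : ℝ, 0 ≤ R ∧ ∀ w, ∫⁻ v, ENNReal.ofReal (wt a b v) *
      (E ∩ {x | R < ‖x‖}).indicator 1 (w + v) ∂resolvent A c ≤ η := by
  have hW := (measurable_wt a b).ennreal_ofReal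
  have hK := lintegral_wt_resolvent_lt_top hA hc ha1 hb
  have hdm := measurable_resolventDensity A c
  rw [resolvent, lintegral_withDensity_eq_lintegral_mul _ hdm hW] at hK
  obtain ⟨δ, hδ, hδE⟩ := exists_pos_setLIntegral_lt_of_measure_lt hK.ne hη
  have ht : Tendsto (fun n : ℕ ↦ volume (E ∩ {x | (n : ℝ) < ‖x‖})) atTop (𝓝 0) := by
    have h := tendsto_measure_iInter_atTop (μ := (volume : Measure Plane))
      (s := fun n : ℕ ↦ E ∩ {x | (n : ℝ) < ‖x‖})
      (fun n ↦ (hE.inter (measurableSet_lt measurable_const measurable_norm)).nullMeasurableSet)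
      (fun m n hmn x hx ↦ ⟨hx.1, (Nat.cast_le.2 hmn).trans_lt (show (n : ℝ) < ‖x‖ from hx.2)⟩)
      ⟨0, (lt_of_le_of_lt (measure_mono Set.inter_subset_left) hEfin).ne⟩
    have he : ⋂ n : ℕ, E ∩ {x | (n : ℝ) < ‖x‖} = ∅ := by
      ext x
      simp only [Set.mem_iInter, Set.mem_inter_iff, Set.mem_ofPred_eq, Set.mem_empty_iff_false,
        iff_false, not_forall]
      obtain ⟨n, hn⟩ := exists_nat_gt ‖x‖
      exact ⟨n, fun h ↦ absurd h.2 (not_lt.2 hn.le)⟩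
    rwa [he, measure_empty] at h
  obtain ⟨n, hn⟩ := (ht.eventually (Iio_mem_nhds hδ)).exists
  refine ⟨n, by positivity, fun w ↦ ?_⟩
  set E' := E ∩ {x : Plane | (n : ℝ) < ‖x‖} with hE'
  have hE'm : MeasurableSet E' := hE.inter (measurableSet_lt measurable_const measurable_norm)
  have hpre : MeasurableSet ((fun v ↦ w + v) ⁻¹' E') := hE'm.preimage (by fun_prop)
  have hvol : volume ((fun v ↦ w + v) ⁻¹' E') < δ := by
    rw [(measurePreserving_add_left volume w).measure_preimage hE'm.nullMeasurableSet]
    exact hn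
  have hind : Measurable fun v ↦ E'.indicator (1 : Plane → ℝ≥0∞) (w + v) :=
    (measurable_one.indicator hE'm).comp (by fun_prop)
  have hWi : Measurable fun v ↦ ENNReal.ofReal (wt a b v) *
      E'.indicator (1 : Plane → ℝ≥0∞) (w + v) := hW.mul hind
  rw [resolvent, lintegral_withDensity_eq_lintegral_mul _ hdm hWi]
  refine le_trans (le_of_eq ?_) (hδE _ hvol).le
  rw [← lintegral_indicator hpre]
  congr 1 with v
  by_cases hv : w + v ∈ E'
  · rw [Set.indicator_of_mem (by exact hv)]
    simp [hv]
  · rw [Set.indicator_of_notMem (by exact hv)]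
    simp [hv]

/-- Bounded subsolutions of the integral equation decay like the weights that are integrable
against the fundamental solution. -/
theorem exists_ae_wt_mul_le (hA : 0 < A) (hc : 0 < c) (hp0 : 0 < p) (hU : Measurable U)
    (hL2 : ∫⁻ v, U v ^ (2 : ℝ) < ⊤) {B : ℝ≥0∞} (hB : B < ⊤) (hUB : ∀ᵐ w, U w ≤ B)
    (hle : ∀ᵐ w, U w ≤ ∫⁻ v, U (w + v) ^ (p + 1) ∂resolvent A c)
    {a b : ℝ} (ha0 : 0 ≤ a) (ha1 : a < 1) (hb0 : 0 ≤ b) (hb : 4 * b ^ 2 ≤ c) :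
    ∃ C : ℝ≥0∞, C < ⊤ ∧ ∀ᵐ w, ENNReal.ofReal (wt a b w) * U w ≤ C := by
  have hK := lintegral_wt_resolvent_lt_top hA hc ha1 hb
  set ρ := resolvent A c with hρ
  set W : Plane → ℝ≥0∞ := fun v ↦ ENNReal.ofReal (wt a b v) with hW
  have hWm : Measurable W := (measurable_wt a b).ennreal_ofReal
  set K := ∫⁻ v, W v ∂ρ with hKdef
  have hp1 : 0 < p + 1 := by linarith
  have hBp : B ^ p < ⊤ := ENNReal.rpow_lt_top_of_nonneg hp0.le hB.ne
  -- The level `ε` bounds the potential by `ε ^ p` where `U ≤ ε`, worth `1/4` after integration; the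
  -- exceptional set `U > ε` far from the origin is given another `1/4`.
  obtain ⟨ε, hε0, hεt, hεK⟩ : ∃ ε : ℝ≥0∞, ε ≠ 0 ∧ ε ≠ ⊤ ∧ ε ^ p * K ≤ 4⁻¹ := by
    have h1 : Tendsto (fun ε : ℝ≥0∞ ↦ ε ^ p * K) (𝓝 0) (𝓝 0) := by
      have h2 := (ENNReal.continuous_rpow_const (y := p)).tendsto 0
      rw [ENNReal.zero_rpow_of_pos hp0] at h2
      have h3 := ENNReal.Tendsto.mul_const h2 (Or.inr hK.ne)
      rwa [zero_mul] at h3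
    have h2 := h1.eventually (Iic_mem_nhds (by simp : (0 : ℝ≥0∞) < 4⁻¹))
    have h3 : ∀ᶠ n : ℕ in atTop, ((n : ℝ≥0∞)⁻¹) ^ p * K ≤ 4⁻¹ :=
      ENNReal.tendsto_inv_nat_nhds_zero.eventually h2
    obtain ⟨n, hn1, hn2⟩ := (h3.and (eventually_ge_atTop 1)).exists
    refine ⟨(n : ℝ≥0∞)⁻¹, by simp, ?_, hn1⟩
    simp only [ne_eq, ENNReal.inv_eq_top, Nat.cast_eq_zero]
    omega
  set E : Set Plane := {v | ε < U v} with hE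
  have hEm : MeasurableSet E := measurableSet_lt measurable_const hU
  have hEfin : volume E < ⊤ := by
    have h1 := meas_ge_le_lintegral_div (μ := (volume : Measure Plane))
      (hU.pow_const (2 : ℝ)).aemeasurable (ε := ε ^ (2 : ℝ)) (by simp [hε0]) (by simp [hεt])
    refine lt_of_le_of_lt (measure_mono fun v hv ↦ ?_) (h1.trans_lt
      (ENNReal.div_lt_top hL2.ne (by simp [hε0])))
    exact ENNReal.rpow_le_rpow (le_of_lt hv) zero_le_two
  obtain ⟨R, hR0, hR⟩ := exists_lintegral_wt_indicator_le hA hc ha1 hb hEm hEfin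
    (η := 4⁻¹ * (B ^ p + 1)⁻¹) (by simp [hBp.ne])
  have hR' : ∀ w, B ^ p * ∫⁻ v, W v * (E ∩ {x | R < ‖x‖}).indicator 1 (w + v) ∂ρ ≤ 4⁻¹ := by
    intro w
    calc _ ≤ (B ^ p + 1) * (4⁻¹ * (B ^ p + 1)⁻¹) := by
          gcongr
          · exact le_self_add
          · exact hR w
      _ = 4⁻¹ * ((B ^ p + 1) * (B ^ p + 1)⁻¹) := by ring
      _ = 4⁻¹ := by
          rw [ENNReal.mul_inv_cancel (by simp) (ENNReal.add_lt_top.2 ⟨hBp, by simp⟩).ne, mul_one]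
  set D : ℝ≥0∞ := ENNReal.ofReal ((1 + R) ^ a * Real.exp (b * R)) * B ^ (p + 1) with hD
  have hDt : D < ⊤ := ENNReal.mul_lt_top ENNReal.ofReal_lt_top
    (ENNReal.rpow_lt_top_of_nonneg hp1.le hB.ne)
  have hWR : ∀ x : Plane, ‖x‖ ≤ R → W x ≤ ENNReal.ofReal ((1 + R) ^ a * Real.exp (b * R)) := by
    intro x hx
    refine ENNReal.ofReal_le_ofReal ?_
    unfold wt
    have h0 := (norm_coord_le x 0).trans hx
    have h1 := (norm_coord_le x 1).trans hx
    gcongr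
  have main : ∀ n : ℕ, ∀ᵐ w, min (W w) n * U w ≤ 2 * (D * K) := by
    intro n
    -- Truncating the weight at `n` makes the weighted supremum finite beforehand, which absorption
    -- requires. Since `W ≥ 1`, the truncated weight still satisfies the product inequality; the
    -- final bound does not depend on `n`.
    set χ : Plane → ℝ≥0∞ := fun w ↦ min (W w) n with hχ
    have hχW : ∀ w, χ w ≤ W w := fun w ↦ min_le_left _ _
    have hχmul : ∀ w v, χ w ≤ χ (w + v) * W v := by
      intro w v
      have h1 : (1 : ℝ≥0∞) ≤ W v := by
        rw [hW]; exact ENNReal.one_le_ofReal.2 (one_le_wt ha0 hb0 v)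
      rcases min_choice (W (w + v)) (n : ℝ≥0∞) with h | h
      · simp only [hχ]
        rw [h]
        refine (min_le_left _ _).trans ?_
        simp only [hW]
        rw [← ENNReal.ofReal_mul (wt_pos a b _).le]
        exact ENNReal.ofReal_le_ofReal (wt_le_wt_mul ha0 hb0 w v)
      · simp only [hχ]
        rw [h]
        calc _ ≤ (n : ℝ≥0∞) * 1 := by rw [mul_one]; exact min_le_right _ _
          _ ≤ _ := by gcongr
    set S : ℝ≥0∞ := essSup (fun w ↦ χ w * U w) volume with hS
    have hSae : ∀ᵐ w, χ w * U w ≤ S := ae_le_essSup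
    have hSt : S ≠ ⊤ := by
      refine ne_top_of_le_ne_top (ENNReal.mul_ne_top (by simp : (n : ℝ≥0∞) ≠ ⊤) hB.ne)
        (essSup_le_of_ae_le _ ?_)
      filter_upwards [hUB] with w hw
      gcongr
      exact min_le_right _ _
    set E' := E ∩ {x : Plane | R < ‖x‖} with hE'
    have hE'm : MeasurableSet E' := hEm.inter (measurableSet_lt measurable_const measurable_norm)
    -- Three regions: small `U`, large `U` far out, and large `U` in the ball of radius `R`, where
    -- the weight is bounded.
    have hpt : ∀ x, U x ≤ B → χ x * U x ≤ S → χ x * U x ^ (p + 1) ≤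
        ε ^ p * S + B ^ p * S * E'.indicator 1 x + D := by
      intro x hx1 hx2
      have hsplit : χ x * U x ^ (p + 1) = U x ^ p * (χ x * U x) := by
        rw [ENNReal.rpow_add_of_nonneg _ _ hp0.le zero_le_one, ENNReal.rpow_one]; ring
      rcases le_or_gt (U x) ε with h | h
      · rw [hsplit]
        calc _ ≤ ε ^ p * S := by gcongr
          _ ≤ _ := by rw [add_assoc]; exact le_self_add
      rcases le_or_gt ‖x‖ R with h' | h'
      · refine le_trans ?_ le_add_self
        rw [hD]
        gcongr
        exact (hχW x).trans (hWR x h')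
      · rw [hsplit, Set.indicator_of_mem (show x ∈ E' from ⟨h, h'⟩), Pi.one_apply, mul_one]
        calc _ ≤ B ^ p * S := by gcongr
          _ ≤ _ := le_add_right le_add_self
    have hfin : ∀ᵐ w, χ w * U w ≤ 2⁻¹ * S + D * K := by
      filter_upwards [hle] with w hw
      have hae := ae_comp_add_resolvent A c (hUB.and hSae) w
      have hm1 : Measurable fun v ↦ W v * E'.indicator (1 : Plane → ℝ≥0∞) (w + v) :=
        hWm.mul ((measurable_one.indicator hE'm).comp (by fun_prop))
      have hm0 : Measurable fun v ↦ U (w + v) ^ (p + 1) :=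
        (hU.pow_const _).comp (measurable_const_add w)
      have hm2 : Measurable fun v ↦ (ε ^ p * S) * W v +
          (B ^ p * S) * (W v * E'.indicator (1 : Plane → ℝ≥0∞) (w + v)) :=
        (hWm.const_mul _).add (hm1.const_mul _)
      calc χ w * U w ≤ χ w * ∫⁻ v, U (w + v) ^ (p + 1) ∂ρ := by gcongr
        _ = ∫⁻ v, χ w * U (w + v) ^ (p + 1) ∂ρ := by
            rw [lintegral_const_mul _ hm0]
        _ ≤ ∫⁻ v, (ε ^ p * S) * W v + (B ^ p * S) * (W v * E'.indicator 1 (w + v)) +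
              D * W v ∂ρ := by
            refine lintegral_mono_ae (hae.mono fun v hv ↦ ?_)
            calc _ ≤ (χ (w + v) * W v) * U (w + v) ^ (p + 1) := by gcongr; exact hχmul w v
              _ = (χ (w + v) * U (w + v) ^ (p + 1)) * W v := by ring
              _ ≤ (ε ^ p * S + B ^ p * S * E'.indicator 1 (w + v) + D) * W v := by
                  gcongr; exact hpt _ hv.1 hv.2
              _ = _ := by ring
        _ = (ε ^ p * K) * S + (B ^ p * ∫⁻ v, W v * E'.indicator 1 (w + v) ∂ρ) * S + D * K := by
            rw [lintegral_add_left hm2,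
              lintegral_add_left (hWm.const_mul _), lintegral_const_mul _ hWm,
              lintegral_const_mul _ hm1, lintegral_const_mul _ hWm]
            ring
        _ ≤ 4⁻¹ * S + 4⁻¹ * S + D * K := by
            gcongr
            exact hR' w
        _ = _ := by
            rw [← add_mul]
            congr 2
            rw [← two_mul, show (4 : ℝ≥0∞) = 2 * 2 by norm_num,
              ENNReal.mul_inv (by simp) (by simp), ← mul_assoc,
              ENNReal.mul_inv_cancel two_ne_zero ENNReal.ofNat_ne_top, one_mul]
    have hSle : S ≤ 2⁻¹ * S + D * K := essSup_le_of_ae_le _ hfin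
    have := ennreal_le_of_le_half_add hSt hSle
    filter_upwards [hSae] with w hw using hw.trans this
  refine ⟨2 * (D * K), ENNReal.mul_lt_top (by simp) (ENNReal.mul_lt_top hDt hK), ?_⟩
  filter_upwards [ae_all_iff.2 main] with w hw
  obtain ⟨n, hn⟩ := ENNReal.exists_nat_gt (ENNReal.ofReal_ne_top : W w ≠ ⊤)
  have := hw n
  rwa [min_eq_left hn.le] at this

/-! ### Bootstrap of the decay in `x` up to the quadratic rate. -/

theorem one_add_abs_rpow_le {a : ℝ} (ha0 : 0 ≤ a) (ha2 : a ≤ 2) (x z : ℝ) :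
    (1 + |x|) ^ a ≤ 4 * ((1 + |x + z|) ^ a + |z| ^ a) := by
  have h0 : |x| ≤ |x + z| + |z| := by simpa using abs_sub (x + z) z
  have hm : 0 ≤ max (1 + |x + z|) |z| := le_max_of_le_right (abs_nonneg z)
  have h1 : 1 + |x| ≤ 2 * max (1 + |x + z|) |z| := by
    have := le_max_left (1 + |x + z|) |z|
    have := le_max_right (1 + |x + z|) |z|
    linarith
  have h2 : (2 : ℝ) ^ a ≤ 4 := by
    calc (2 : ℝ) ^ a ≤ 2 ^ (2 : ℝ) := Real.rpow_le_rpow_of_exponent_le one_le_two ha2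
      _ = 4 := by norm_num
  have h3 : max (1 + |x + z|) |z| ^ a ≤ (1 + |x + z|) ^ a + |z| ^ a := by
    have e1 : 0 ≤ (1 + |x + z|) ^ a := by positivity
    have e2 : 0 ≤ |z| ^ a := by positivity
    rcases max_choice (1 + |x + z|) |z| with h | h <;> rw [h] <;> linarith
  calc _ ≤ (2 * max (1 + |x + z|) |z|) ^ a := Real.rpow_le_rpow (by positivity) h1 ha0
    _ = 2 ^ a * max (1 + |x + z|) |z| ^ a := Real.mul_rpow zero_le_two hm
    _ ≤ _ := by gcongr

/-- For `a ≥ 1` the weight is no longer integrable against the fundamental solution. Here the power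
of `x` falls on one factor at a time, on the unknown or on the kernel, and only the exponential is
shared. -/
theorem wt_le_add {a b : ℝ} (ha0 : 0 ≤ a) (ha2 : a ≤ 2) (hb0 : 0 ≤ b) (w v : Plane) :
    wt a b w ≤ 4 * (wt a b (w + v) * wt 0 b v) +
      4 * ((|v 0| ^ a * Real.exp (b * |v 1|)) * wt 0 b (w + v)) := by
  have h1 := one_add_abs_rpow_le ha0 ha2 (w 0) (v 0)
  have h2 : Real.exp (b * |w 1|) ≤ Real.exp (b * |w 1 + v 1|) * Real.exp (b * |v 1|) := by
    rw [← Real.exp_add, ← mul_add]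
    have : |w 1| ≤ |w 1 + v 1| + |v 1| := by simpa using abs_sub (w 1 + v 1) (v 1)
    gcongr
  unfold wt
  simp only [PiLp.add_apply, Real.rpow_zero, one_mul]
  calc _ ≤ (4 * ((1 + |w 0 + v 0|) ^ a + |v 0| ^ a)) *
        (Real.exp (b * |w 1 + v 1|) * Real.exp (b * |v 1|)) := by gcongr
    _ = _ := by ring

/-- Improvement of the rate of decay in `x` by the nonlinearity. -/
theorem exists_ae_wt_mul_le_min (hA : 0 < A) (hc : 0 < c) (hp0 : 0 < p) (hU : Measurable U)
    (hle : ∀ᵐ w, U w ≤ ∫⁻ v, U (w + v) ^ (p + 1) ∂resolvent A c)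
    {a b : ℝ} (ha : 1 < a * (1 + p)) (hb0 : 0 < b) (hb : 4 * b ^ 2 ≤ c)
    (h : ∃ C : ℝ≥0∞, C < ⊤ ∧ ∀ᵐ w, ENNReal.ofReal (wt a b w) * U w ≤ C) :
    ∃ C : ℝ≥0∞, C < ⊤ ∧
      ∀ᵐ w, ENNReal.ofReal (wt (min 2 (a * (1 + p))) b w) * U w ≤ C := by
  obtain ⟨C₁, hC₁, hae⟩ := h
  set a' := min 2 (a * (1 + p)) with ha'
  have ha'2 : a' ≤ 2 := min_le_left _ _
  have ha'1 : 1 < a' := lt_min one_lt_two ha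
  have hp1 : 0 < p + 1 := by linarith
  set ρ := resolvent A c with hρ
  have hK := lintegral_wt_resolvent_lt_top hA hc zero_lt_one hb
  obtain ⟨C₂, hC₂, hC₂f⟩ := exists_lintegral_abs_rpow_mul_exp_resolvent_le hA hc
    (by linarith : 1 / 2 < a') ha'2 hb
  have hCp : C₁ ^ (p + 1) < ⊤ := ENNReal.rpow_lt_top_of_nonneg hp1.le hC₁.ne
  have hpow : ∀ᵐ w, ENNReal.ofReal (wt a b w ^ (p + 1)) * U w ^ (p + 1) ≤ C₁ ^ (p + 1) := by
    filter_upwards [hae] with w hw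
    have := ENNReal.rpow_le_rpow hw hp1.le
    rwa [ENNReal.mul_rpow_of_nonneg _ _ hp1.le,
      ENNReal.ofReal_rpow_of_nonneg (wt_pos a b w).le hp1.le] at this
  have hwpow : ∀ w, wt a b w ^ (p + 1) =
      (1 + |w 0|) ^ (a * (1 + p)) * Real.exp (b * (p + 1) * |w 1|) := by
    intro w
    unfold wt
    rw [Real.mul_rpow (by positivity) (by positivity), ← Real.rpow_mul (by positivity),
      ← Real.exp_mul]
    congr 2 <;> ring
  have h1 : ∀ᵐ w, ENNReal.ofReal (wt a' b w) * U w ^ (p + 1) ≤ C₁ ^ (p + 1) := by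
    filter_upwards [hpow] with w hw
    refine le_trans ?_ hw
    gcongr ENNReal.ofReal ?_ * _
    rw [hwpow]
    unfold wt
    gcongr
    · linarith [abs_nonneg (w 0)]
    · exact min_le_right _ _
    · nlinarith
  -- When the weight falls on the kernel, the kernel is merely bounded and `U^{p+1}` must be
  -- integrable with weight `e^{b|y|}`. It is: `a(1+p) > 1` handles `x`, and the spare factor
  -- `e^{-bp|y|}` handles `y`.
  set J : ℝ≥0∞ := (∫⁻ x : ℝ, ENNReal.ofReal ((1 + |x|) ^ (-(a * (1 + p))))) *
    ∫⁻ y : ℝ, ENNReal.ofReal (Real.exp (-(b * p) * |y|)) with hJ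
  have hJt : J < ⊤ := by
    have i1 := (integrable_one_add_norm (E := ℝ) (μ := volume) (r := a * (1 + p)) (by simpa))
    have i2 := integrable_exp_neg_abs (mul_pos hb0 hp0)
    exact ENNReal.mul_lt_top i1.lintegral_lt_top i2.lintegral_lt_top
  have h2 : ∫⁻ x, ENNReal.ofReal (wt 0 b x) * U x ^ (p + 1) ≤ C₁ ^ (p + 1) * J := by
    calc _ ≤ ∫⁻ x : Plane, C₁ ^ (p + 1) * (ENNReal.ofReal ((1 + |x 0|) ^ (-(a * (1 + p)))) *
          ENNReal.ofReal (Real.exp (-(b * p) * |x 1|))) := by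
          refine lintegral_mono_ae ?_
          filter_upwards [hpow] with x hx
          have e : ENNReal.ofReal (wt 0 b x) = ENNReal.ofReal ((1 + |x 0|) ^ (-(a * (1 + p)))) *
              ENNReal.ofReal (Real.exp (-(b * p) * |x 1|)) * ENNReal.ofReal (wt a b x ^ (p + 1)) := by
            rw [← ENNReal.ofReal_mul (by positivity), ← ENNReal.ofReal_mul (by positivity), hwpow]
            congr 1
            rw [mul_mul_mul_comm, ← Real.rpow_add (by positivity), ← Real.exp_add]
            unfold wt
            congr 2 <;> ring
          rw [e, mul_assoc, mul_comm (C₁ ^ (p + 1))]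
          gcongr
      _ = _ := by
          rw [lintegral_const_mul' _ _ hCp.ne, lintegral_plane_mul
            (f := fun x ↦ ENNReal.ofReal ((1 + |x|) ^ (-(a * (1 + p)))))
            (g := fun y ↦ ENNReal.ofReal (Real.exp (-(b * p) * |y|))) (by fun_prop) (by fun_prop)]
  refine ⟨4 * (C₁ ^ (p + 1) * ∫⁻ v, ENNReal.ofReal (wt 0 b v) ∂ρ) +
    4 * (C₂ * (C₁ ^ (p + 1) * J)), ?_, ?_⟩
  · exact ENNReal.add_lt_top.2 ⟨ENNReal.mul_lt_top (by simp) (ENNReal.mul_lt_top hCp hK),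
      ENNReal.mul_lt_top (by simp) (ENNReal.mul_lt_top hC₂ (ENNReal.mul_lt_top hCp hJt))⟩
  filter_upwards [hle] with w hw
  have hadd : Measurable fun v : Plane ↦ w + v := by fun_prop
  have hUw : Measurable fun v ↦ U (w + v) ^ (p + 1) := (hU.pow_const _).comp hadd
  have hw0 : Measurable fun v ↦ ENNReal.ofReal (wt 0 b v) := (measurable_wt 0 b).ennreal_ofReal
  have hf2 : Measurable fun x ↦ ENNReal.ofReal (wt 0 b x) * U x ^ (p + 1) :=
    hw0.mul (hU.pow_const _)
  have hw2 : Measurable fun v : Plane ↦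
      ENNReal.ofReal (|v 0| ^ a' * Real.exp (b * |v 1|)) := by fun_prop
  have hwf : Measurable fun v ↦ ENNReal.ofReal (|v 0| ^ a' * Real.exp (b * |v 1|)) *
      (ENNReal.ofReal (wt 0 b (w + v)) * U (w + v) ^ (p + 1)) := hw2.mul (hf2.comp hadd)
  calc _ ≤ ENNReal.ofReal (wt a' b w) * ∫⁻ v, U (w + v) ^ (p + 1) ∂ρ := by gcongr
    _ = ∫⁻ v, ENNReal.ofReal (wt a' b w) * U (w + v) ^ (p + 1) ∂ρ := by
        rw [lintegral_const_mul _ hUw]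
    _ ≤ ∫⁻ v, 4 * (C₁ ^ (p + 1) * ENNReal.ofReal (wt 0 b v)) +
          4 * (ENNReal.ofReal (|v 0| ^ a' * Real.exp (b * |v 1|)) *
            (ENNReal.ofReal (wt 0 b (w + v)) * U (w + v) ^ (p + 1))) ∂ρ := by
        refine lintegral_mono_ae ((ae_comp_add_resolvent A c h1 w).mono fun v hv ↦ ?_)
        have hwt := ENNReal.ofReal_le_ofReal
          (wt_le_add (by linarith : 0 ≤ a') ha'2 hb0.le w v)
        have p1 := (wt_pos a' b (w + v)).le
        have p2 := (wt_pos 0 b v).le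
        have p3 := (wt_pos 0 b (w + v)).le
        rw [ENNReal.ofReal_add (by positivity) (by positivity), ENNReal.ofReal_mul (by positivity),
          ENNReal.ofReal_mul p1, ENNReal.ofReal_mul (by positivity),
          ENNReal.ofReal_mul (by positivity)] at hwt
        norm_num at hwt
        calc _ ≤ _ := mul_le_mul_left hwt _
          _ = 4 * ((ENNReal.ofReal (wt a' b (w + v)) * U (w + v) ^ (p + 1)) *
                ENNReal.ofReal (wt 0 b v)) +
              4 * (ENNReal.ofReal (|v 0| ^ a' * Real.exp (b * |v 1|)) *
                (ENNReal.ofReal (wt 0 b (w + v)) * U (w + v) ^ (p + 1))) := by ring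
          _ ≤ _ := by gcongr
    _ = 4 * (C₁ ^ (p + 1) * ∫⁻ v, ENNReal.ofReal (wt 0 b v) ∂ρ) +
          4 * ∫⁻ v, ENNReal.ofReal (|v 0| ^ a' * Real.exp (b * |v 1|)) *
            (ENNReal.ofReal (wt 0 b (w + v)) * U (w + v) ^ (p + 1)) ∂ρ := by
        rw [lintegral_add_left ((hw0.const_mul _).const_mul _), lintegral_const_mul _
          (hw0.const_mul _), lintegral_const_mul _ hw0, lintegral_const_mul _ hwf]
    _ ≤ _ := by
        gcongr
        exact (hC₂f _ hf2 w).trans (by gcongr)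

/-- Decay of subsolutions of the integral equation: quadratic in `x`, exponential in `y`. -/
theorem exists_ae_wt_two_mul_le (hA : 0 < A) (hc : 0 < c) (hp0 : 0 < p) (hp4 : p < 4)
    (hU : Measurable U) (hfin : ∀ v, U v ≠ ⊤)
    (hLr : ∀ r : ℝ, 2 ≤ r → r < 6 → ∫⁻ v, U v ^ r < ⊤)
    (hle : ∀ᵐ w, U w ≤ ∫⁻ v, U (w + v) ^ (p + 1) ∂resolvent A c) :
    ∃ b : ℝ, 0 < b ∧ ∃ C : ℝ≥0∞, C < ⊤ ∧ ∀ᵐ w, ENNReal.ofReal (wt 2 b w) * U w ≤ C := by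
  obtain ⟨B, hB, hUB⟩ := exists_ae_le_of_le_lintegral_resolvent hA hc hp0 hp4 hU hfin hLr hle
  set b := Real.sqrt c / 2 with hbdef
  have hb0 : 0 < b := by positivity
  have hb : 4 * b ^ 2 ≤ c := by rw [hbdef, div_pow, Real.sq_sqrt hc.le]; linarith
  refine ⟨b, hb0, ?_⟩
  -- The starting rate lies below `1` for the absorption argument, and above `1/(1+p)` so that the
  -- first improvement already passes `1`.
  obtain ⟨a₀, ha₀, ha₁⟩ := exists_between (show 1 / (1 + p) < 1 by
    rw [div_lt_one (by linarith)]; linarith)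
  have ha₀0 : 0 < a₀ := lt_trans (by positivity) ha₀
  have ha₀p : 1 < a₀ * (1 + p) := by rwa [div_lt_iff₀ (by linarith)] at ha₀
  have key : ∀ n : ℕ, ∃ C : ℝ≥0∞, C < ⊤ ∧
      ∀ᵐ w, ENNReal.ofReal (wt (min 2 (a₀ * (1 + p) ^ n)) b w) * U w ≤ C := by
    intro n
    induction n with
    | zero =>
      rw [pow_zero, mul_one, min_eq_right (by linarith)]
      exact exists_ae_wt_mul_le hA hc hp0 hU (hLr 2 le_rfl (by norm_num)) hB hUB hle ha₀0.le ha₁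
        hb0.le hb
    | succ n ih =>
      have hge : a₀ ≤ min 2 (a₀ * (1 + p) ^ n) :=
        le_min (by linarith) (le_mul_of_one_le_right ha₀0.le (one_le_pow₀ (by linarith)))
      have h := exists_ae_wt_mul_le_min hA hc hp0 hU hle
        (a := min 2 (a₀ * (1 + p) ^ n)) (by nlinarith) hb0 hb ih
      have e : min 2 (min 2 (a₀ * (1 + p) ^ n) * (1 + p)) = min 2 (a₀ * (1 + p) ^ (n + 1)) := by
        rw [pow_succ, ← mul_assoc]
        rcases le_total 2 (a₀ * (1 + p) ^ n) with h2 | h2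
        · rw [min_eq_left h2, min_eq_left (by nlinarith), min_eq_left (by nlinarith)]
        · rw [min_eq_right h2]
      rwa [e] at h
  -- The rate grows geometrically, so finitely many steps reach the cap `2`.
  obtain ⟨n, hn⟩ := pow_unbounded_of_one_lt (2 / a₀) (by linarith : 1 < 1 + p)
  have h := key n
  rw [div_lt_iff₀ ha₀0] at hn
  rwa [min_eq_left (by linarith)] at h

end Decay

/-! ### Comparison of polynomial weights and conclusion. -/

theorem rpow_mul_rpow_le_wt {b ℓ ϱ : ℝ} (hb : 0 < b) (hℓ₀ : 0 ≤ ℓ) (hℓ₂ : ℓ ≤ 2) (hϱ : 0 ≤ ϱ) :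
    ∃ C, 0 ≤ C ∧ ∀ v : Plane, |v 0| ^ ℓ * |v 1| ^ ϱ ≤ C * wt 2 b v := by
  obtain ⟨N, hN⟩ := exists_nat_ge ϱ
  -- The term of order `N` in the exponential series bounds `|y|^N` when `|y| ≥ 1`; the summand `1`
  -- covers `|y| ≤ 1`.
  refine ⟨1 + N.factorial / b ^ N, by positivity, fun v ↦ ?_⟩
  have h1 : |v 0| ^ ℓ ≤ (1 + |v 0|) ^ (2 : ℝ) := by
    calc _ ≤ (1 + |v 0|) ^ ℓ := by gcongr; linarith
      _ ≤ _ := Real.rpow_le_rpow_of_exponent_le (by linarith [abs_nonneg (v 0)]) hℓ₂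
  have h2 : |v 1| ^ ϱ ≤ (1 + N.factorial / b ^ N) * Real.exp (b * |v 1|) := by
    have he : 1 ≤ Real.exp (b * |v 1|) := Real.one_le_exp (by positivity)
    have hpow : |v 1| ^ N ≤ N.factorial / b ^ N * Real.exp (b * |v 1|) := by
      have := Real.pow_div_factorial_le_exp (b * |v 1|) (by positivity) N
      rw [div_le_iff₀ (by positivity), mul_pow] at this
      rw [div_mul_eq_mul_div, le_div_iff₀ (by positivity)]
      linarith
    rcases le_total |v 1| 1 with h | h
    · have h3 := Real.rpow_le_one (abs_nonneg (v 1)) h hϱ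
      have : 0 ≤ |v 1| ^ N := by positivity
      rw [add_mul, one_mul]; linarith
    · have h3 := Real.rpow_le_rpow_of_exponent_le h hN
      rw [Real.rpow_natCast] at h3
      rw [add_mul, one_mul]; linarith
  unfold wt
  calc _ ≤ (1 + |v 0|) ^ (2 : ℝ) * ((1 + N.factorial / b ^ N) * Real.exp (b * |v 1|)) := by gcongr
    _ = _ := by ring

end BOZK

end

theorem corollary4p19 (k m : ℕ) (hk : 0 < k) (hm : Odd m) (hkm : Nat.Coprime k m)
    (hp : (k : ℝ) / (m : ℝ) < 4)
    (c α ε : ℝ) (hε : ε = 1 ∨ ε = -1) (hαε : α * ε < 0) (hcα : c * α < 0)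
    (φ : BOZK.Plane → ℝ) (hφ : BOZK.IsSolitaryWave k m c α ε φ)
    (ℓ ϱ : ℝ) (hℓ₀ : 0 ≤ ℓ) (hℓ₂ : ℓ ≤ 2) (hϱ : 0 ≤ ϱ) :
    MemLp (fun v : BOZK.Plane => |v 0| ^ ℓ * |v 1| ^ ϱ * φ v) ⊤ volume := by
  have hm0 : 0 < m := hm.pos
  obtain ⟨u, hu, hφu, hLr, A, c₀, hA, hc₀, hle⟩ :=
    hφ.exists_measurable_rep hm0 hp hε hαε hcα
  obtain ⟨b, hb, C, hC, hdecay⟩ := BOZK.exists_ae_wt_two_mul_le (U := fun v ↦ ‖u v‖ₑ) hA hc₀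
    (by positivity : (0 : ℝ) < (k : ℝ) / m) hp hu.enorm (fun _ ↦ enorm_ne_top) hLr hle
  obtain ⟨K, hK, hweight⟩ := BOZK.rpow_mul_rpow_le_wt hb hℓ₀ hℓ₂ hϱ
  have hwm : Measurable fun v : BOZK.Plane ↦ |v 0| ^ ℓ * |v 1| ^ ϱ := by fun_prop
  refine memLp_top_of_bound (hwm.aestronglyMeasurable.mul
    (hu.aestronglyMeasurable.congr hφu.symm)) (K * C.toReal) ?_
  filter_upwards [hφu, hdecay] with v hv hd
  have hd' : BOZK.wt 2 b v * |u v| ≤ C.toReal := by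
    have := ENNReal.toReal_mono hC.ne hd
    rwa [ENNReal.toReal_mul, ENNReal.toReal_ofReal (BOZK.wt_pos 2 b v).le, toReal_enorm,
      Real.norm_eq_abs] at this
  rw [hv, norm_mul, Real.norm_eq_abs, Real.norm_eq_abs, abs_of_nonneg (by positivity)]
  calc _ ≤ K * BOZK.wt 2 b v * |u v| := mul_le_mul_of_nonneg_right (hweight v) (abs_nonneg _)
    _ = K * (BOZK.wt 2 b v * |u v|) := mul_assoc _ _ _
    _ ≤ _ := by gcongr
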